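/- **Setting.** There are $n$ clients with differentiable local losses $\mathcal L_i:\mathbb R^d\to\mathbb R$ and importances $p_i\ge 0$. Let $\eta_l,\eta_g>0$ be the local and global learning rates, $\tilde\eta=\eta_l\eta_g$, $K$ the number of local steps, and $a_{i,k}\ge 0$ ($0\le k<K$) scalars that client $i$ applies to its $k$-th gradient. Write $a_i=\|\mathbf a_i\|_1=\sum_k a_{i,k}$, $\|\mathbf a_i\|_2^2=\sum_k a_{i,k}^2$, $a_{i,-1}=a_{i,K-1}$, $K_{eff}=\sum_i p_ia_i$ (assumed positive), $w_i=p_ia_i/K_{eff}$, and let $\tilde{\mathcal L}=\sum_i w_i\mathcal L_i$ be the surrogate objective, assumed bounded below, with $\tilde{\mathcal L}^*=\inf\tilde{\mathcal L}$. From a deterministic $\theta^0\in\mathbb R^d$, in round $t$ every client performs $y_{i,0}^t=\theta^t$, $y_{i,k+1}^t=y_{i,k}^t-\eta_l a_{i,k}\,g_i(y_{i,k}^t,\xi_{i,k}^t)$ for $k<K$, and the server sets $\theta^{t+1}=\theta^t+\eta_g\sum_i\omega_i(S_t)\,(y_{i,K}^t-\theta^t)$. The batches $\xi_{i,k}^t$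 (of a law that depends only on $i$) and the client samplings $S_t$ (identically distributed) are all mutually independent. **Assumptions.** 1. $\|\nabla\mathcal L_i(x)-\nabla\mathcal L_i(y)\|\le L\|x-y\|$ for all $i,x,y$, where $L\ge0$. 2. With constants $\beta^2\ge1$ and $\kappa^2\ge0$: for all weights $v_i\ge0$ with $\sum_iv_i=1$ and all $x$, $\sum_iv_i\|\nabla\mathcal L_i(x)\|^2\le\beta^2\|\nabla\tilde{\mathcal L}(x)\|^2+\kappa^2$. 3. For all $i,x$: $\mathbb E_{\xi_i}[g_i(x,\xi_i)]=\nabla\mathcal L_i(x)$ and $\mathbb E_{\xi_i}\|g_i(x,\xi_i)-\nabla\mathcal L_i(x)\|^2\le\sigma^2$. 4. The $\omega_i(S_t)$ are square integrable with $\mathbb E[\omega_i]=p_i$ and $\mathrm{Cov}(\omega_i,\omega_j)=-\alpha p_ip_j$ for $i\ne j$, and $\gamma_i:=\mathrm{Var}(\omega_i)+\alpha p_i^2\ge0$ for all $i$. **Constants.** For the number $m\ge1$ of sampled clients, put $$A=\frac m{K_{eff}}\sum_i\big(\mathrm{Var}(\omega_i)+p_i^2\big)\|\mathbf a_i\|_2^2,\qquad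 B=\sum_iw_i\big(\|\mathbf a_i\|_2^2-a_{i,-1}^2\big),\qquad C=\max_i a_i(a_i-a_{i,-1}),$$ $$D=\frac{C}{K_{eff}}\Big(\sum_i\mathrm{Var}(\omega_i)+\alpha\sum_ip_i^2\Big),\qquad E=\frac{\max_ia_i^2}{K_{eff}}\Big(\sum_i\mathrm{Var}(\omega_i)+\alpha\sum_ip_i^2\Big),$$ $$R=2\eta_l^2L^2C,\qquad R'=2\eta_l^2L^2\max_ia_i^2,\qquad \Omega=\frac{3L\tilde\eta\beta^2}{2K_{eff}}\sum_i\gamma_ia_i^2,$$ and $A'=A/(1-\Omega)$, $B'=B/(1-\Omega)$, $C'=C/(1-\Omega)$. **Theorem.** Assume the step-size conditions $R\le\frac1{2\beta^2+1}$, $R'<1$, $1-L\tilde\eta(1-\alpha)K_{eff}>0$ and $\Omega\le\frac12$. Then for every $T\ge1$ the variables $\|\nabla\tilde{\mathcal L}(\theta^t)\|^2$, $t<T$, are integrable and $$\frac1T\sum_{t=0}^{T-1}\mathbb E\|\nabla\tilde{\mathcal L}(\theta^t)\|^2\le\frac{4(\tilde{\mathcal L}(\theta^0)-\tilde{\mathcal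 L}^*)}{(1-\Omega)\tilde\eta K_{eff}T}+\frac{2L\tilde\eta A'\sigma^2}{m}+3\eta_l^2L^2B'\sigma^2+6\eta_l^2L^2C'\kappa^2+3L\tilde\eta D\sigma^2+6L\tilde\eta E\kappa^2.$$ -/

import Mathlib

open MeasureTheory ProbabilityTheory

noncomputable section

/-- The data of a federated learning scheme with `n` clients and parameter space `ℝ^d`
(data only, no assumptions). `Ξ` is the type of sample batches and `𝒮` the type of outcomes of the
client sampling. -/
structure FedScheme (n d : ℕ) (Ξ 𝒮 : Type*) [MeasurableSpace Ξ] [MeasurableSpace 𝒮] where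
  /-- local loss function of each client -/
  loss : Fin n → EuclideanSpace ℝ (Fin d) → ℝ
  /-- stochastic gradient of client `i` at a point, computed on a batch -/
  g : Fin n → EuclideanSpace ℝ (Fin d) → Ξ → EuclideanSpace ℝ (Fin d)
  /-- law of a random batch of client `i` -/
  batchLaw : Fin n → Measure Ξ
  /-- aggregation weight of client `i`, given the outcome of the client sampling -/
  ω : Fin n → 𝒮 → ℝ
  /-- law of the client sampling of one round -/
  samplingLaw : Measure 𝒮
  /-- importance of client `i` -/
  p : Fin n → ℝ
  /-- covariance parameter of the client sampling -/
  α : ℝ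
  /-- number of local steps -/
  K : ℕ
  /-- scalar applied by client `i` to its `k`-th gradient, `k < K` -/
  a : Fin n → ℕ → ℝ
  /-- local learning rate -/
  ηl : ℝ
  /-- global learning rate -/
  ηg : ℝ

namespace FedScheme

variable {n d : ℕ} {Ξ 𝒮 : Type*} [MeasurableSpace Ξ] [MeasurableSpace 𝒮]

/-! ### The algorithm -/

/-- The local model of client `i` after `k` local steps started at `x`, where step `k` uses the
batch `ζ k`. -/
def localModel (F : FedScheme n d Ξ 𝒮) (i : Fin n) (x : EuclideanSpace ℝ (Fin d)) (ζ : ℕ → Ξ) :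
    ℕ → EuclideanSpace ℝ (Fin d)
  | 0 => x
  | k + 1 => F.localModel i x ζ k - (F.ηl * F.a i k) • F.g i (F.localModel i x ζ k) (ζ k)

/-- The global model after `t` rounds: `s t` is the outcome of the client sampling of round `t` and
`ζ t i k` is the batch of client `i` in its local step `k` of round `t`. -/
def globalModel (F : FedScheme n d Ξ 𝒮) (θ₀ : EuclideanSpace ℝ (Fin d)) (s : ℕ → 𝒮)
    (ζ : ℕ → Fin n → ℕ → Ξ) : ℕ → EuclideanSpace ℝ (Fin d)
  | 0 => θ₀
  | t + 1 => F.globalModel θ₀ s ζ t + F.ηg • ∑ i, F.ω i (s t) •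
      (F.localModel i (F.globalModel θ₀ s ζ t) (ζ t i) F.K - F.globalModel θ₀ s ζ t)

/-! ### Derived quantities -/

/-- `a_i = ‖a_i‖₁` -/
def a1 (F : FedScheme n d Ξ 𝒮) (i : Fin n) : ℝ := ∑ k ∈ Finset.range F.K, |F.a i k|

/-- `‖a_i‖₂²` -/
def a2sq (F : FedScheme n d Ξ 𝒮) (i : Fin n) : ℝ := ∑ k ∈ Finset.range F.K, F.a i k ^ 2

/-- `a_{i,-1}`, the last entry of `a_i` -/
def aLast (F : FedScheme n d Ξ 𝒮) (i : Fin n) : ℝ := F.a i (F.K - 1)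

/-- The effective learning rate `η̃ = η_l η_g`. -/
def ηeff (F : FedScheme n d Ξ 𝒮) : ℝ := F.ηl * F.ηg

/-- `K_eff = ∑ p_i a_i` -/
def Keff (F : FedScheme n d Ξ 𝒮) : ℝ := ∑ i, F.p i * F.a1 i

/-- `w_i = p_i a_i / ∑ p_j a_j` -/
def w (F : FedScheme n d Ξ 𝒮) (i : Fin n) : ℝ := F.p i * F.a1 i / F.Keff

/-- The surrogate objective `∑ w_i L_i`. -/
def surrogate (F : FedScheme n d Ξ 𝒮) (x : EuclideanSpace ℝ (Fin d)) : ℝ :=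
  ∑ i, F.w i * F.loss i x

/-- The variance of the aggregation weight of client `i`. -/
def varω (F : FedScheme n d Ξ 𝒮) (i : Fin n) : ℝ := Var[F.ω i; F.samplingLaw]

/-- `γ_i = Var ω_i + α p_i²` -/
def γ (F : FedScheme n d Ξ 𝒮) (i : Fin n) : ℝ := F.varω i + F.α * F.p i ^ 2

/-- `A`, for `m` sampled clients -/
def cA (F : FedScheme n d Ξ 𝒮) (m : ℕ) : ℝ :=
  m * (1 / F.Keff) * ∑ i, (F.varω i + F.p i ^ 2) * F.a2sq i

def cB (F : FedScheme n d Ξ 𝒮) : ℝ := ∑ i, F.w i * (F.a2sq i - F.aLast i ^ 2)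

def cC (F : FedScheme n d Ξ 𝒮) : ℝ := ⨆ i, F.a1 i * (F.a1 i - F.aLast i)

def cD (F : FedScheme n d Ξ 𝒮) : ℝ :=
  1 / F.Keff * F.cC * (∑ i, F.varω i + F.α * ∑ i, F.p i ^ 2)

def cE (F : FedScheme n d Ξ 𝒮) : ℝ :=
  1 / F.Keff * (⨆ i, F.a1 i ^ 2) * (∑ i, F.varω i + F.α * ∑ i, F.p i ^ 2)

/-- `R = 2 η_l² L² max_i a_i (a_i - a_{i,-1})` -/
def R (F : FedScheme n d Ξ 𝒮) (L : ℝ) : ℝ := 2 * F.ηl ^ 2 * L ^ 2 * F.cC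

/-- `R' = 2 η_l² L² max_i a_i²` -/
def R' (F : FedScheme n d Ξ 𝒮) (L : ℝ) : ℝ := 2 * F.ηl ^ 2 * L ^ 2 * ⨆ i, F.a1 i ^ 2

/-- `Ω = (3/2) L η̃ β² (∑ γ_i a_i²) / K_eff` -/
def Ω (F : FedScheme n d Ξ 𝒮) (L β : ℝ) : ℝ :=
  L * F.ηeff * (1 / F.Keff) * (3 / 2) * (∑ i, F.γ i * F.a1 i ^ 2) * β ^ 2

/-! ### Assumptions -/

/-- The local losses are differentiable with `L`-Lipschitz gradients. -/
def Smooth (F : FedScheme n d Ξ 𝒮) (L : ℝ) : Prop :=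
  ∀ i, Differentiable ℝ (F.loss i) ∧
    ∀ x y, ‖gradient (F.loss i) x - gradient (F.loss i) y‖ ≤ L * ‖x - y‖

/-- Bounded gradient dissimilarity: every convex combination of the squared norms of the local
gradients is controlled by the gradient of the surrogate objective. -/
def BoundedDissimilarity (F : FedScheme n d Ξ 𝒮) (β κ : ℝ) : Prop :=
  ∀ v : Fin n → ℝ, (∀ i, 0 ≤ v i) → ∑ i, v i = 1 → ∀ x,
    ∑ i, v i * ‖gradient (F.loss i) x‖ ^ 2 ≤ β ^ 2 * ‖gradient F.surrogate x‖ ^ 2 + κ ^ 2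

/-- The stochastic gradients are unbiased and have variance at most `σ²`. -/
structure UnbiasedBoundedVariance (F : FedScheme n d Ξ 𝒮) (σ : ℝ) : Prop where
  measurable : ∀ i, Measurable (Function.uncurry (F.g i))
  integrable : ∀ i x, Integrable (F.g i x) (F.batchLaw i)
  unbiased : ∀ i x, ∫ ξ, F.g i x ξ ∂(F.batchLaw i) = gradient (F.loss i) x
  integrable_sq : ∀ i x,
    Integrable (fun ξ => ‖F.g i x ξ - gradient (F.loss i) x‖ ^ 2) (F.batchLaw i)
  variance_le : ∀ i x,
    ∫ ξ, ‖F.g i x ξ - gradient (F.loss i) x‖ ^ 2 ∂(F.batchLaw i) ≤ σ ^ 2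

/-- The aggregation weights are square integrable, with `E ω_i = p_i` and
`Cov(ω_i, ω_j) = -α p_i p_j` for `i ≠ j`. -/
structure SamplingAssumption (F : FedScheme n d Ξ 𝒮) : Prop where
  measurable : ∀ i, Measurable (F.ω i)
  memLp : ∀ i, MemLp (F.ω i) 2 F.samplingLaw
  mean : ∀ i, ∫ s, F.ω i s ∂F.samplingLaw = F.p i
  cov : ∀ i j, i ≠ j → cov[F.ω i, F.ω j; F.samplingLaw] = -F.α * F.p i * F.p j

/-- `S t` (the client sampling of round `t`) and `ξ t i k` (the batch of client `i` in local step
`k` of round `t`) have the prescribed laws and are all mutually independent. -/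
structure IsRandomness (F : FedScheme n d Ξ 𝒮) {X : Type*} [MeasurableSpace X] (P : Measure X)
    (S : ℕ → X → 𝒮) (ξ : ℕ → Fin n → ℕ → X → Ξ) : Prop where
  measurable_S : ∀ t, Measurable (S t)
  measurable_ξ : ∀ t i k, Measurable (ξ t i k)
  law_S : ∀ t, P.map (S t) = F.samplingLaw
  law_ξ : ∀ t i k, P.map (ξ t i k) = F.batchLaw i
  indep_S : iIndepFun S P
  indep_ξ : iIndepFun (fun (q : ℕ × Fin n × ℕ) => ξ q.1 q.2.1 q.2.2) P
  indep_S_ξ : IndepFun (fun x t => S t x)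
    (fun x (q : ℕ × Fin n × ℕ) => ξ q.1 q.2.1 q.2.2 x) P

/-- The random global model `θ^t`. -/
def θ (F : FedScheme n d Ξ 𝒮) {X : Type*} (θ₀ : EuclideanSpace ℝ (Fin d))
    (S : ℕ → X → 𝒮) (ξ : ℕ → Fin n → ℕ → X → Ξ) (t : ℕ) (x : X) : EuclideanSpace ℝ (Fin d) :=
  F.globalModel θ₀ (fun t => S t x) (fun t i k => ξ t i k x) t

end FedScheme

end

/-!
The proof analyses a single round started at a fixed `θ` and then chains the rounds, using that `θ^t`
is independent of the randomness of round `t`.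

*Descent.* The surrogate has `L`-Lipschitz gradient, so the descent lemma bounds its expected value
after a round by the mean and the second moment of `U = ∑ ω_i h_i`, where `h_i` is the sum of the
scaled stochastic gradients of client `i`. The `h_i` are independent of each other and of the
weights, hence (`integral_norm_sum_smul_sq`)
`E‖U‖² = ∑ (Var ω_i + p_i²) Var h_i + ∑ γ_i ‖E h_i‖² + (1 - α) ‖∑ p_i E h_i‖²`.
The mean of `U` is `K_eff u`, and `-⟪∇, u⟫ + ‖u‖²/2 = ‖u - ∇‖²/2 - ‖∇‖²/2`, where the step-size
condition `1 - L η̃ (1 - α) K_eff > 0` absorbs the last term of `E‖U‖²`. What remains to be bounded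
are the variance of `h_i` and the distance `d_i` of `E h_i / a_i` from `∇L_i(θ)`.

*Local steps.* Let `V_k` be the variance of the gradient accumulated in `k` steps, `v_k` the variance
of the `k`-th exact gradient and `D_k` the distance of its mean from `∇L_i(θ)`. Orthogonality of the
noise to the past and Minkowski's inequality bound `V_{k+1}` by `V_k` and `v_k`, and smoothness bounds
`v_k` and `v_k + D_k²` by the past (`IsLocalRun`, verified in `FedScheme.isLocalRun`). After rescaling
by `q = η_l L`, these recursions are solved with the growth factors `∏_{l ≥ j} (1 + q a_l)`:
`variance_le` for the variance, `drift_sq_le` for the drift, and `variance_add_drift_sq_le` for the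
sum of the two, which is controlled by one potential so that the gradient term is paid for only once.

*Constants.* With `Q = q² C ≤ 1/6` the growth factors are bounded by polynomials in `t = q (a_i - a_{i,-1})`
and `z = q a_{i,-1}`, and the bounds reduce to polynomial inequalities on the region
`t (t + z) ≤ 1/6`, `(t + z)² ≤ 1/2`. The drift costs `driftCoeff Q ‖∇L_i‖²`; the condition
`R ≤ 1 / (2β² + 1)` says that `4 Q β² ≤ 1 - 2 Q`, so that after dissimilarity a multiple `rhoZero Q` of
`‖∇‖²` survives. The terms with `γ_i` use up the part of it that is proportional to `Ω`, and
`descentRate = (1 - Ω) ρ` with `ρ > 1/4` is left. The noise terms carry factors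
`4ρ`, `6ρ`, `3ρ` chosen so that division by the descent rate gives the constants of the theorem; this
is where `noise_le`, `noise_drift_le` and `excess_noise_le` are needed in their sharp form.
They are put together in `round_step_le`.

*Chaining.* As the surrogate is bounded below, the one-round inequality also yields, by induction, the
integrability of its values and of `‖∇‖²` along the iterates. Summation over `t` gives the theorem.
-/

section
set_option maxHeartbeats 1000000
open Finset
open scoped InnerProductSpace

/-! ### Polynomial inequalities -/
theorem growth_drift_coeff_two_le {u : ℝ} (hu : 0 ≤ u) (hv : 0 ≤ 1 - u) :
   (4/3*u^2-1.4*u^3+1/3*u^4) ≤ 0.54*u -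
       (((1-u)*u^3/10)+(u-u^2/2)*((1-u)*u^2/3+u^3/10)+((1-u)*u^2/2+0.186*u^3)*(u-2*u^2/3) +
       (71/100)*((u-u^2/2)*((1-u)*u^3/10)+((1-u)*u^2/2+0.186*u^3)*((1-u)*u^2/3+u^3/10)+
         (0.186*(1-u)*u^3)*(u-2*u^2/3))+
       (71/100)^2*(((1-u)*u^2/2+0.186*u^3)*((1-u)*u^3/10)+
         (0.186*(1-u)*u^3)*((1-u)*u^2/3+u^3/10))+
       (71/100)^3*((0.186*(1-u)*u^3)*((1-u)*u^3/10))) := by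
    have hB : ∀ i j : ℕ, 0 ≤ u^i*(1-u)^j := fun i j => mul_nonneg (pow_nonneg hu i)
        (pow_nonneg hv j)
    have hC : ∀ i j : ℕ, 0 ≤ u^i*(1-u)^j*(u-17/25)^2 := fun i j => mul_nonneg (hB i j) (sq_nonneg _)
    linarith [hB 1 0, hB 1 7, hB 2 6, hB 3 5, hB 4 4, hB 5 3, hB 6 2, hB 7 1, hB 8 0, hC 1 0,
        hC 2 0, hC 3 0, hC 1 1, hC 2 1]

/-- The product of a cubic and a quadratic in `c ≤ 0.71` is bounded by its coefficients: the powers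
`c³, c⁴, c⁵` are absorbed into `c²`, and the linear term by `c ≤ 1/4 + c²`. -/
theorem cubic_mul_quadratic_le {κ1 κ2 κ3 a b d A C c : ℝ} (hc : 0 ≤ c) (hc1 : c ≤ 71/100)
    (k1 : 0 ≤ κ1) (k2 : 0 ≤ κ2) (k3 : 0 ≤ κ3) (ha : 0 ≤ a) (hb : 0 ≤ b) (hd : 0 ≤ d)
    (h1 : (b+κ1*a)/4 ≤ A - a)
    (h2 : b+κ1*a ≤ C - (d+κ1*b+κ2*a +
        (71/100)*(κ1*d+κ2*b+κ3*a)+(71/100)^2*(κ2*d+κ3*b)+(71/100)^3*(κ3*d))) :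
    (1+κ1*c+κ2*c^2+κ3*c^3)*(a+b*c+d*c^2) ≤ A + C*c^2 := by
  have hc2 : 0 ≤ c^2 := sq_nonneg c
  have c3 : c^3 ≤ 71/100 * c^2 := by nlinarith
  have c4 : c^4 ≤ (71/100)^2 * c^2 := by nlinarith
  have c5 : c^5 ≤ (71/100)^3 * c^2 := by
    have : c^3 ≤ (71/100)^3 := by gcongr
    nlinarith
  have m3 := mul_le_mul_of_nonneg_left c3 (show 0 ≤ κ1*d+κ2*b+κ3*a by positivity)
  have m4 := mul_le_mul_of_nonneg_left c4 (show 0 ≤ κ2*d+κ3*b by positivity)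
  have m5 := mul_le_mul_of_nonneg_left c5 (show 0 ≤ κ3*d by positivity)
  have m2 := mul_le_mul_of_nonneg_right h2 hc2
  have m6 := mul_nonneg (show 0 ≤ b+κ1*a by positivity) (sq_nonneg (c-1/2))
  linarith

theorem growth_drift_coeff_zero_le {u : ℝ} (hu : 0 ≤ u) (hv : 0 ≤ 1 - u) :
    (4/3*u^2-1.4*u^3+1/3*u^4)/4 ≤ 0.45 - (u-2*u^2/3) := by
  nlinarith [mul_nonneg hu hv, mul_nonneg (mul_nonneg hu hv) hu, sq_nonneg (u-3/4),
    sq_nonneg (u*(u-3/4)), sq_nonneg (u^2-3/4*u)]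

theorem excess_growth_coeff_zero_le {u : ℝ} (hu : 0 ≤ u) (hv : 0 ≤ 1 - u) :
   u*(2*(1-u/2)*((1-u)*u/2+0.186*u^2)+u*(1-u/2)^2)*0.21375 ≤ 0.45 - 0.41/6 - u*(1-u/2)^2 := by
    have hB : ∀ i j : ℕ, 0 ≤ u^i*(1-u)^j := fun i j => mul_nonneg (pow_nonneg hu i)
        (pow_nonneg hv j)
    have hC : ∀ i j : ℕ, 0 ≤ u^i*(1-u)^j*(u-3/4)^2 := fun i j => mul_nonneg (hB i j) (sq_nonneg _)
    linarith [hB 0 4, hB 1 3, hB 2 2, hB 3 1, hB 4 0, hC 0 0, hC 1 0, hC 2 0, hC 0 1,hC 1 1, hC 0 2]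

theorem excess_growth_coeff_two_le {κ1 κ2 κ3 u : ℝ} (hu : 0 ≤ u) (hv : 0 ≤ 1 - u)
    (h1 : κ1 = 1 - u/2) (h2 : κ2 = (1-u)*u/2+0.186*u^2) (h3 : κ3 = 0.186*(1-u)*u^2):
   (2*κ1*κ2+u*κ1^2)*(200/171) ≤ 0.54 + 0.41 - ((κ2^2+2*κ1*κ3+u*(2*κ1*κ2)) +
       (71/100)*(2*κ2*κ3+u*(κ2^2+2*κ1*κ3))+(71/100)^2*(κ3^2+u*(2*κ2*κ3))+(71/100)^3*(u*κ3^2)) := by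
    have hB : ∀ i j : ℕ, 0 ≤ u^i*(1-u)^j := fun i j => mul_nonneg (pow_nonneg hu i)
        (pow_nonneg hv j)
    have hC : ∀ i j : ℕ, 0 ≤ u^i*(1-u)^j*(u-141/200)^2 := fun i j => mul_nonneg (hB i j)
        (sq_nonneg _)
    subst h1 h2 h3
    linarith [hB 0 7, hB 1 6, hB 2 5, hB 3 4, hB 4 3, hB 5 2, hB 6 1, hB 7 0, hC 0 0, hC 1 0,
        hC 2 0,  hC 0 1, hC 0 2, hC 3 0, hC 0 3,hC 4 0, hC 0 4, hC 5 0, hC 0 5, hC 1 4, hC 4 1,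
        hC 2 3, hC 3 2]

/-- The analogue of `cubic_mul_quadratic_le` for a square times a linear factor. Here the linear
term is absorbed at the tangent point `c = 0.4275`, and the slack `0.41 (1/6 - u c²)` is used. -/
theorem sq_quadratic_mul_linear_le {κ1 κ2 κ3 u c : ℝ} (hu : 0 ≤ u) (hc : 0 ≤ c) (hc1 : c ≤ 71/100)
    (huc : u*c^2 ≤ 1/6)
    (k1 : 0 ≤ κ1) (k2 : 0 ≤ κ2) (k3 : 0 ≤ κ3)
    (h1 : u*(2*κ1*κ2+u*κ1^2)*0.21375 ≤ 0.45 - 0.41/6 - u*κ1^2)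
    (h2 : (2*κ1*κ2+u*κ1^2)*(200/171) ≤ 0.54 + 0.41 -
        ((κ2^2+2*κ1*κ3+u*(2*κ1*κ2)) +
        (71/100)*(2*κ2*κ3+u*(κ2^2+2*κ1*κ3))+(71/100)^2*(κ3^2+u*(2*κ2*κ3))+(71/100)^3*(u*κ3^2))) :
    u*(κ1+κ2*c+κ3*c^2)^2*(1+u*c) ≤ 0.45 + 0.54*(u*c^2) := by
  have hc2 : 0 ≤ c^2 := sq_nonneg c
  have c3 : c^3 ≤ 71/100 * c^2 := by nlinarith
  have c4 : c^4 ≤ (71/100)^2 * c^2 := by nlinarith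
  have c5 : c^5 ≤ (71/100)^3 * c^2 := by
    have : c^3 ≤ (71/100)^3 := by gcongr
    nlinarith
  have m3 := mul_le_mul_of_nonneg_left c3 (show 0 ≤ u*(2*κ2*κ3+u*(κ2^2+2*κ1*κ3)) by positivity)
  have m4 := mul_le_mul_of_nonneg_left c4 (show 0 ≤ u*(κ3^2+u*(2*κ2*κ3)) by positivity)
  have m5 := mul_le_mul_of_nonneg_left c5 (show 0 ≤ u*(u*κ3^2) by positivity)
  have m2 := mul_le_mul_of_nonneg_right h2 (mul_nonneg hu hc2)
  have m6 := mul_nonneg (show 0 ≤ u*(2*κ1*κ2+u*κ1^2) by positivity) (sq_nonneg (c-0.4275))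
  linarith

/-- The polynomial form of `growth_drift_le`. With `t = u c` and `z = (1 - u) c` it becomes a
family of inequalities for the coefficients of `c`, which hold for `0 ≤ u ≤ 1`. -/
theorem growth_poly_mul_drift_poly_le {t z : ℝ} (ht : 0 ≤ t) (hz : 0 ≤ z) (hc : (t+z)^2 ≤ 1/2) :
    ((1+z)*(1+t+t^2/2+0.186*t^3) - 1)*((1+z)*(t^3/3+t^4/10)+z*t^2) ≤
      (t+z)^3*t*(0.45+0.54*(t*(t+z))) := by
  obtain h0 | h0 := (add_nonneg ht hz).eq_or_lt
  · have : t = 0 := by linarith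
    subst this; simp
  obtain ⟨u, c, hu, hv, hc0, rfl, rfl⟩ : ∃ u c : ℝ, 0 ≤ u ∧ 0 ≤ 1 - u ∧ 0 ≤ c ∧ t = u*c ∧
      z = (1-u)*c := by
    refine ⟨t/(t+z), t+z, by positivity, ?_, h0.le, by field_simp, by field_simp; ring⟩
    rw [sub_nonneg, div_le_one h0]; linarith
  have hc' : c^2 ≤ 1/2 := by convert hc using 2; ring
  have hc1 : c ≤ 71/100 := by nlinarith
  have key := cubic_mul_quadratic_le hc0 hc1 (κ1 := u-u^2/2) (κ2 := (1-u)*u^2/2+0.186*u^3)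
    (κ3 := 0.186*(1-u)*u^3) (a := u-2*u^2/3) (b := (1-u)*u^2/3+u^3/10) (d := (1-u)*u^3/10)
    (A := 0.45) (C := 0.54*u) (by nlinarith) (by positivity) (by positivity) (by nlinarith)
    (by positivity) (by positivity)
    (by have := growth_drift_coeff_zero_le hu hv; linarith)
    (by have := growth_drift_coeff_two_le hu hv; linarith)
  have := mul_le_mul_of_nonneg_left key (show 0 ≤ u*c^4 by positivity)
  linarith

/-- The polynomial form of `excess_growth_sq_le`, by the same substitution `t = u c`, `z = (1 - u)
c`. -/
theorem excess_growth_poly_sq_le {t z : ℝ} (ht : 0 ≤ t) (hz : 0 ≤ z) (htz : t*(t+z) ≤ 1/6)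
    (hc : (t+z)^2 ≤ 1/2) :
    (1+t)*((1+z)*(1+t+t^2/2+0.186*t^3) - 1 - (t+z))^2 ≤ (t+z)^3*t*(0.45+0.54*(t*(t+z))) := by
  obtain h0 | h0 := (add_nonneg ht hz).eq_or_lt
  · have : t = 0 := by linarith
    subst this; simp
  obtain ⟨u, c, hu, hv, hc0, rfl, rfl⟩ : ∃ u c : ℝ, 0 ≤ u ∧ 0 ≤ 1 - u ∧ 0 ≤ c ∧ t = u*c ∧
      z = (1-u)*c := by
    refine ⟨t/(t+z), t+z, by positivity, ?_, h0.le, by field_simp, by field_simp; ring⟩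
    rw [sub_nonneg, div_le_one h0]; linarith
  have hc' : c^2 ≤ 1/2 := by convert hc using 2; ring
  have hc1 : c ≤ 71/100 := by nlinarith
  have key := sq_quadratic_mul_linear_le hu hc0 hc1 (κ1 := 1-u/2) (κ2 := (1-u)*u/2+0.186*u^2)
    (κ3 := 0.186*(1-u)*u^2) (by convert htz using 1; ring) (by linarith) (by positivity)
    (by positivity) (excess_growth_coeff_zero_le hu hv)
        (excess_growth_coeff_two_le hu hv rfl rfl rfl)
  have := mul_le_mul_of_nonneg_left key (show 0 ≤ u*c^4 by positivity)
  linarith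

theorem growth_poly_sub_one_le {t z : ℝ} (ht : 0 ≤ t) (hz : 0 ≤ z) (htz : t*(t+z) ≤ 1/6) :
   (1+z)*(1+t+t^2/2+0.186*t^3) - 1 ≤ 1.27*(t+z) := by
  have h1 : t ≤ 0.41 := by nlinarith
  have h2 : 0 ≤ 1/6 - t*(t+z) := by linarith
  nlinarith [mul_nonneg ht hz, mul_nonneg (mul_nonneg ht hz) ht, mul_nonneg h2 ht, mul_nonneg h2 hz,
      mul_nonneg ht (sq_nonneg (t-0.34)), mul_nonneg hz (sq_nonneg (t-0.34)), sq_nonneg (t-0.34),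
      sq_nonneg (z-0.15), sq_nonneg (t+z-0.49), mul_nonneg ht (sub_nonneg.2 h1),
      mul_nonneg hz (sub_nonneg.2 h1)]

/-- The factor of `4 + 6 (t + z)²` on the right is `rhoZero (t (t + z))`. -/
theorem growth_sq_poly_le_rhoZero {t z : ℝ} (ht : 0 ≤ t) (hz : 0 ≤ z) (htz : t*(t+z) ≤ 1/6)
    (hc : (t+z)^2 ≤ 1/2) :
   (1+z)^2*(1+2*t+2*t^2+1.66*t^3) ≤ (0.44375+0.045*(t*(t+z))+0.135*(t*(t+z))^2)*(4+6*(t+z)^2) +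
       3.5*z := by
  have h1 : t ≤ 0.41 := by nlinarith
  have h1' : 0 ≤ 0.41 - t := by linarith
  have h2 : 0 ≤ 1/6 - t*(t+z) := by linarith
  have hs : 0 ≤ (t+z)^2 := sq_nonneg _
  have h3 : (0.44 + 0.09*(t*(t+z)))*(4+6*(t+z)^2) ≤
      (0.44375+0.045*(t*(t+z))+0.135*(t*(t+z))^2)*(4+6*(t+z)^2) := by
    apply mul_le_mul_of_nonneg_right _ (by positivity)
    nlinarith [sq_nonneg (t*(t+z)-1/6)]
  refine le_trans ?_ (add_le_add_left h3 _)
  nlinarith [mul_nonneg ht hz, mul_nonneg (mul_nonneg ht hz) ht, mul_nonneg h2 ht, mul_nonneg h2 hz,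
      mul_nonneg ht h1', mul_nonneg hz h1', mul_nonneg (mul_nonneg ht hz) hz, pow_nonneg ht 3,
      pow_nonneg hz 3, mul_nonneg (mul_nonneg ht hz) h1', mul_nonneg h2 h1', mul_nonneg h1' h1',
      mul_nonneg (mul_nonneg h1' h1') ht]

/-- Case `Q = 1/6` of `growth_sq_le_rhoOne`, where `rhoOne` is at least `0.3455`. -/
theorem growth_sq_poly_le_rhoOne_endpoint {t z : ℝ} (ht : 0 ≤ t) (hz : 0 ≤ z) (htz : t*(t+z) ≤ 1/6)
    (hc : (t+z)^2 ≤ 1/2) :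
   (1+z)^2*(1+2*t+2*t^2+1.66*t^3) ≤ 0.3455*(4+6*(t+z)^2) + 8.2*(1/6)*(t+z) + z := by
  have h1 : t ≤ 0.41 := by nlinarith
  have h1' : 0 ≤ 0.41 - t := by linarith
  have h2 : 0 ≤ 1/6 - t*(t+z) := by linarith
  nlinarith [mul_nonneg ht hz, mul_nonneg (mul_nonneg ht hz) ht, mul_nonneg h2 ht, mul_nonneg h2 hz,
      mul_nonneg ht h1', mul_nonneg hz h1', mul_nonneg (mul_nonneg ht hz) hz, pow_nonneg ht 3,
      pow_nonneg hz 3, mul_nonneg (mul_nonneg ht hz) h1', mul_nonneg h2 h1']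

/-- Case `Q = t (t + z)` of `growth_sq_le_rhoOne`; the factor of `4 + 6 (t + z)²` on the right is
`rhoOne Q` up to rounding. -/
theorem growth_sq_poly_le_rhoOne_diagonal {t z : ℝ} (ht : 0 ≤ t) (hz : 0 ≤ z) (htz : t*(t+z) ≤ 1/6)
    (hc : (t+z)^2 ≤ 1/2) :
   (1+z)^2*(1+2*t+2*t^2+1.66*t^3) ≤ (0.443-0.51*(t*(t+z))-0.45*(t*(t+z))^2)*(4+6*(t+z)^2) +
       8.2*(t*(t+z))*(t+z) + z := by
  have h1 : t ≤ 0.41 := by nlinarith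
  have h1' : 0 ≤ 0.41 - t := by linarith
  have h2 : 0 ≤ 1/6 - t*(t+z) := by linarith
  have h3 : (t*(t+z))^2 ≤ t*(t+z)/6 := by
    nlinarith [mul_nonneg (mul_nonneg ht (add_nonneg ht hz)) h2]
  nlinarith [mul_nonneg ht hz, mul_nonneg (mul_nonneg ht hz) ht, mul_nonneg h2 ht, mul_nonneg h2 hz,
      mul_nonneg ht h1', mul_nonneg hz h1', mul_nonneg (mul_nonneg ht hz) hz, pow_nonneg ht 3,
      pow_nonneg hz 3, mul_nonneg (mul_nonneg ht hz) h1', mul_nonneg h2 h1']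

theorem growth_poly_sub_one_le_cubic {t z : ℝ} (ht : 0 ≤ t) (hz : 0 ≤ z) (htz : t*(t+z) ≤ 1/6)  :
   (1+z)*(1+t+t^2/2+0.186*t^3)-1 ≤ (t+z) + 0.5*(t+z)^2+0.19*(t+z)^3 := by
  have h1 : t ≤ 0.41 := by nlinarith
  have h1' : 0 ≤ 0.41 - t := by linarith
  have h3 : z*t^3 ≤ 0.41*(z*t^2) := by nlinarith [mul_nonneg (mul_nonneg hz (sq_nonneg t)) h1']
  nlinarith [mul_nonneg ht hz, mul_nonneg (mul_nonneg ht hz) ht, mul_nonneg (mul_nonneg ht hz) hz,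
      mul_nonneg (mul_nonneg ht hz) h1', pow_nonneg ht 3, pow_nonneg hz 3,
      mul_nonneg ht (sq_nonneg (t-50*z)), mul_nonneg ht (sq_nonneg (z-0.01*t))]

/-- Bounds the coefficient of the linear term in `term_le_tangent` when the quadratic one is
nonpositive. -/
theorem tangent_coeff_le {y c : ℝ} (hc : 0 ≤ c) (h0 : 1.272 ≤ y) (h1 : y ≤ 1.6245)
    (hy : y ≤ 1+c+0.5*c^2+0.19*c^3) :
   0.14015*y^2-0.090363*y ≤ 0.4664*c := by
  by_contra! h
  set s := y - 1.272 with hs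
  have hy' : y = s + 1.272 := by rw [hs]; ring
  have s0 : 0 ≤ s := by rw [hs]; linarith
  have s1 : s ≤ 0.3525 := by rw [hs]; linarith
  have h2 : c ≤ 0.2399+0.6767*s := by rw [hy'] at h; nlinarith
  have h3 : c^2 ≤ (0.2399+0.6767*s)^2 := by gcongr
  have h4 : c^3 ≤ (0.2399+0.6767*s)^3 := by gcongr
  rw [hy'] at hy
  nlinarith [mul_nonneg s0 (sub_nonneg.2 s1), mul_nonneg (mul_nonneg s0 s0) (sub_nonneg.2 s1)]

/-- Bounds both correction terms of `term_le_tangent` when the quadratic one is positive. -/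
theorem tangent_le_of_large {t c : ℝ} (ht : 0 ≤ t) (htc : t ≤ c) (hc0 : 0.4913 ≤ c)
    (hc1 : c ≤ 0.7072) (htz : t*c ≤ 1/6) :
    t*(0.14015*(1+1.27*c)^2-0.090363*(1+1.27*c)) +
        t^2*(2.494974*(1+1.27*c)^2-5.049039*(1+1.27*c)+1.618) ≤ 0.382*(c-t)^2 + 0.4664*(t*c) := by
  have a1 : 0 ≤ c - 0.4913 := by linarith
  have a2 : 0 ≤ 0.7072 - c := by linarith
  have a3 : 0 ≤ 1/6-t*c := by linarith
  have h5 : t ≤ 0.3393 := by nlinarith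
  have h6 : 0 ≤ c - t := by linarith
  nlinarith [mul_nonneg a1 a2, mul_nonneg a1 a3, mul_nonneg a2 a3, mul_nonneg ht a3,
      mul_nonneg (mul_nonneg ht a3) a1, mul_nonneg (mul_nonneg ht a3) a2, mul_nonneg ht a1,
      mul_nonneg ht a2, mul_nonneg (mul_nonneg ht a1) a2, sq_nonneg (c-1.8*t), sq_nonneg (c-2*t),
      mul_nonneg (mul_nonneg ht ht) a1, mul_nonneg (mul_nonneg ht ht) a2,
      mul_nonneg (mul_nonneg ht ht) (mul_nonneg a1 a2), mul_nonneg (mul_nonneg ht a3) ht,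
      mul_nonneg ht h6,  mul_nonneg a3 a3]

/-! ### Growth factors and the drift coefficients -/

/-- The factor by which a perturbation of step `j` is amplified by the steps `j, …, K - 1`, if
step `l` has relative size `α l`. -/
noncomputable def growth (α : ℕ → ℝ) (K j : ℕ) : ℝ := ∏ l ∈ Ico j K, (1 + α l)

section growth
variable {α : ℕ → ℝ} {K n : ℕ}

theorem growth_self (α : ℕ → ℝ) (K : ℕ) : growth α K K = 1 := by simp [growth]

theorem growth_eq_mul {j : ℕ} (h : j < K) : growth α K j = (1 + α j) * growth α K (j+1) := by
  rw [growth, growth, Finset.prod_eq_prod_Ico_succ_bot h]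

theorem growth_succ {j : ℕ} (h : j ≤ n) : growth α (n+1) j = growth α n j * (1 + α n) := by
  rw [growth, growth, Finset.prod_Ico_succ_top h]

theorem one_le_growth (hα : ∀ k < K, 0 ≤ α k) (j : ℕ) : 1 ≤ growth α K j :=
  calc (1:ℝ) = ∏ _l ∈ Ico j K, 1 := by simp
    _ ≤ _ := Finset.prod_le_prod (by simp) fun l hl => by have := hα l (mem_Ico.1 hl).2; linarith

theorem one_add_sum_le_growth (hα : ∀ k < K, 0 ≤ α k) :
    1 + ∑ k ∈ range K, α k ≤ growth α K 0 := by
  induction K with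
  | zero => simp [growth]
  | succ K ih =>
    have h1 := ih fun k hk => hα k (by omega)
    have h2 := one_le_growth (K := K) (α := α) (fun k hk => hα k (by omega)) 0
    have h3 := hα K (by omega)
    rw [sum_range_succ, growth_succ (Nat.zero_le K)]
    nlinarith

theorem growth_le_growth_zero (hα : ∀ k < K, 0 ≤ α k) {j : ℕ} (h : j ≤ K) :
    growth α K j ≤ growth α K 0 := by
  induction j with
  | zero => rfl
  | succ j ih =>
    refine le_trans ?_ (ih (by omega))
    rw [growth_eq_mul (show j < K by omega)]
    have := one_le_growth hα (j+1)
    have := hα j (by omega)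
    nlinarith

theorem growth_zero_le_exp (hα : ∀ k < n, 0 ≤ α k) :
    growth α n 0 ≤ Real.exp (∑ k ∈ range n, α k) := by
  rw [growth, ← Finset.range_eq_Ico, Real.exp_sum]
  refine Finset.prod_le_prod (fun i hi => ?_) fun i hi => ?_
  · have := hα i (mem_range.1 hi); linarith
  · rw [add_comm]; exact Real.add_one_le_exp _

theorem exp_le_poly {t : ℝ} (h0 : 0 ≤ t) (h1 : t ≤ 0.41) :
    Real.exp t ≤ 1 + t + t^2/2 + 0.186*t^3 := by
  have h := Real.exp_bound' h0 (by linarith) (n := 5) (by norm_num)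
  simp [Finset.sum_range_succ, Nat.factorial] at h
  have h2 : 0 ≤ t^3 := by positivity
  have h3 : t^4 ≤ 0.41*t^3 := by nlinarith
  have h4 : t^5 ≤ 0.41^2*t^3 := by nlinarith
  linarith

theorem exp_two_mul_le_poly {t : ℝ} (h0 : 0 ≤ t) (h1 : t ≤ 0.409) :
    Real.exp (2*t) ≤ 1 + 2*t + 2*t^2 + 1.66*t^3 := by
  have h := Real.exp_bound' (x := 2*t) (by linarith) (by linarith) (n := 5) (by norm_num)
  simp [Finset.sum_range_succ, Nat.factorial] at h
  have h2 : 0 ≤ t^3 := by positivity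
  have h3 : t^4 ≤ 0.409*t^3 := by nlinarith
  have h4 : t^5 ≤ 0.409^2*t^3 := by nlinarith
  nlinarith

/-- The polynomial `A³/3 + A⁴/10` in the partial sum `A` is a supersolution of the recursion that
the left-hand side satisfies. -/
theorem sum_growth_mul_sq_le {m : ℕ} (hα : ∀ k < m, 0 ≤ α k) (hA : ∑ k ∈ range m, α k ≤ 2/3) :
    ∑ k ∈ range m, α k * growth α m (k+1) * (∑ j ∈ range k, α j)^2 ≤
      (∑ k ∈ range m, α k)^3/3 + (∑ k ∈ range m, α k)^4/10 := by
  induction m with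
  | zero => simp
  | succ m ih =>
    have hm := hα m (by omega)
    rw [sum_range_succ] at hA
    have ih := ih (fun k hk => hα k (by omega)) (by linarith)
    have h0 : 0 ≤ ∑ k ∈ range m, α k := sum_nonneg fun k hk => hα k
        (by have := mem_range.1 hk; omega)
    rw [sum_range_succ, sum_range_succ _ m, growth_self]
    have : ∑ k ∈ range m, α k * growth α (m+1) (k+1) * (∑ j ∈ range k, α j)^2 =
        (1 + α m) * ∑ k ∈ range m, α k * growth α m (k+1) * (∑ j ∈ range k, α j)^2 := by
      rw [mul_sum]
      refine sum_congr rfl fun k hk => ?_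
      rw [growth_succ (by have := mem_range.1 hk; omega)]; ring
    rw [this]
    generalize ∑ k ∈ range m, α k = A at *
    have h1 := mul_le_mul_of_nonneg_left ih (show 0 ≤ 1 + α m by linarith)
    have h2 : 0 ≤ (α m * A^3) * (2/3 - A) := mul_nonneg (by positivity) (by linarith)
    have h3 : 0 ≤ A * α m^2 + α m^3/3 + (6*A^2*α m^2 + 4*A*α m^3+α m^4)/10 := by positivity
    nlinarith

theorem sum_sq_le_sq_sum (hα : ∀ k < n, 0 ≤ α k) :
    ∑ k ∈ range n, α k^2 ≤ (∑ k ∈ range n, α k)^2 :=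
  Finset.sum_sq_le_sq_sum_of_nonneg fun k hk => hα k (mem_range.1 hk)

end growth

/-- The price, in units of `a_i² ‖∇L_i‖²`, of the client drift. -/
noncomputable def driftCoeff (Q : ℝ) : ℝ := Q * (0.45 + 0.54*Q)

/-- The multiple of `‖∇‖²` that survives the client drift: if `4 Q β² ≤ 1 - 2 Q`, then
`β² driftCoeff Q ≤ 1 - 2 rhoZero Q`. -/
noncomputable def rhoZero (Q : ℝ) : ℝ := (1 - (1-2*Q)*(0.45+0.54*Q)/4)/2

/-- The value at `Ω = 1/2` of the normalized descent rate
`(rhoZero Q - Ω (4/3 + 4 driftCoeff Q) / 3) / (1 - Ω)`, whose value at `Ω = 0` is `rhoZero Q`. -/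
noncomputable def rhoOne (Q : ℝ) : ℝ := 2*rhoZero Q - (4/3 + 4*driftCoeff Q)/3

theorem rhoOne_ge {Q : ℝ} (h0 : 0 ≤ Q) (h1 : Q ≤ 1/6) : 0.3455 ≤ rhoOne Q := by
  unfold rhoOne rhoZero driftCoeff; nlinarith

theorem rhoOne_le_rhoZero {Q : ℝ} (h0 : 0 ≤ Q) : rhoOne Q ≤ rhoZero Q := by
  unfold rhoOne rhoZero driftCoeff; nlinarith

section client
variable {α : ℕ → ℝ} {n : ℕ} {t z Q : ℝ}

theorem le_of_mul_add_le (ht : 0 ≤ t) (hz : 0 ≤ z) (htz : t*(t+z) ≤ 1/6) : t ≤ 0.409 := by nlinarith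

theorem growth_le_poly (hα : ∀ k < n+1, 0 ≤ α k) (ht : t = ∑ k ∈ range n, α k) (hz : z = α n)
    (htz : t*(t+z) ≤ 1/6) : growth α (n+1) 0 ≤ (1+z)*(1+t+t^2/2+0.186*t^3) := by
  have hz0 : 0 ≤ z := hz ▸ hα n (by omega)
  have ht0 : 0 ≤ t := ht ▸ sum_nonneg fun k hk => hα k (by have := mem_range.1 hk; omega)
  rw [growth_succ (Nat.zero_le n), ← hz, mul_comm]
  have := growth_zero_le_exp (n := n) (α := α) fun k hk => hα k (by omega)
  rw [← ht] at this
  exact mul_le_mul_of_nonneg_left (this.trans (exp_le_poly ht0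
      ((le_of_mul_add_le ht0 hz0 htz).trans (by norm_num)))) (by linarith)

theorem growth_sq_le_poly (hα : ∀ k < n+1, 0 ≤ α k) (ht : t = ∑ k ∈ range n, α k) (hz : z = α n)
    (htz : t*(t+z) ≤ 1/6) : growth α (n+1) 0^2 ≤ (1+z)^2*(1+2*t+2*t^2+1.66*t^3) := by
  have hz0 : 0 ≤ z := hz ▸ hα n (by omega)
  have ht0 : 0 ≤ t := ht ▸ sum_nonneg fun k hk => hα k (by have := mem_range.1 hk; omega)
  rw [growth_succ (Nat.zero_le n), ← hz, mul_comm, mul_pow]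
  have := growth_zero_le_exp (n := n) (α := α) fun k hk => hα k (by omega)
  have h1 := one_le_growth (K := n) (α := α) (fun k hk => hα k (by omega)) 0
  rw [← ht] at this
  refine mul_le_mul_of_nonneg_left ?_ (by positivity)
  calc growth α n 0^2 ≤ (Real.exp t)^2 := by gcongr
    _ = Real.exp (2*t) := by rw [← Real.exp_nat_mul]; norm_num
    _ ≤ _ := exp_two_mul_le_poly ht0 (le_of_mul_add_le ht0 hz0 htz)

/-- The coefficient of `g²` in the bound `IsLocalRun.drift_sq_le` for the drift. -/
theorem growth_drift_le (hα : ∀ k < n+1, 0 ≤ α k) (ht : t = ∑ k ∈ range n, α k) (hz : z = α n)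
    (hQ : t*(t+z) ≤ Q) (hQ1 : Q ≤ 1/6) (hc : (t+z)^2 ≤ 1/2) :
    (growth α (n+1) 0 - 1) *
      ∑ k ∈ range (n+1), α k * growth α (n+1) (k+1) * (∑ j ∈ range k, α j)^2 ≤
      (t+z)^2 * driftCoeff Q := by
  have hz0 : 0 ≤ z := hz ▸ hα n (by omega)
  have ht0 : 0 ≤ t := ht ▸ sum_nonneg fun k hk => hα k (by have := mem_range.1 hk; omega)
  have h1 := growth_le_poly hα ht hz (hQ.trans hQ1)
  have h2 := one_le_growth hα 0
  have ht1 := le_of_mul_add_le ht0 hz0 (hQ.trans hQ1)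
  have hJ : ∑ k ∈ range (n+1), α k * growth α (n+1) (k+1) * (∑ j ∈ range k, α j)^2 ≤
      (1+z)*(t^3/3+t^4/10)+z*t^2 := by
    rw [sum_range_succ, growth_self, ← ht, ← hz]
    have : ∑ k ∈ range n, α k * growth α (n+1) (k+1) * (∑ j ∈ range k, α j)^2 =
        (1 + z) * ∑ k ∈ range n, α k * growth α n (k+1) * (∑ j ∈ range k, α j)^2 := by
      rw [mul_sum]
      refine sum_congr rfl fun k hk => ?_
      rw [growth_succ (by have := mem_range.1 hk; omega), hz]; ring
    rw [this]
    have h3 := sum_growth_mul_sq_le (m := n) (α := α) (fun k hk => hα k (by omega))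
        (by rw [← ht]; linarith)
    rw [← ht] at h3
    have := mul_le_mul_of_nonneg_left h3 (show 0 ≤ 1 + z by linarith)
    linarith
  calc _ ≤ ((1+z)*(1+t+t^2/2+0.186*t^3) - 1)*((1+z)*(t^3/3+t^4/10)+z*t^2) := by
        refine mul_le_mul (by linarith) hJ (sum_nonneg fun k hk => ?_) (by linarith)
        have := hα k (mem_range.1 hk)
        have := one_le_growth hα (k+1)
        positivity
    _ ≤ (t+z)^3*t*(0.45+0.54*(t*(t+z))) := growth_poly_mul_drift_poly_le ht0 hz0 hc
    _ = (t+z)^2*((t*(t+z))*(0.45+0.54*(t*(t+z)))) := by ring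
    _ ≤ _ := by
      have : 0 ≤ t*(t+z) := by positivity
      have := this.trans hQ
      unfold driftCoeff; gcongr

/-- The coefficient of `g²` in the potential bound `IsLocalRun.variance_add_drift_sq_le`. -/
theorem excess_growth_sq_le (hα : ∀ k < n+1, 0 ≤ α k) (ht : t = ∑ k ∈ range n, α k) (hz : z = α n)
    (hQ : t*(t+z) ≤ Q) (hQ1 : Q ≤ 1/6) (hc : (t+z)^2 ≤ 1/2) :
    (1+t)*(growth α (n+1) 0 - 1 - (t+z))^2 ≤ (t+z)^2 * driftCoeff Q := by
  have hz0 : 0 ≤ z := hz ▸ hα n (by omega)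
  have ht0 : 0 ≤ t := ht ▸ sum_nonneg fun k hk => hα k (by have := mem_range.1 hk; omega)
  have h1 := growth_le_poly hα ht hz (hQ.trans hQ1)
  have h2 : 0 ≤ growth α (n+1) 0 - 1 - (t+z) := by
    have h3 : 1 + ∑ k ∈ range (n+1), α k ≤ growth α (n+1) 0 := by
      exact one_add_sum_le_growth hα
    rw [sum_range_succ, ← ht, ← hz] at h3
    linarith
  calc _ ≤ (1+t)*((1+z)*(1+t+t^2/2+0.186*t^3) - 1 - (t+z))^2 := by gcongr
    _ ≤ (t+z)^3*t*(0.45+0.54*(t*(t+z))) := excess_growth_poly_sq_le ht0 hz0 (hQ.trans hQ1) hc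
    _ = (t+z)^2*((t*(t+z))*(0.45+0.54*(t*(t+z)))) := by ring
    _ ≤ _ := by
      have : 0 ≤ t*(t+z) := by positivity
      have := this.trans hQ
      unfold driftCoeff; gcongr

theorem growth_sub_one_le (hα : ∀ k < n+1, 0 ≤ α k) (ht : t = ∑ k ∈ range n, α k) (hz : z = α n)
    (htz : t*(t+z) ≤ 1/6) : growth α (n+1) 0 - 1 ≤ 1.27*(t+z) := by
  have hz0 : 0 ≤ z := hz ▸ hα n (by omega)
  have ht0 : 0 ≤ t := ht ▸ sum_nonneg fun k hk => hα k (by have := mem_range.1 hk; omega)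
  have := growth_le_poly hα ht hz htz
  have := growth_poly_sub_one_le ht0 hz0 htz
  linarith
end client

/-! ### Noise coefficient of the variance -/
theorem growth_mul_le {α : ℕ → ℝ} {K : ℕ} (hα : ∀ k < K, 0 ≤ α k) {j : ℕ} (h : j < K) :
    growth α K (j+1) * (1 + α j) ≤ growth α K 0 := by
  rw [mul_comm, ← growth_eq_mul h]; exact growth_le_growth_zero hα h.le

/-- A weighted sum of squares whose weights satisfy `f_j (1 + α_j) ≤ √F`: where `f_j²` exceeds
`P`, the step `α_j` is small, and the excess is quadratic in `F - P`. -/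
theorem sum_sq_mul_sq_le {α f : ℕ → ℝ} {n : ℕ} {F P : ℝ} (hα : ∀ j < n, 0 ≤ α j)
    (hf : ∀ j < n, f j^2 * (1 + α j)^2 ≤ F) (hP : 0 < P) :
    ∑ j ∈ range n, α j^2 * f j^2 ≤
      P * ∑ j ∈ range n, α j^2 + (max (F - P) 0)^2/(8*P) * ∑ j ∈ range n, α j := by
  rw [mul_sum, mul_sum, ← sum_add_distrib]
  refine sum_le_sum fun j hj => ?_
  have ha := hα j (mem_range.1 hj)
  have hF := hf j (mem_range.1 hj)
  generalize α j = a at *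
  generalize f j = f at *
  set d := max (F - P) 0 with hd
  have d0 : 0 ≤ d := le_max_right _ _
  have d1 : F ≤ P + d := by have := le_max_left (F - P) 0; linarith
  -- `a (d - 2 P a) ≤ d² / (8 P)`
  have h1 : a * (d - 2*P*a) ≤ d^2/(8*P) := by
    rw [le_div_iff₀ (by positivity)]; nlinarith [sq_nonneg (d - 4*P*a)]
  have h2 : f^2 * (1+a)^2 ≤ P + d := hF.trans d1
  have h3 : f^2 - P ≤ max (d - 2*P*a) 0 := by
    by_cases h : f^2 ≤ P
    · exact le_max_of_le_right (by linarith)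
    · refine le_max_of_le_left ?_
      push Not at h
      nlinarith [mul_nonneg ha ha, mul_nonneg ha (sub_nonneg.2 h.le)]
  have h4 : a * max (d - 2*P*a) 0 ≤ d^2/(8*P) := by
    rcases max_cases (d - 2*P*a) 0 with ⟨h, _⟩ | ⟨h, _⟩ <;> rw [h]
    · exact h1
    · simp; positivity
  nlinarith [mul_le_mul_of_nonneg_left h3 (sq_nonneg a), mul_le_mul_of_nonneg_left h4 ha]

theorem sum_range_succ_growth {α : ℕ → ℝ} {n : ℕ} :
    ∑ j ∈ range (n+1), α j^2 * growth α (n+1) (j+1)^2 =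
      (∑ j ∈ range n, α j^2 * growth α (n+1) (j+1)^2) + α n^2 := by
  rw [sum_range_succ, growth_self]; ring

section client
variable {α : ℕ → ℝ} {n : ℕ} {t z Q ρ w : ℝ}

/-- The right-hand side is concave in `Q`, so the two endpoints of `t (t + z) ≤ Q ≤ 1/6` suffice. -/
theorem growth_sq_le_rhoOne {F : ℝ} (ht : 0 ≤ t) (hz : 0 ≤ z) (hQ : t*(t+z) ≤ Q) (hQ1 : Q ≤ 1/6)
    (hc : (t+z)^2 ≤ 1/2) (hF : F ≤ (1+z)^2*(1+2*t+2*t^2+1.66*t^3)) :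
    F ≤ rhoOne Q * (4 + 6*(t+z)^2) + 8.2*Q*(t+z) + z := by
  have h1 := growth_sq_poly_le_rhoOne_endpoint ht hz (hQ.trans hQ1) hc
  have h2 := growth_sq_poly_le_rhoOne_diagonal ht hz (hQ.trans hQ1) hc
  have h0 : 0 ≤ t*(t+z) := by positivity
  have e : rhoOne Q = 5/9-0.1125 - 0.51*Q - 0.45*Q^2 := by
    unfold rhoOne rhoZero driftCoeff; ring
  rw [e]
  have hC : 0 ≤ (t+z)^2 := sq_nonneg _
  generalize t*(t+z) = q at *
  generalize (t+z)^2 = C at *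
  by_cases h : 0.51*(4+6*C) + 0.45*(q+1/6)*(4+6*C) ≤ 8.2*(t+z)
  · have : 0 ≤ 4 + 6*C := by linarith
    nlinarith [mul_nonneg (mul_nonneg this (sub_nonneg.2 hQ)) (sub_nonneg.2 hQ1),
        mul_le_mul_of_nonneg_right h (sub_nonneg.2 hQ)]
  · push Not at h
    have : 0 ≤ 4 + 6*C := by linarith
    nlinarith [mul_nonneg (mul_nonneg this (sub_nonneg.2 hQ)) (sub_nonneg.2 hQ1),
        mul_le_mul_of_nonneg_right h.le (sub_nonneg.2 hQ1)]

theorem growth_sq_le_rhoZero {F : ℝ} (ht : 0 ≤ t) (hz : 0 ≤ z) (hQ : t*(t+z) ≤ Q) (hQ1 : Q ≤ 1/6)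
    (hc : (t+z)^2 ≤ 1/2) (hF : F ≤ (1+z)^2*(1+2*t+2*t^2+1.66*t^3)) :
    F ≤ rhoZero Q * (4 + 6*(t+z)^2) + 3.5*z := by
  have h1 := growth_sq_poly_le_rhoZero ht hz (hQ.trans hQ1) hc
  have h0 : 0 ≤ t*(t+z) := by positivity
  have e : rhoZero Q = 0.44375+0.045*Q+0.135*Q^2 := by
    unfold rhoZero; ring
  have : (0.44375+0.045*(t*(t+z))+0.135*(t*(t+z))^2)*(4+6*(t+z)^2) ≤ rhoZero Q *
      (4 + 6*(t+z)^2) := by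
    rw [e]; gcongr
  linarith

theorem mul_sq_le_of_rhoZero {c : ℝ} (ht : 0 ≤ t) (ht1 : t ≤ 0.409) (htc : t ≤ c) :
    t*(3.5*z)^2 ≤ 8*(0.3455*(4+6*c^2))*(0.382*z^2) := by
  have h1 : t^2 ≤ c^2 := by gcongr
  have : t*12.25 ≤ 8*(0.3455*(4+6*t^2))*0.382 := by nlinarith
  have : t*12.25 ≤ 8*(0.3455*(4+6*c^2))*0.382 := by linarith
  linarith [mul_le_mul_of_nonneg_right this (sq_nonneg z)]

theorem mul_sq_le_of_rhoOne {c : ℝ} (ht : 0 ≤ t) (ht1 : t ≤ 0.409) (htc : t ≤ c) (hQ : t^2 ≤ Q) :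
    t*(z + 8.2*Q*c)^2 ≤ 8*(0.3455*(4+6*c^2))*(0.382*z^2 + (1.949+1.477*Q)*(Q*c)^2) := by
  have hQ0 : 0 ≤ Q := (sq_nonneg t).trans hQ
  have h0 : t^2 ≤ c^2 := by gcongr
  have h1 : (z + 8.2*Q*c)^2 * (0.382 * (1.949+1.477*Q)) ≤
      ((1.949+1.477*Q) + 67.24*0.382)*(0.382*z^2 + (1.949+1.477*Q)*(Q*c)^2) := by
    linarith [sq_nonneg ((1.949+1.477*Q)*(Q*c) - 0.382*8.2*z)]
  have h2 : t*((1.949+1.477*t^2) + 67.24*0.382) ≤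
      8*(0.3455*(4+6*t^2))*(0.382 * (1.949+1.477*t^2)) := by
    nlinarith [sq_nonneg (t-0.4), sq_nonneg (t-0.35), mul_nonneg ht (sub_nonneg.2 ht1),
        mul_nonneg (mul_nonneg ht ht) (sub_nonneg.2 ht1), pow_nonneg ht 4]
  have h3 : t*((1.949+1.477*Q) + 67.24*0.382) ≤
      8*(0.3455*(4+6*t^2))*(0.382 * (1.949+1.477*Q)) := by
    nlinarith [mul_nonneg (sub_nonneg.2 hQ) (sub_nonneg.2 ht1), mul_nonneg (sub_nonneg.2 hQ)
        (sq_nonneg t)]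
  have h4 : 8*(0.3455*(4+6*t^2))*(0.382 * (1.949+1.477*Q)) ≤
      8*(0.3455*(4+6*c^2))*(0.382 * (1.949+1.477*Q)) := by gcongr
  have h5 : 0 < 0.382 * (1.949+1.477*Q) := by positivity
  have h6 := mul_le_mul_of_nonneg_right (h3.trans h4)
      (show 0 ≤ 0.382*z^2 + (1.949+1.477*Q)*(Q*c)^2 by positivity)
  refine le_of_mul_le_mul_right ?_ h5
  linarith [mul_le_mul_of_nonneg_left h1 ht]

theorem le_mul_rhoOne (hQ0 : 0 ≤ Q) (hQ1 : Q ≤ 1/6) :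
    1.949+1.477*Q ≤ 4.4*rhoOne Q*(1+2*Q+4*Q^2) := by
  unfold rhoOne rhoZero driftCoeff
  nlinarith [mul_nonneg hQ0 (sub_nonneg.2 hQ1), mul_nonneg (mul_nonneg hQ0 hQ0) (sub_nonneg.2 hQ1),
      pow_nonneg hQ0 3, mul_nonneg (pow_nonneg hQ0 3) (sub_nonneg.2 hQ1)]

theorem excess_le {F c : ℝ} (ht : 0 ≤ t) (ht1 : t ≤ 0.409) (hz : 0 ≤ z) (htc : t ≤ c) (hQ : t^2 ≤ Q)
    (hQ1 : Q ≤ 1/6)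
    (hw0 : 0 ≤ w) (hw1 : w ≤ 1) (hρ : (1-w)*rhoZero Q + w*rhoOne Q ≤ ρ)
    (hd0 : F ≤ rhoZero Q * (4 + 6*c^2) + 3.5*z)
    (hd1 : F ≤ rhoOne Q * (4 + 6*c^2) + 8.2*Q*c + z) :
    (max (F - ρ*(4+6*c^2)) 0)^2/(8*(ρ*(4+6*c^2)))*t ≤
      (4*ρ-1)*z^2 + w*(4.4*ρ*(1+2*Q+4*Q^2)*(Q*c)^2) := by
  have hQ0 : 0 ≤ Q := (sq_nonneg t).trans hQ
  have hc0 : 0 ≤ c := ht.trans htc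
  have hr1 := rhoOne_ge hQ0 hQ1
  have hr0 := rhoOne_le_rhoZero hQ0
  have h1w : 0 ≤ 1 - w := by linarith
  have hρ1 : rhoOne Q ≤ ρ := by nlinarith
  have hP0 : 0.3455*(4+6*c^2) ≤ ρ*(4+6*c^2) := by gcongr; linarith
  have hD : max (F - ρ*(4+6*c^2)) 0 ≤ (1-w)*(3.5*z) + w*(z + 8.2*Q*c) := by
    refine max_le ?_ (by positivity)
    have h1 : ((1-w)*rhoZero Q + w*rhoOne Q)*(4+6*c^2) ≤ ρ*(4+6*c^2) := by gcongr
    linarith [mul_le_mul_of_nonneg_left hd0 h1w, mul_le_mul_of_nonneg_left hd1 hw0]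
  have hP1 : 0 < ρ*(4+6*c^2) := lt_of_lt_of_le (by positivity) hP0
  generalize ρ*(4+6*c^2) = P at *
  have hD2 : (max (F - P) 0)^2 ≤ (1-w)*(3.5*z)^2 + w*(z + 8.2*Q*c)^2 := by
    refine (pow_le_pow_left₀ (le_max_right _ _) hD 2).trans ?_
    linarith [mul_nonneg (mul_nonneg hw0 h1w) (sq_nonneg (3.5*z-(z + 8.2*Q*c)))]
  have hk1 : 0.382*z^2 ≤ (4*ρ-1)*z^2 := by
    apply mul_le_mul_of_nonneg_right _ (sq_nonneg z); linarith
  have hk2 : (1.949+1.477*Q)*(Q*c)^2 ≤ 4.4*ρ*(1+2*Q+4*Q^2)*(Q*c)^2 := by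
    apply mul_le_mul_of_nonneg_right _ (sq_nonneg _)
    refine (le_mul_rhoOne hQ0 hQ1).trans ?_
    gcongr
  have ha : t*(3.5*z)^2 ≤ 8*P*((4*ρ-1)*z^2) :=
    (mul_sq_le_of_rhoZero ht ht1 htc).trans (by gcongr)
  have hb : t*(z + 8.2*Q*c)^2 ≤ 8*P*((4*ρ-1)*z^2 + 4.4*ρ*(1+2*Q+4*Q^2)*(Q*c)^2) :=
    (mul_sq_le_of_rhoOne ht ht1 htc hQ).trans (by gcongr)
  rw [div_mul_eq_mul_div, div_le_iff₀ (by positivity)]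
  linarith [mul_le_mul_of_nonneg_left ha h1w, mul_le_mul_of_nonneg_left hb hw0,
    mul_le_mul_of_nonneg_left hD2 ht]

/-- The coefficient of `σ²` in the variance. The excess of the growth factors over `ρ (4 + 6 (t +
z)²)` is paid for by the last step `z`, and by a term of order `w Q²`, where `w` measures how far
`ρ` is from `rhoZero Q`. -/
theorem noise_le (hα : ∀ k < n+1, 0 ≤ α k) (ht : t = ∑ k ∈ range n, α k) (hz : z = α n)
    (hQ : t*(t+z) ≤ Q) (hQ1 : Q ≤ 1/6) (hc : (t+z)^2 ≤ 1/2) (hw0 : 0 ≤ w) (hw1 : w ≤ 1)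
    (hρ : (1-w)*rhoZero Q + w*rhoOne Q ≤ ρ) :
    ∑ j ∈ range (n+1), α j^2 * growth α (n+1) (j+1)^2 ≤
      4*ρ*∑ j ∈ range (n+1), α j^2 + 6*ρ*(t+z)^2*∑ j ∈ range n, α j^2
        + w*(4.4*ρ*(1+2*Q+4*Q^2)*(Q*(t+z))^2) := by
  have hz0 : 0 ≤ z := hz ▸ hα n (by omega)
  have ht0 : 0 ≤ t := ht ▸ sum_nonneg fun k hk => hα k (by have := mem_range.1 hk; omega)
  have ht1 := le_of_mul_add_le ht0 hz0 (hQ.trans hQ1)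
  have ht2 : t^2 ≤ Q := le_trans (by nlinarith) hQ
  have hQ0 : 0 ≤ Q := (sq_nonneg t).trans ht2
  have hF := growth_sq_le_poly hα ht hz (hQ.trans hQ1)
  have hr1 := rhoOne_ge hQ0 hQ1
  have hr0 := rhoOne_le_rhoZero hQ0
  have hρ1 : rhoOne Q ≤ ρ := by nlinarith
  have hex := excess_le ht0 ht1 hz0 (by linarith) ht2 hQ1 hw0 hw1 hρ
    (growth_sq_le_rhoZero ht0 hz0 hQ hQ1 hc hF) (growth_sq_le_rhoOne ht0 hz0 hQ hQ1 hc hF)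
  have hρ0 : 0 < ρ := by linarith
  have hk := sum_sq_mul_sq_le (n := n) (α := α) (f := fun j => growth α (n+1) (j+1))
    (F := growth α (n+1) 0^2) (P := ρ*(4+6*(t+z)^2))
    (fun j hj => hα j (by omega)) (fun j hj => by
      rw [← mul_pow]
      have := growth_mul_le hα (show j < n+1 by omega)
      have h1 := one_le_growth hα (j+1)
      have h2 := hα j (by omega)
      exact pow_le_pow_left₀ (by positivity) this 2) (by positivity)
  rw [sum_range_succ_growth, sum_range_succ, ← hz]
  rw [← ht] at hk
  linarith
end client

/-! ### Noise coefficient of the drift -/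

section client
variable {α : ℕ → ℝ} {n : ℕ} {t z Q ρ : ℝ}

/-- Linear bounds for `a / (1 + a)²` and `a / (1 + a)`, by tangents near `a = 0.21`. -/
theorem term_le_tangent {a f y : ℝ} (ha : 0 ≤ a) (hf : 1 ≤ f) (hy : 1 ≤ y) (hfy : f*(1+a) ≤ y) :
    a^2*(f^2 + 3*((y-1)*(f-1))) ≤
      a^2*1.382 + a*(0.14015*y^2-0.090363*y) + a^2*(2.494974*y^2-5.049039*y+1.618) := by
  have h1 : a ≤ (0.049787+0.445935*a)*(1+a)^2 := by
    nlinarith [sq_nonneg (a-0.21), mul_nonneg ha (sq_nonneg (a-0.21))]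
  have h2 : a ≤ (0.030121+0.683013*a)*(1+a) := by
    nlinarith [sq_nonneg (a-0.21)]
  have h3 : a*f ≤ (0.030121+0.683013*a)*y := by
    nlinarith [mul_le_mul_of_nonneg_right h2 (show 0 ≤ f by linarith)]
  have h4 : a*f^2 ≤ (0.049787+0.445935*a)*y^2 := by
    have : (f*(1+a))^2 ≤ y^2 := by gcongr
    nlinarith [mul_le_mul_of_nonneg_right h1 (sq_nonneg f)]
  have h5 := mul_le_mul_of_nonneg_left h3 (show 0 ≤ 3*(y-1) by linarith)
  linarith [mul_le_mul_of_nonneg_left (add_le_add h4 h5) ha]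

theorem sum_noise_le {f : ℕ → ℝ} {y : ℝ} (hα : ∀ j < n, 0 ≤ α j) (hf : ∀ j < n, 1 ≤ f j)
    (hy : 1 ≤ y)
    (hfy : ∀ j < n, f j*(1+α j) ≤ y) (ht : t = ∑ k ∈ range n, α k) (hz : 0 ≤ z)
    (htz : t*(t+z) ≤ 1/6) (hc : (t+z)^2 ≤ 1/2)
    (hy1 : y ≤ (1+z)*(1+t+t^2/2+0.186*t^3)) :
    ∑ j ∈ range n, α j^2*(f j^2 + 3*((y-1)*(f j-1))) ≤
      1.382*∑ j ∈ range n, α j^2 + 0.382*z^2 + 0.4664*(t*(t+z)) := by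
  have ht0 : 0 ≤ t := ht ▸ sum_nonneg fun k hk => hα k (mem_range.1 hk)
  have hb : ∑ j ∈ range n, α j^2 ≤ t^2 := ht ▸ sum_sq_le_sq_sum hα
  have hb0 : 0 ≤ ∑ j ∈ range n, α j^2 := sum_nonneg fun _ _ => sq_nonneg _
  by_cases h : y ≤ 1.272
  · have : ∑ j ∈ range n, α j^2*(f j^2 + 3*((y-1)*(f j-1))) ≤ ∑ j ∈ range n, α j^2*1.8484 := by
      refine sum_le_sum fun j hj => mul_le_mul_of_nonneg_left ?_ (sq_nonneg _)
      have h1 := hα j (mem_range.1 hj)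
      have h2 := hf j (mem_range.1 hj)
      have h3 := hfy j (mem_range.1 hj)
      have h4 : f j ≤ 1.272 := by nlinarith
      nlinarith
    rw [← sum_mul] at this
    nlinarith [sq_nonneg z, mul_nonneg ht0 hz]
  · push Not at h
    have h1 : ∑ j ∈ range n, α j^2*(f j^2 + 3*((y-1)*(f j-1))) ≤
        1.382*∑ j ∈ range n, α j^2 + (t*(0.14015*y^2-0.090363*y) +
          (∑ j ∈ range n, α j^2)*(2.494974*y^2-5.049039*y+1.618)) := by
      rw [ht, sum_mul, sum_mul, mul_sum, ← sum_add_distrib, ← sum_add_distrib]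
      refine sum_le_sum fun j hj => ?_
      have := term_le_tangent (hα j (mem_range.1 hj)) (hf j (mem_range.1 hj)) hy
          (hfy j (mem_range.1 hj))
      linarith
    refine h1.trans ?_
    rw [add_assoc]
    refine add_le_add le_rfl ?_
    by_cases hs : 2.494974*y^2-5.049039*y+1.618 ≤ 0
    · have hy2 : y ≤ 1.6245 := by nlinarith
      have h2 := tangent_coeff_le (c := t+z) (by linarith) h.le hy2
          (by linarith [growth_poly_sub_one_le_cubic ht0 hz htz])
      nlinarith [mul_le_mul_of_nonneg_left h2 ht0, mul_nonneg hb0 (neg_nonneg.2 hs), sq_nonneg z]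
    · push Not at hs
      have hy2 : 1.6244 ≤ y := by nlinarith
      have hyc : y ≤ 1 + 1.27*(t+z) := by linarith [growth_poly_sub_one_le ht0 hz htz]
      have h2 := tangent_le_of_large (c := t+z) ht0 (by linarith) (by linarith) (by nlinarith) htz
      have e : t + z - t = z := by ring
      rw [e] at h2
      refine le_trans ?_ h2
      have h3 : 2.494974*y^2-5.049039*y+1.618 ≤
          2.494974*(1+1.27*(t+z))^2-5.049039*(1+1.27*(t+z))+1.618 := by
        nlinarith
      have h4 : 0.14015*y^2-0.090363*y ≤ 0.14015*(1+1.27*(t+z))^2-0.090363*(1+1.27*(t+z)) := by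
        nlinarith
      have h5 := mul_le_mul_of_nonneg_left h4 ht0
      have h6 : (∑ j ∈ range n, α j^2)*(2.494974*y^2-5.049039*y+1.618) ≤
        t^2*(2.494974*(1+1.27*(t+z))^2-5.049039*(1+1.27*(t+z))+1.618) :=
        mul_le_mul hb h3 hs.le (sq_nonneg t)
      linarith

theorem sum_growth_sub_one :
    ∑ j ∈ range (n+1), α j^2 * (growth α (n+1) (j+1) - 1) =
      ∑ j ∈ range n, α j^2 * (growth α (n+1) (j+1) - 1) := by
  rw [sum_range_succ, growth_self]; ring

/-- The coefficient of `σ²` in the variance plus three times the squared drift. -/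
theorem noise_drift_le (hα : ∀ k < n+1, 0 ≤ α k) (ht : t = ∑ k ∈ range n, α k) (hz : z = α n)
    (hQ : t*(t+z) ≤ Q) (hQ1 : Q ≤ 1/6) (hc : (t+z)^2 ≤ 1/2) (hρ : 0.3455 ≤ ρ) :
    ∑ j ∈ range (n+1), α j^2 * growth α (n+1) (j+1)^2 +
      3*((growth α (n+1) 0 - 1) * ∑ j ∈ range (n+1), α j^2 * (growth α (n+1) (j+1) - 1)) ≤
      4*ρ*∑ j ∈ range (n+1), α j^2 + 1.35*ρ*Q := by
  have hz0 : 0 ≤ z := hz ▸ hα n (by omega)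
  have ht0 : 0 ≤ t := ht ▸ sum_nonneg fun k hk => hα k (by have := mem_range.1 hk; omega)
  have h := sum_noise_le (n := n) (f := fun j => growth α (n+1) (j+1)) (y := growth α (n+1) 0)
    (fun j hj => hα j (by omega)) (fun j _ => one_le_growth hα _) (one_le_growth hα _)
    (fun j hj => growth_mul_le hα (by omega)) ht hz0 (hQ.trans hQ1) hc
    (growth_le_poly hα ht hz (hQ.trans hQ1))
  rw [sum_range_succ_growth, sum_growth_sub_one, sum_range_succ, ← hz, mul_sum, mul_sum]
  have e : ∑ j ∈ range n, α j^2*(growth α (n+1) (j+1)^2 +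
      3*((growth α (n+1) 0-1)*(growth α (n+1) (j+1)-1)))
    = ∑ j ∈ range n, α j^2 * growth α (n+1) (j+1)^2 +
        ∑ j ∈ range n, 3*((growth α (n+1) 0 - 1) * (α j^2 * (growth α (n+1) (j+1) - 1))) := by
    rw [← sum_add_distrib]; exact sum_congr rfl fun j _ => by ring
  rw [e] at h
  have hb0 : 0 ≤ ∑ j ∈ range n, α j^2 := sum_nonneg fun _ _ => sq_nonneg _
  have hq : 0 ≤ t*(t+z) := by positivity
  have : 1.35*0.3455*(t*(t+z)) ≤ 1.35*ρ*Q := by gcongr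
  nlinarith [mul_le_mul_of_nonneg_right hρ hb0, mul_le_mul_of_nonneg_right hρ (sq_nonneg z)]

/-- The coefficient of `σ²` in the squared drift. -/
theorem excess_noise_le (hα : ∀ k < n+1, 0 ≤ α k) (ht : t = ∑ k ∈ range n, α k) (hz : z = α n)
    (hQ : t*(t+z) ≤ Q) (hQ1 : Q ≤ 1/6) (hc : (t+z)^2 ≤ 1/2) (hρ : 0.3455 ≤ ρ) :
    (growth α (n+1) 0 - 1) * ∑ j ∈ range (n+1), α j^2 * (growth α (n+1) (j+1) - 1) ≤
      6*ρ*(t+z)^2*∑ j ∈ range n, α j^2 ∧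
    4*((growth α (n+1) 0 - 1) * ∑ j ∈ range (n+1), α j^2 * (growth α (n+1) (j+1) - 1)) ≤ 3*ρ*Q := by
  have hz0 : 0 ≤ z := hz ▸ hα n (by omega)
  have ht0 : 0 ≤ t := ht ▸ sum_nonneg fun k hk => hα k (by have := mem_range.1 hk; omega)
  have hE := growth_sub_one_le hα ht hz (hQ.trans hQ1)
  have h1 := one_le_growth hα 0
  have hb0 : 0 ≤ ∑ j ∈ range n, α j^2 := sum_nonneg fun _ _ => sq_nonneg _
  have hc0 : 0 ≤ t + z := by positivity
  rw [sum_growth_sub_one]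
  set E := growth α (n+1) 0 - 1 with hEd
  have hE0 : 0 ≤ E := by linarith
  constructor
  · have h2 : ∑ j ∈ range n, α j^2 * (growth α (n+1) (j+1) - 1) ≤ E * ∑ j ∈ range n, α j^2 := by
      rw [mul_sum]
      refine sum_le_sum fun j hj => ?_
      rw [mul_comm]
      have := growth_le_growth_zero hα (show j+1 ≤ n+1 by have := mem_range.1 hj; omega)
      exact mul_le_mul_of_nonneg_right (by linarith) (sq_nonneg _)
    have h3 : E^2 ≤ (1.27*(t+z))^2 := by gcongr
    calc _ ≤ E*(E * ∑ j ∈ range n, α j^2) := by gcongr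
      _ = E^2 * ∑ j ∈ range n, α j^2 := by ring
      _ ≤ _ := by
        refine mul_le_mul_of_nonneg_right (h3.trans ?_) hb0
        nlinarith [sq_nonneg (t+z)]
  · have h2 : ∑ j ∈ range n, α j^2 * (growth α (n+1) (j+1) - 1) ≤ E^2/4*t := by
      rw [ht, mul_sum]
      refine sum_le_sum fun j hj => ?_
      have hj' : j < n+1 := by have := mem_range.1 hj; omega
      have h3 := growth_mul_le hα hj'
      have h4 := one_le_growth hα (j+1)
      have h5 := hα j hj'
      have h6 : α j * (growth α (n+1) (j+1) - 1) ≤ E^2/4 := by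
        have : α j * (growth α (n+1) (j+1) - 1) ≤ α j * (E - α j) := by
          apply mul_le_mul_of_nonneg_left _ h5; nlinarith
        nlinarith [sq_nonneg (E - 2*α j)]
      nlinarith [mul_le_mul_of_nonneg_left h6 h5]
    have h3 : E^3 ≤ (1.27*(t+z))^3 := by gcongr
    have h4 : 4*(E * ∑ j ∈ range n, α j^2 * (growth α (n+1) (j+1) - 1)) ≤ E^3*t := by
      nlinarith [mul_le_mul_of_nonneg_left h2 hE0]
    have h5 : (1.27*(t+z))^3 ≤ 3*0.3455*(t+z) := by nlinarith
    have h6 : 0 ≤ t*(t+z) := by positivity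
    calc _ ≤ E^3*t := h4
      _ ≤ 3*0.3455*(t+z)*t := by gcongr; exact h3.trans h5
      _ = 3*0.3455*(t*(t+z)) := by ring
      _ ≤ _ := by gcongr

end client

/-! ### Recursions for the moments of a local run -/

/-- The recursions satisfied by the moments of a local run with step sizes `a k`, where `q` is the
local learning rate times the smoothness constant: `V k` is the variance of the gradient
accumulated in `k` steps, `v k` the variance of the exact gradient at step `k`, `D k` the distance
of its mean from the initial gradient, whose norm is `g`, and `σ²` bounds the variance of the
gradient noise. The squared norm of the mean accumulated gradient enters through its bound by `(∑
a j) g + ∑ a j D j`. -/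
structure IsLocalRun (a : ℕ → ℝ) (K : ℕ) (q g σ : ℝ) (V v D : ℕ → ℝ) : Prop where
  a_nonneg : ∀ k < K, 0 ≤ a k
  g_nonneg : 0 ≤ g
  V_zero : V 0 = 0
  V_nonneg : ∀ k, 0 ≤ V k
  v_nonneg : ∀ k, 0 ≤ v k
  D_nonneg : ∀ k, 0 ≤ D k
  V_succ : ∀ k < K, V (k+1) ≤ (√(V k) + a k * √(v k))^2 + a k^2 * σ^2
  v_le_mul : ∀ k < K, v k ≤ q^2 * V k
  add_le_mul : ∀ k < K, v k + D k^2 ≤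
    q^2 * (V k + ((∑ j ∈ range k, a j) * g + ∑ j ∈ range k, a j * D j)^2)

/-- Minkowski's inequality in the plane. -/
theorem add_sq_add_add_sq_le {a b c d r s : ℝ} (hr : 0 ≤ r) (hs : 0 ≤ s) (h1 : a^2+b^2 ≤ r^2)
    (h2 : c^2+d^2 ≤ s^2) : (a+c)^2+(b+d)^2 ≤ (r+s)^2 := by
  have h3 : a*c+b*d ≤ r*s := by
    apply le_of_sq_le_sq _ (by positivity)
    calc (a*c+b*d)^2 ≤ (a^2+b^2)*(c^2+d^2) := by nlinarith [sq_nonneg (a*d-b*c)]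
      _ ≤ r^2*s^2 := by gcongr
      _ = (r*s)^2 := by ring
  linarith

/-- One step of the potential used for `IsLocalRun.variance_add_drift_sq_le`: the shift `e` may be
negative, and only its positive part is lost. -/
theorem potential_step {a V v M D e : ℝ} (ha : 0 ≤ a) (hV : 0 ≤ V) (hv : 0 ≤ v) (hvV : v ≤ V)
    (hM : 0 ≤ M) (hD : 0 ≤ D) (hMe : 0 ≤ M + e) (h : v + D^2 ≤ V + M^2) :
    (√V + a*√v)^2 + (M + a*D + e)^2 ≤ (1+a)^2*V + ((1+a)*M+e)^2 + a*(max e 0)^2 := by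
  have h1 : 2*(√V*√v) ≤ V + v := by
    have := sq_nonneg (√V - √v)
    nlinarith [Real.sq_sqrt hV, Real.sq_sqrt hv]
  have h2 : V + v + 2*D*(M+e) ≤ 2*V + 2*M*(M+e) + (max e 0)^2 := by
    rcases le_total 0 e with he | he
    · rw [max_eq_left he]; nlinarith [sq_nonneg (D-(M+e))]
    · rw [max_eq_right he]
      rcases le_total D M with hDM | hDM
      · nlinarith
      · nlinarith [mul_nonneg (sub_nonneg.2 hDM) (neg_nonneg.2 he)]
  have h3 := mul_le_mul_of_nonneg_left (add_le_add h1 h2) ha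
  have h4 := mul_le_mul_of_nonneg_left h (sq_nonneg a)
  nlinarith [Real.sq_sqrt hV, Real.sq_sqrt hv]

namespace IsLocalRun
variable {α : ℕ → ℝ} {K n : ℕ} {g σ : ℝ} {V v D : ℕ → ℝ}

/-- Rescaling the step sizes by `q` reduces to the case `q = 1`. -/
theorem scale {a : ℕ → ℝ} {q : ℝ} (h : IsLocalRun a K q g σ V v D) (hq : 0 < q) :
    IsLocalRun (fun k => q * a k) K 1 g σ (fun k => q^2 * V k) v D where
  a_nonneg k hk := mul_nonneg hq.le (h.a_nonneg k hk)
  g_nonneg := h.g_nonneg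
  V_zero := by simp [h.V_zero]
  V_nonneg k := mul_nonneg (sq_nonneg q) (h.V_nonneg k)
  v_nonneg := h.v_nonneg
  D_nonneg := h.D_nonneg
  V_succ k hk := by
    have := mul_le_mul_of_nonneg_left (h.V_succ k hk) (sq_nonneg q)
    rw [Real.sqrt_mul (sq_nonneg q), Real.sqrt_sq hq.le]
    linarith
  v_le_mul k hk := by simpa using h.v_le_mul k hk
  add_le_mul k hk := by
    refine (h.add_le_mul k hk).trans_eq ?_
    simp only [mul_assoc, ← mul_sum]
    ring

theorem v_le (h : IsLocalRun α K 1 g σ V v D) : ∀ k < K, v k ≤ V k := fun k hk => by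
  simpa using h.v_le_mul k hk

theorem add_le (h : IsLocalRun α K 1 g σ V v D) : ∀ k < K, v k + D k^2 ≤
    V k + ((∑ j ∈ range k, α j) * g + ∑ j ∈ range k, α j * D j)^2 := fun k hk => by
  simpa using h.add_le_mul k hk

theorem sq_le (h : IsLocalRun α K 1 g σ V v D) {k : ℕ} (hk : k < K) :
    (√(V k) + α k * √(v k))^2 ≤ (1 + α k)^2 * V k := by
  have h1 : √(v k) ≤ √(V k) := Real.sqrt_le_sqrt (h.v_le k hk)
  have ha := h.a_nonneg k hk
  calc _ ≤ (√(V k) + α k * √(V k))^2 := by gcongr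
    _ = (1 + α k)^2 * √(V k)^2 := by ring
    _ = _ := by rw [Real.sq_sqrt (h.V_nonneg k)]

/-- The recursion `V (k + 1) ≤ (1 + α k)² V k + α k² σ²`, unrolled. -/
theorem variance_le (h : IsLocalRun α K 1 g σ V v D) :
    V K ≤ (∑ j ∈ range K, α j^2 * growth α K (j+1)^2) * σ^2 := by
  have key : ∀ k ≤ K, growth α K k^2 * V k ≤ (∑ j ∈ range k, α j^2 * growth α K (j+1)^2) * σ^2 := by
    intro k
    induction k with
    | zero => simp [h.V_zero]
    | succ k ih =>
      intro hk
      have ih := ih (by omega)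
      rw [growth_eq_mul (show k < K by omega)] at ih
      rw [sum_range_succ]
      have h1 := (h.V_succ k hk).trans (add_le_add_left (h.sq_le hk) _)
      nlinarith [mul_le_mul_of_nonneg_left h1 (sq_nonneg (growth α K (k+1)))]
  simpa [growth_self] using key K le_rfl

theorem sum_mul_growth (α : ℕ → ℝ) (K : ℕ) :
    ∑ k ∈ range K, α k * growth α K (k+1) = growth α K 0 - 1 := by
  have : ∀ k ∈ range K, α k * growth α K (k+1) = growth α K k - growth α K (k+1) := fun k hk => by
    rw [growth_eq_mul (mem_range.1 hk)]; ring
  rw [sum_congr rfl this, sum_range_sub', growth_self]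

theorem sum_mul_growth_mul_sum (α : ℕ → ℝ) (K : ℕ) :
    ∑ k ∈ range K, α k * growth α K (k+1) * ∑ j ∈ range k, α j^2 =
      ∑ j ∈ range K, α j^2 * (growth α K (j+1) - 1) := by
  have key : ∀ m ≤ K, ∑ k ∈ range m, α k * growth α K (k+1) * ∑ j ∈ range k, α j^2 =
      ∑ j ∈ range m, α j^2 * growth α K (j+1) - growth α K m * ∑ j ∈ range m, α j^2 := by
    intro m
    induction m with
    | zero => simp
    | succ m ih =>
      intro hm
      have ih := ih (by omega)
      rw [growth_eq_mul (show m < K by omega)] at ih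
      rw [sum_range_succ, ih, sum_range_succ, sum_range_succ]
      ring
  rw [key K le_rfl, growth_self, one_mul, ← sum_sub_distrib]
  exact sum_congr rfl fun _ _ => by ring

/-- With `Y` the accumulated standard deviations and `T` the accumulated drifts, `Y² + T²` obeys a
linear recursion for its square root, whose solution is estimated by the Cauchy-Schwarz
inequality. -/
theorem drift_sq_le (h : IsLocalRun α K 1 g σ V v D) :
    (∑ k ∈ range K, α k * D k)^2 ≤ (growth α K 0 - 1) *
      ((∑ k ∈ range K, α k * growth α K (k+1) * (∑ j ∈ range k, α j)^2) * g^2 +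
        (∑ j ∈ range K, α j^2 * (growth α K (j+1) - 1)) * σ^2) := by
  set s : ℕ → ℝ := fun k => √((∑ j ∈ range k, α j^2) * σ^2) with hs
  set r : ℕ → ℝ := fun k => √((∑ j ∈ range k, α j)^2 * g^2 + (∑ j ∈ range k, α j^2) * σ^2) with hr
  set Y : ℕ → ℝ := fun k => ∑ j ∈ range k, α j * √(v j) with hY
  set T : ℕ → ℝ := fun k => ∑ j ∈ range k, α j * D j with hT
  set U : ℕ → ℝ := fun k => ∑ j ∈ range k, α j * growth α K (j+1) * r j with hU
  have hf : ∀ k, 0 < growth α K k := fun k => one_pos.trans_le (one_le_growth h.a_nonneg k)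
  have hs2 : ∀ k, s k^2 = (∑ j ∈ range k, α j^2) * σ^2 := fun k =>
    Real.sq_sqrt (mul_nonneg (sum_nonneg fun _ _ => sq_nonneg _) (sq_nonneg σ))
  have hr2 : ∀ k, r k^2 = (∑ j ∈ range k, α j)^2 * g^2 + (∑ j ∈ range k, α j^2) * σ^2 := fun k =>
    Real.sq_sqrt (add_nonneg (by positivity) (mul_nonneg (sum_nonneg fun _ _ => sq_nonneg _)
        (sq_nonneg σ)))
  have hU0 : ∀ k ≤ K, 0 ≤ U k := fun k hk => sum_nonneg fun j hj =>
    mul_nonneg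
        (mul_nonneg (h.a_nonneg j (by have := mem_range.1 hj; omega)) (hf _).le) (Real.sqrt_nonneg _)
  have hY0 : ∀ k ≤ K, 0 ≤ Y k := fun k hk => sum_nonneg fun j hj =>
    mul_nonneg (h.a_nonneg j (by have := mem_range.1 hj; omega)) (Real.sqrt_nonneg _)
  have key : ∀ k ≤ K, V k ≤ (s k + Y k)^2 ∧ Y k^2 + T k^2 ≤ (U k / growth α K k)^2 := by
    intro k
    induction k with
    | zero => simp [h.V_zero, hs, hY, hT, hU]
    | succ k ih =>
      intro hk
      obtain ⟨ih1, ih2⟩ := ih (by omega)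
      have ha := h.a_nonneg k hk
      have hYs : Y (k+1) = Y k + α k * √(v k) := sum_range_succ _ _
      have hTs : T (k+1) = T k + α k * D k := sum_range_succ _ _
      have hsk : 0 ≤ s k := Real.sqrt_nonneg _
      have hrk : 0 ≤ r k := Real.sqrt_nonneg _
      have hss : s (k+1)^2 = s k^2 + α k^2 * σ^2 := by rw [hs2, hs2, sum_range_succ]; ring
      have hle : s k ≤ s (k+1) := abs_le_of_sq_le_sq'
          (by rw [hss]; nlinarith [sq_nonneg (α k * σ)]) (Real.sqrt_nonneg _) |>.2
      constructor
      · have h1 : √(V k) ≤ s k + Y k := Real.sqrt_le_iff.2 ⟨add_nonneg hsk (hY0 k (by omega)), ih1⟩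
        have h2 : (√(V k) + α k * √(v k))^2 ≤ (s k + Y (k+1))^2 := by
          rw [hYs, ← add_assoc]; gcongr
        have h3 := h.V_succ k hk
        nlinarith [mul_le_mul_of_nonneg_right hle (hY0 (k+1) hk)]
      · have e : U (k+1) / growth α K (k+1) = U k / growth α K k +
            α k * (r k + U k / growth α K k) := by
          have := hf (k+1)
          have h1 : 0 < 1 + α k := by linarith
          rw [growth_eq_mul (show k < K by omega), show U (k+1) = U k +
              α k * growth α K (k+1) * r k from sum_range_succ _ _]
          field_simp
          ring
        have hR : 0 ≤ U k / growth α K k := div_nonneg (hU0 k (by omega)) (hf k).le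
        have h4 : v k + D k^2 ≤ (r k + U k / growth α K k)^2 := by
          have h5 := add_sq_add_add_sq_le (a := s k) (b := (∑ j ∈ range k, α j) * g) hrk hR
            (by rw [hs2, hr2]; apply le_of_eq; ring) ih2
          linarith [h.add_le k hk]
        rw [e, hYs, hTs]
        refine add_sq_add_add_sq_le hR (by positivity) ih2 ?_
        rw [mul_pow, mul_pow, mul_pow, Real.sq_sqrt (h.v_nonneg k), ← mul_add]
        gcongr
  have h1 := (key K le_rfl).2
  rw [growth_self, div_one] at h1
  have h2 : U K^2 ≤ (∑ k ∈ range K, α k * growth α K (k+1)) *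
      ∑ k ∈ range K, α k * growth α K (k+1) * r k^2 :=
    sum_sq_le_sum_mul_sum_of_sq_le_mul _ (fun k hk => mul_nonneg (h.a_nonneg k (mem_range.1 hk))
        (hf _).le)
      (fun k hk => mul_nonneg (mul_nonneg (h.a_nonneg k (mem_range.1 hk)) (hf _).le) (sq_nonneg _))
      (fun k hk => le_of_eq (by ring))
  have h3 : ∑ k ∈ range K, α k * growth α K (k+1) * r k^2 =
      (∑ k ∈ range K, α k * growth α K (k+1) * (∑ j ∈ range k, α j)^2) * g^2 +
        (∑ j ∈ range K, α j^2 * (growth α K (j+1) - 1)) * σ^2 := by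
    rw [← sum_mul_growth_mul_sum, sum_mul, sum_mul, ← sum_add_distrib]
    exact sum_congr rfl fun k _ => by rw [hr2]; ring
  rw [sum_mul_growth, h3] at h2
  nlinarith [sq_nonneg (Y K)]

/-- A bound for the variance and the drift together. With the growth factors `f k`, the potential
`(f k)² V k + (f k (A k g + T k) + g η k)²`, where `A` and `T` are the partial sums of `α` and `α
D`, grows only by the noise and by the loss in `potential_step`; the shift `η k` makes its final
value the desired left-hand side. -/
theorem variance_add_drift_sq_le (h : IsLocalRun α (n+1) 1 g σ V v D) :
    V (n+1) + (∑ k ∈ range (n+1), α k * D k)^2 ≤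
      (∑ j ∈ range (n+1), α j^2 * growth α (n+1) (j+1)^2) * σ^2 +
      (1 + ∑ k ∈ range n, α k) * (growth α (n+1) 0 - 1 - ∑ k ∈ range (n+1), α k)^2 * g^2 := by
  set f := growth α (n+1) with hfdef
  set T : ℕ → ℝ := fun k => ∑ j ∈ range k, α j * D j with hT
  set A : ℕ → ℝ := fun k => ∑ j ∈ range k, α j with hA
  -- `η k = ∑_{l ≥ k} α_l f_{l+1} - ∑ α`, the sum being telescopic
  set η : ℕ → ℝ := fun k => f k - 1 - A (n+1) with hη
  have hf1 : ∀ k, 1 ≤ f k := fun k => one_le_growth h.a_nonneg k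
  have hA0 : ∀ k ≤ n+1, 0 ≤ A k := fun k hk => sum_nonneg fun j hj =>
    h.a_nonneg j (by have := mem_range.1 hj; omega)
  have hT0 : ∀ k ≤ n+1, 0 ≤ T k := fun k hk => sum_nonneg fun j hj =>
    mul_nonneg (h.a_nonneg j (by have := mem_range.1 hj; omega)) (h.D_nonneg j)
  have hη0 : 0 ≤ η 0 := by
    have := one_add_sum_le_growth h.a_nonneg
    simp only [hη, hA, hfdef]
    linarith
  have hηle : ∀ k ≤ n+1, η k ≤ η 0 := fun k hk => by
    have := growth_le_growth_zero h.a_nonneg hk; simp only [hη, hfdef]; linarith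
  have hηn : η n ≤ 0 := by
    have e : f n = 1 + α n := by
      rw [hfdef, growth_eq_mul (show n < n+1 by omega), growth_self, mul_one]
    have e2 : A (n+1) = A n + α n := sum_range_succ _ _
    simp only [hη]; rw [e, e2]; have := hA0 n (by omega); linarith
  have hηA : ∀ k ≤ n, 0 ≤ f (k+1) * A k + η k := by
    -- `f k - 1 ≥ ∑_{k ≤ l} α l`
    have : ∀ m k, k + m = n+1 → A (n+1) - A k ≤ f k - 1 := by
      intro m
      induction m with
      | zero => intro k hk; simp only [add_zero] at hk; subst hk; simp [hfdef, growth_self]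
      | succ m ih =>
        intro k hk
        have h1 := ih (k+1) (by omega)
        have e : A (k+1) = A k + α k := sum_range_succ _ _
        have h2 := h.a_nonneg k (by omega)
        rw [hfdef, growth_eq_mul (show k < n+1 by omega), ← hfdef]
        nlinarith [hf1 (k+1)]
    intro k hk
    have h1 := this (n+1-k) k (by omega)
    simp only [hη]
    nlinarith [hf1 (k+1), hA0 k (by omega)]
  have key : ∀ k ≤ n+1, f k^2 * V k + (f k * (A k * g + T k) + g * η k)^2 ≤
      (g * η 0)^2 + (∑ j ∈ range k, α j^2 * f (j+1)^2) * σ^2 + (A (min k n)) * (η 0)^2 * g^2 := by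
    intro k
    induction k with
    | zero => simp [h.V_zero, hA, hT]
    | succ k ih =>
      intro hk
      have ih := ih (by omega)
      have ha := h.a_nonneg k hk
      have hfk : f k = (1 + α k) * f (k+1) := growth_eq_mul (show k < n+1 by omega)
      have hfp : 0 < f (k+1) := one_pos.trans_le (hf1 _)
      have hTs : T (k+1) = T k + α k * D k := sum_range_succ _ _
      have hAs : A (k+1) = A k + α k := sum_range_succ _ _
      have hηs : η k = η (k+1) + α k * f (k+1) := by simp only [hη]; rw [hfk]; ring
      have hM : 0 ≤ A k * g + T k :=
        add_nonneg (mul_nonneg (hA0 k (by omega)) h.g_nonneg) (hT0 k (by omega))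
      have step := potential_step (e := g * η k / f (k+1)) ha (h.V_nonneg k) (h.v_nonneg k)
        (h.v_le k hk) hM (h.D_nonneg k) (by
          have : 0 ≤ (f (k+1) * A k + η k) * g / f (k+1) :=
            div_nonneg (mul_nonneg (hηA k (by omega)) h.g_nonneg) hfp.le
          have e : (f (k+1) * A k + η k) * g / f (k+1) = A k * g + g * η k / f (k+1) := by
            field_simp
          linarith [hT0 k (by omega)]) (h.add_le k hk)
      have hgap : f (k+1)^2 * (α k * (max (g * η k / f (k+1)) 0)^2) ≤
          (A (min (k+1) n) - A (min k n)) * (η 0)^2 * g^2 := by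
        have e : f (k+1)^2 * (α k * (max (g * η k / f (k+1)) 0)^2) = α k * (max (g * η k) 0)^2 := by
          have : max (g * η k) 0 = f (k+1) * max (g * η k / f (k+1)) 0 := by
            rw [mul_max_of_nonneg _ _ hfp.le, mul_zero, mul_div_cancel₀ _ hfp.ne']
          rw [this]; ring
        rw [e]
        rcases Nat.lt_or_ge k n with hkn | hkn
        · rw [min_eq_left (show k+1 ≤ n by omega), min_eq_left hkn.le, hAs]
          have : max (g * η k) 0 ≤ g * η 0 :=
            max_le (mul_le_mul_of_nonneg_left (hηle k (by omega)) h.g_nonneg)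
                (mul_nonneg h.g_nonneg hη0)
          have := pow_le_pow_left₀ (le_max_right _ _) this 2
          nlinarith [mul_le_mul_of_nonneg_left this ha]
        · obtain rfl : k = n := by omega
          rw [max_eq_right (mul_nonpos_of_nonneg_of_nonpos h.g_nonneg hηn)]
          simp
      have e1 : f (k+1)^2 * ((1+α k)^2*V k + ((1+α k)*(A k * g + T k)+g * η k / f (k+1))^2) =
          f k^2 * V k + (f k * (A k * g + T k) + g * η k)^2 := by
        rw [hfk]; field_simp
      have e2 : f (k+1) * (A (k+1) * g + T (k+1)) + g * η (k+1) =
          f (k+1) * (A k * g + T k + α k * D k + g * η k / f (k+1)) := by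
        rw [hηs, hTs, hAs]; field_simp; ring
      rw [e2, sum_range_succ]
      have h1 := mul_le_mul_of_nonneg_left step (sq_nonneg (f (k+1)))
      have h2 := mul_le_mul_of_nonneg_left (h.V_succ k hk) (sq_nonneg (f (k+1)))
      nlinarith
  have hfin := key (n+1) le_rfl
  have e : f (n+1) = 1 := growth_self _ _
  have e2 : η (n+1) = - A (n+1) := by simp only [hη]; rw [e]; ring
  rw [e, e2, min_eq_right (by omega)] at hfin
  have e3 : (1 * (A (n+1) * g + T (n+1)) + g * -A (n+1))^2 = T (n+1)^2 := by ring
  rw [e3] at hfin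
  simp only [hη] at hfin
  nlinarith

end IsLocalRun

/-! ### Bounds for a local run -/

namespace IsLocalRun
variable {a : ℕ → ℝ} {n : ℕ} {q g σ C ρ w d : ℝ} {V v D : ℕ → ℝ}

theorem variance_le_of_zero {K : ℕ} (h : IsLocalRun a K 0 g σ V v D) :
    V K ≤ (∑ j ∈ range K, a j^2) * σ^2 := by
  have key : ∀ k ≤ K, V k ≤ (∑ j ∈ range k, a j^2) * σ^2 := by
    intro k
    induction k with
    | zero => simp [h.V_zero]
    | succ k ih =>
      intro hk
      have ih := ih (by omega)
      have h1 := h.v_le_mul k hk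
      have h2 : v k = 0 := le_antisymm (by linarith) (h.v_nonneg k)
      have h3 := h.V_succ k hk
      rw [h2, Real.sqrt_zero, mul_zero, add_zero, Real.sq_sqrt (h.V_nonneg k)] at h3
      rw [sum_range_succ]; linarith
  exact key K le_rfl

theorem drift_eq_zero {K : ℕ} (h : IsLocalRun a K 0 g σ V v D) :
    ∑ j ∈ range K, a j * D j = 0 := by
  refine sum_eq_zero fun j hj => ?_
  have h1 := h.add_le_mul j (mem_range.1 hj)
  have h2 := h.v_nonneg j
  have : D j = 0 := by
    rw [← sq_eq_zero_iff]; exact le_antisymm (by linarith) (sq_nonneg _)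
  rw [this, mul_zero]

/-- The smallness conditions on the step sizes, and the range of the rate `ρ`. Here `C` bounds
`a_i (a_i - a_{i,-1})` and `w` interpolates between `rhoZero` and `rhoOne`. -/
structure Small (a : ℕ → ℝ) (n : ℕ) (q C ρ w : ℝ) : Prop where
  C_nonneg : 0 ≤ C
  le_C : (∑ k ∈ range (n+1), a k) * ∑ k ∈ range n, a k ≤ C
  Q_le : q^2 * C ≤ 1/6
  sq_le : (q * ∑ k ∈ range (n+1), a k)^2 ≤ 1/2
  w_nonneg : 0 ≤ w
  w_le : w ≤ 1
  ρ_ge : (1-w)*rhoZero (q^2*C) + w*rhoOne (q^2*C) ≤ ρ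

theorem Small.ρ_ge' (hs : Small a n q C ρ w) : 0.3455 ≤ ρ := by
  have h0 : 0 ≤ q^2*C := mul_nonneg (sq_nonneg q) hs.C_nonneg
  have h1 := rhoOne_ge h0 hs.Q_le
  have h2 := rhoOne_le_rhoZero h0
  nlinarith [hs.ρ_ge, hs.w_nonneg, hs.w_le]

/-- The bounds for variance and drift in terms of two noise coefficients, `S` for the variance and
`B` for the squared drift. -/
theorem scaled_bounds (h : IsLocalRun a (n+1) q g σ V v D) (hs : Small a n q C ρ w) (hq : 0 < q) :
    ∃ S B : ℝ, 0 ≤ B ∧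
      q^2*(V (n+1) + (∑ k ∈ range (n+1), a k * D k)^2) ≤
        S*σ^2 + (q*∑ k ∈ range (n+1), a k)^2 * driftCoeff (q^2*C) * g^2 ∧
      q^2*(∑ k ∈ range (n+1), a k * D k)^2 ≤
        B*σ^2 + (q*∑ k ∈ range (n+1), a k)^2 * driftCoeff (q^2*C) * g^2 ∧
      q^2*V (n+1) ≤ S*σ^2 ∧
      S ≤ q^2*(4*ρ*∑ k ∈ range (n+1), a k^2 + 6*ρ*q^2*(∑ k ∈ range (n+1), a k)^2*
          ∑ k ∈ range n, a k^2
        + w*(4.4*ρ*(1+2*(q^2*C)+4*(q^2*C)^2)*(q^2*C)^2*(∑ k ∈ range (n+1), a k)^2)) ∧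
      S + 3*B ≤ q^2*(4*ρ*∑ k ∈ range (n+1), a k^2 + 1.35*ρ*C) ∧
      B ≤ q^2*(6*ρ*q^2*(∑ k ∈ range (n+1), a k)^2*∑ k ∈ range n, a k^2) ∧
      4*B ≤ q^2*(3*ρ*C) := by
  have hsc := h.scale hq
  set α := fun k => q * a k with hα
  have e1 : ∑ k ∈ range n, α k = q * ∑ k ∈ range n, a k := by rw [mul_sum]
  have e2 : ∑ k ∈ range (n+1), α k = q * ∑ k ∈ range (n+1), a k := by rw [mul_sum]
  have e3 : ∀ m, ∑ k ∈ range m, α k^2 = q^2 * ∑ k ∈ range m, a k^2 := fun m => by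
    rw [mul_sum]; exact sum_congr rfl fun k _ => by simp only [hα]; ring
  have e4 : ∑ k ∈ range (n+1), α k * D k = q * ∑ k ∈ range (n+1), a k * D k := by
    rw [mul_sum]; exact sum_congr rfl fun k _ => by simp only [hα]; ring
  have e5 : q * ∑ k ∈ range n, a k + α n = q * ∑ k ∈ range (n+1), a k := by
    rw [sum_range_succ]; simp only [hα]; ring
  have hQ : (q * ∑ k ∈ range n, a k) * (q * ∑ k ∈ range n, a k + α n) ≤ q^2*C := by
    rw [e5]; have := mul_le_mul_of_nonneg_left hs.le_C (sq_nonneg q); linarith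
  have hc : (q * ∑ k ∈ range n, a k + α n)^2 ≤ 1/2 := by rw [e5]; exact hs.sq_le
  have hB0 : 0 ≤ (growth α (n+1) 0 - 1) * ∑ j ∈ range (n+1), α j^2 * (growth α (n+1) (j+1) - 1) :=
    mul_nonneg (sub_nonneg.2 (one_le_growth hsc.a_nonneg _))
      (sum_nonneg fun j _ => mul_nonneg (sq_nonneg _) (sub_nonneg.2 (one_le_growth hsc.a_nonneg _)))
  refine ⟨_, _, hB0, ?_, ?_, hsc.variance_le, ?_, ?_, ?_, ?_⟩
  · have h1 := hsc.variance_add_drift_sq_le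
    have h2 := excess_growth_sq_le hsc.a_nonneg e1.symm rfl hQ hs.Q_le hc
    rw [e5] at h2
    rw [e1, e2, e4] at h1
    have := mul_le_mul_of_nonneg_right h2 (sq_nonneg g)
    linarith
  · have h1 := hsc.drift_sq_le
    have h2 := growth_drift_le hsc.a_nonneg e1.symm rfl hQ hs.Q_le hc
    rw [e5] at h2
    rw [e4] at h1
    have := mul_le_mul_of_nonneg_right h2 (sq_nonneg g)
    linarith
  · have h1 := noise_le hsc.a_nonneg e1.symm rfl hQ hs.Q_le hc hs.w_nonneg hs.w_le hs.ρ_ge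
    rw [e5, e3, e3] at h1
    linarith
  · have h1 := noise_drift_le hsc.a_nonneg e1.symm rfl hQ hs.Q_le hc hs.ρ_ge'
    rw [e3] at h1
    linarith
  · have h1 := (excess_noise_le hsc.a_nonneg e1.symm rfl hQ hs.Q_le hc hs.ρ_ge').1
    rw [e3, e5] at h1
    linarith
  · have h1 := (excess_noise_le hsc.a_nonneg e1.symm rfl hQ hs.Q_le hc hs.ρ_ge').2
    linarith

/-- `scaled_bounds` divided by `q²`; the case `q = 0` is treated separately. -/
theorem unscaled_bounds (h : IsLocalRun a (n+1) q g σ V v D) (hs : Small a n q C ρ w) (hq : 0 ≤ q) :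
    ∃ S B : ℝ, 0 ≤ B ∧
      V (n+1) + (∑ k ∈ range (n+1), a k * D k)^2 ≤
        S*σ^2 + (∑ k ∈ range (n+1), a k)^2 * driftCoeff (q^2*C) * g^2 ∧
      (∑ k ∈ range (n+1), a k * D k)^2 ≤
        B*σ^2 + (∑ k ∈ range (n+1), a k)^2 * driftCoeff (q^2*C) * g^2 ∧
      V (n+1) ≤ S*σ^2 ∧
      S ≤ 4*ρ*∑ k ∈ range (n+1), a k^2 + 6*ρ*q^2*(∑ k ∈ range (n+1), a k)^2*∑ k ∈ range n, a k^2
        + w*(4.4*ρ*(1+2*(q^2*C)+4*(q^2*C)^2)*(q^2*C)^2*(∑ k ∈ range (n+1), a k)^2) ∧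
      S + 3*B ≤ 4*ρ*∑ k ∈ range (n+1), a k^2 + 1.35*ρ*C ∧
      B ≤ 6*ρ*q^2*(∑ k ∈ range (n+1), a k)^2*∑ k ∈ range n, a k^2 ∧
      4*B ≤ 3*ρ*C := by
  have hρ := hs.ρ_ge'
  have hC := hs.C_nonneg
  rcases hq.eq_or_lt with rfl | hq
  · have h1 := h.variance_le_of_zero
    have h2 := h.drift_eq_zero
    have h3 : 0 ≤ ∑ k ∈ range (n+1), a k^2 := sum_nonneg fun _ _ => sq_nonneg _
    refine ⟨∑ k ∈ range (n+1), a k^2, 0, le_rfl, ?_, ?_, h1, ?_, ?_, ?_, by nlinarith⟩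
    · rw [h2]; simpa [driftCoeff] using h1
    · rw [h2]; simp [driftCoeff]
    · simp; nlinarith
    · nlinarith
    · simp
  · obtain ⟨S, B, h0, h1, h2, h3, h4, h5, h6, h7⟩ := h.scaled_bounds hs hq
    have hq2 : 0 < q^2 := by positivity
    have eS : q^2*(S/q^2) = S := by field_simp
    have eB : q^2*(B/q^2) = B := by field_simp
    refine ⟨S/q^2, B/q^2, by positivity, ?_, ?_, ?_, ?_, ?_, ?_, ?_⟩ <;>
      refine le_of_mul_le_mul_left ?_ hq2
    · refine h1.trans_eq ?_; nth_rw 1 [← eS]; ring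
    · refine h2.trans_eq ?_; nth_rw 1 [← eB]; ring
    · refine h3.trans_eq ?_; nth_rw 1 [← eS]; ring
    · rw [eS]; exact h4
    · rw [mul_add, mul_left_comm (q^2) 3, eS, eB]; exact h5
    · rw [eB]; exact h6
    · rw [mul_left_comm, eB]; exact h7

/-- Interpolates between the bound for the drift alone (`s = 0`) and the bound for drift and
variance together (`s = 1`). -/
theorem drift_add_variance_le (h : IsLocalRun a (n+1) q g σ V v D) (hs : Small a n q C ρ w)
    (hq : 0 ≤ q)
    (hd : 0 ≤ (∑ k ∈ range (n+1), a k) * d) (hdT : (∑ k ∈ range (n+1), a k) * d ≤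
      ∑ k ∈ range (n+1), a k * D k)
    {s : ℝ} (hs0 : 0 ≤ s) (hs1 : s ≤ 1) :
    (∑ k ∈ range (n+1), a k)^2 * d^2 + s * V (n+1) ≤
      (∑ k ∈ range (n+1), a k)^2 * driftCoeff (q^2*C) * g^2 +
      (s*(4*ρ*∑ k ∈ range (n+1), a k^2) + 6*ρ*q^2*(∑ k ∈ range (n+1), a k)^2*∑ k ∈ range n, a k^2
        + s*(w*(4.4*ρ*(1+2*(q^2*C)+4*(q^2*C)^2)*(q^2*C)^2*(∑ k ∈ range (n+1), a k)^2)))*σ^2 := by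
  obtain ⟨S, B, h0, h1, h2, h3, h4, h5, h6, h7⟩ := h.unscaled_bounds hs hq
  have h8 : (∑ k ∈ range (n+1), a k)^2 * d^2 ≤ (∑ k ∈ range (n+1), a k * D k)^2 := by
    rw [← mul_pow]; gcongr
  have hs1' : 0 ≤ 1 - s := by linarith
  have h9 := mul_le_mul_of_nonneg_left h1 hs0
  have h10 := mul_le_mul_of_nonneg_left h2 hs1'
  have h11 := mul_le_mul_of_nonneg_right (add_le_add (mul_le_mul_of_nonneg_left h4 hs0)
      (mul_le_mul_of_nonneg_left h6 hs1')) (sq_nonneg σ)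
  linarith

/-- Bound for the terms that are weighted by `γ_i`; `(g + d)² ≤ (4/3) g² + 4 d²`. -/
theorem variance_add_mean_le (h : IsLocalRun a (n+1) q g σ V v D) (hs : Small a n q C ρ w)
    (hq : 0 ≤ q)
    (hd : 0 ≤ (∑ k ∈ range (n+1), a k) * d) (hdT : (∑ k ∈ range (n+1), a k) * d ≤
      ∑ k ∈ range (n+1), a k * D k) :
    V (n+1) + (∑ k ∈ range (n+1), a k)^2*(g+d)^2 ≤
      (∑ k ∈ range (n+1), a k)^2 * (4/3+4*driftCoeff (q^2*C)) * g^2 +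
      (4*ρ*∑ k ∈ range (n+1), a k^2 + 1.35*ρ*C)*σ^2 := by
  obtain ⟨S, B, h0, h1, h2, h3, h4, h5, h6, h7⟩ := h.unscaled_bounds hs hq
  have h8 : (∑ k ∈ range (n+1), a k)^2 * d^2 ≤ (∑ k ∈ range (n+1), a k * D k)^2 := by
    rw [← mul_pow]; gcongr
  have h9 : (∑ k ∈ range (n+1), a k)^2*(g+d)^2 ≤ (∑ k ∈ range (n+1), a k)^2*(4/3*g^2+4*d^2) := by
    apply mul_le_mul_of_nonneg_left _ (sq_nonneg _)
    nlinarith [sq_nonneg (g-3*d)]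
  have h11 := mul_le_mul_of_nonneg_right h5 (sq_nonneg σ)
  linarith

/-- A version of `variance_add_mean_le` with weights, for use when `α ≥ 1`. -/
theorem variance_add_mean_weighted_le (h : IsLocalRun a (n+1) q g σ V v D) (hs : Small a n q C ρ w)
    (hq : 0 ≤ q)
    (hd : 0 ≤ (∑ k ∈ range (n+1), a k) * d) (hdT : (∑ k ∈ range (n+1), a k) * d ≤
      ∑ k ∈ range (n+1), a k * D k)
    {u ν : ℝ} (hu : 0 ≤ u) (huν : u ≤ ν) :
    u*V (n+1) + ν*((∑ k ∈ range (n+1), a k)^2*(g+d)^2) ≤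
      ν*((∑ k ∈ range (n+1), a k)^2 * (4/3+4*driftCoeff (q^2*C)) * g^2) +
      (u*(4*ρ*∑ k ∈ range (n+1), a k^2) + ν*(3*ρ*C))*σ^2 := by
  obtain ⟨S, B, h0, h1, h2, h3, h4, h5, h6, h7⟩ := h.unscaled_bounds hs hq
  have h8 : (∑ k ∈ range (n+1), a k)^2 * d^2 ≤ (∑ k ∈ range (n+1), a k * D k)^2 := by
    rw [← mul_pow]; gcongr
  have h9 : (∑ k ∈ range (n+1), a k)^2*(g+d)^2 ≤ (∑ k ∈ range (n+1), a k)^2*(4/3*g^2+4*d^2) := by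
    apply mul_le_mul_of_nonneg_left _ (sq_nonneg _)
    nlinarith [sq_nonneg (g-3*d)]
  have hν : 0 ≤ ν := hu.trans huν
  have hρC : 0 ≤ ρ*C := mul_nonneg (by linarith [hs.ρ_ge']) hs.C_nonneg
  have e1 : S + 4*B ≤ 4*ρ*∑ k ∈ range (n+1), a k^2 + 3*ρ*C := by linarith
  have e2 : u*S + 4*ν*B ≤ u*(4*ρ*∑ k ∈ range (n+1), a k^2) + ν*(3*ρ*C) := by
    linarith [mul_le_mul_of_nonneg_left e1 hu, mul_le_mul_of_nonneg_left h7 (sub_nonneg.2 huν)]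
  have h11 := mul_le_mul_of_nonneg_right e2 (sq_nonneg σ)
  have h12 := mul_le_mul_of_nonneg_left h9 hν
  have h13 := mul_le_mul_of_nonneg_left (h8.trans h2) hν
  have h14 := mul_le_mul_of_nonneg_left h3 hu
  linarith

end IsLocalRun

/-! ### Combination of the clients in one round -/

/-- The relations between the constants of one round: `Q = q² C`, `κ₁` is the descent rate and `ρ`
its normalization by `1 - Ω`. The inequality `4 Q β² ≤ 1 - 2 Q` is the step-size condition on `R =
2 Q`. -/
structure RoundConstants (β2 Q Ω κ₁ ρ : ℝ) : Prop where
  Q_nonneg : 0 ≤ Q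
  Ω_nonneg : 0 ≤ Ω
  Ω_le : Ω ≤ 1/2
  one_le_β : 1 ≤ β2
  four_mul_le : 4*Q*β2 ≤ 1 - 2*Q
  κ_eq : κ₁ = rhoZero Q - Ω*(4/3+4*driftCoeff Q)/3
  κ_eq' : κ₁ = (1-Ω)*ρ

namespace RoundConstants
variable {β2 Q Ω κ₁ ρ : ℝ}

theorem Q_le (h : RoundConstants β2 Q Ω κ₁ ρ) : Q ≤ 1/6 := by
  nlinarith [h.four_mul_le, h.Q_nonneg, h.one_le_β]

theorem ρ_ge (h : RoundConstants β2 Q Ω κ₁ ρ) :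
    (1-2*Ω)*rhoZero Q + 2*Ω*rhoOne Q ≤ ρ := by
  have h1 := h.Ω_le
  have h2 := h.Ω_nonneg
  have h3 : rhoZero Q ≤ (4/3+4*driftCoeff Q)/3 := by
    have := h.Q_nonneg
    unfold rhoZero driftCoeff; nlinarith
  have h4 : 0 < 1 - Ω := by linarith
  refine le_of_mul_le_mul_left ?_ h4
  rw [← h.κ_eq', h.κ_eq]
  unfold rhoOne
  nlinarith [mul_nonneg (mul_nonneg h2 (show 0 ≤ 1 - 2*Ω by linarith)) (sub_nonneg.2 h3)]

theorem ρ_ge' (h : RoundConstants β2 Q Ω κ₁ ρ) : 0.3455 ≤ ρ := by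
  have h1 := rhoOne_ge h.Q_nonneg h.Q_le
  have h2 := rhoOne_le_rhoZero h.Q_nonneg
  nlinarith [h.ρ_ge, h.Ω_nonneg, h.Ω_le]

theorem κ_ge (h : RoundConstants β2 Q Ω κ₁ ρ) : ρ ≤ 2*κ₁ := by
  rw [h.κ_eq']; nlinarith [h.ρ_ge', h.Ω_le]

theorem growth_coeff_le (h : RoundConstants β2 Q Ω κ₁ ρ) : 4/3+4*driftCoeff Q ≤ 12*κ₁ := by
  have h1 := h.κ_ge
  have h2 := h.ρ_ge'
  have h3 := h.Q_nonneg
  have h4 := h.Q_le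
  unfold driftCoeff; nlinarith

theorem mul_driftCoeff_le (h : RoundConstants β2 Q Ω κ₁ ρ) : β2*driftCoeff Q ≤ 1 - 2*rhoZero Q := by
  have h3 := h.Q_nonneg
  unfold driftCoeff rhoZero
  nlinarith [mul_le_mul_of_nonneg_right h.four_mul_le (show 0 ≤ 0.45+0.54*Q by positivity)]

theorem driftCoeff_le (h : RoundConstants β2 Q Ω κ₁ ρ) : driftCoeff Q ≤ 12*(ρ*Q) := by
  have h1 := h.ρ_ge'
  have h3 := h.Q_nonneg
  have h4 := h.Q_le
  unfold driftCoeff; nlinarith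

/-- Absorbs the term of order `Ω Q²` of `noise_le` into the noise term `M = e C ∑ γ_i`. -/
theorem excess_le (h : RoundConstants β2 Q Ω κ₁ ρ) {M : ℝ} (hM : 4/3*Ω*Q ≤ β2*M) :
    2*Ω*(4.4*ρ*(1+2*Q+4*Q^2)*Q^2) ≤ 3.3*κ₁*M := by
  have h1 := h.κ_ge
  have h2 := h.ρ_ge'
  have h3 := h.Q_nonneg
  have h4 := h.Q_le
  have h5 := h.Ω_nonneg
  have hβ := h.one_le_β
  have h6 : (1+2*Q+4*Q^2)*(1-2*Q) ≤ 1 := by nlinarith [pow_nonneg h3 3]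
  have h7 : (1+2*Q+4*Q^2)*(4*Q*β2) ≤ 1 :=
    (mul_le_mul_of_nonneg_left h.four_mul_le (by positivity)).trans h6
  have hβ0 : 0 < β2 := by linarith
  refine le_of_mul_le_mul_left ?_ hβ0
  have hΩQ : 0 ≤ Ω*Q := mul_nonneg h5 h3
  have e1 := mul_le_mul_of_nonneg_left h7 (mul_nonneg (show 0 ≤ 2.2*ρ by linarith) hΩQ)
  have e2 := mul_le_mul_of_nonneg_left hM (show 0 ≤ 3.3*κ₁ by linarith)
  nlinarith [mul_le_mul_of_nonneg_right h1 hΩQ]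

end RoundConstants

section round
variable {ι : Type*} [Fintype ι]

/-- The combination of the local bounds of all clients. For `α ≤ 1` the variances carry the
weights `(1 - α) p_i² + γ_i`; the first part is treated together with the drift, where `e (1 - α)
K² ≤ 1` keeps its share in `[0, 1]`. For `α ≥ 1` all weights are at most `γ_i`. -/
theorem round_step_le {w p a s2 b vr γ g H d V : ι → ℝ} {α e Kf β2 κ2 σ q C amax Q Ω κ₁ ρ G : ℝ}
    (hc : RoundConstants β2 Q Ω κ₁ ρ) (hQ : Q = q^2*C) (he : 0 ≤ e) (hK : 0 < Kf)
    (hα : e*(1-α)*Kf^2 ≤ 1) (ha : ∀ i, 0 ≤ a i) (hp : ∀ i, 0 ≤ p i)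
    (hw : ∀ i, w i = p i * a i / Kf) (hw1 : ∑ i, w i = 1)
    (hγ : ∀ i, γ i = vr i + α * p i^2) (hγ0 : ∀ i, 0 ≤ γ i) (hvr : ∀ i, 0 ≤ vr i)
    (hΩ : Ω = 3/2*e*β2*∑ i, γ i * a i^2) (hamax : ∀ i, a i^2 ≤ amax) (hamax' : q^2*amax ≤ 1/2)
    (hC : 0 ≤ C) (hH : ∀ i, H i ≤ a i^2*(g i + d i)^2)
    (hκ : 0 ≤ κ2) (hG : 0 ≤ G) (hg : ∀ i, g i^2 ≤ β2*G+κ2)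
    (hA : ∀ i s, 0 ≤ s → s ≤ 1 → a i^2 * d i^2 + s * V i ≤
      a i^2 * driftCoeff Q * g i^2 + (s*(4*ρ*s2 i) + 6*ρ*q^2*a i^2*b i
        + s*(2*Ω*(4.4*ρ*(1+2*Q+4*Q^2)*Q^2*a i^2)))*σ^2)
    (hB : ∀ i, V i + a i^2*(g i + d i)^2 ≤ a i^2 * (4/3+4*driftCoeff Q) * g i^2 +
      (4*ρ*s2 i + 1.35*ρ*C)*σ^2)
    (hB' : ∀ i u ν, 0 ≤ u → u ≤ ν → u*V i + ν*(a i^2*(g i + d i)^2) ≤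
      ν*(a i^2 * (4/3+4*driftCoeff Q) * g i^2) + (u*(4*ρ*s2 i) + ν*(3*ρ*C))*σ^2) :
    -G/2 + 1/2*∑ i, w i * d i^2 + e/2*∑ i, (vr i + p i^2)*V i + e/2*∑ i, γ i*H i ≤
      -(κ₁*G) + (2*ρ*(e*∑ i, (vr i + p i^2)*s2 i)*σ^2 + 3*ρ*q^2*(∑ i, w i*b i)*σ^2 + 6*ρ*Q*κ2 +
        3*κ₁*(e*C*∑ i, γ i)*σ^2 + 6*κ₁*(e*amax*∑ i, γ i)*κ2) := by
  have hρ := hc.ρ_ge'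
  have hκρ := hc.κ_ge
  have hw0 : ∀ i, 0 ≤ w i := fun i => by rw [hw]; exact div_nonneg (mul_nonneg (hp i) (ha i)) hK.le
  have hwle : ∀ i, w i ≤ 1 := fun i => hw1 ▸ single_le_sum (fun j _ => hw0 j) (mem_univ i)
  have hΓ : 0 ≤ ∑ i, γ i := sum_nonneg fun i _ => hγ0 i
  have hx0 : 0 ≤ driftCoeff Q := by have := hc.Q_nonneg; unfold driftCoeff; positivity
  have hβ0 : 0 < β2 := by linarith [hc.one_le_β]
  -- the gradient terms
  have hgw : ∑ i, w i * g i^2 ≤ β2*G+κ2 := by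
    calc _ ≤ ∑ i, w i * (β2*G+κ2) := sum_le_sum fun i _ => mul_le_mul_of_nonneg_left (hg i) (hw0 i)
      _ = _ := by rw [← sum_mul, hw1, one_mul]
  have hG1 : driftCoeff Q * (∑ i, w i * g i^2) ≤ (1-2*rhoZero Q)*G + 12*(ρ*Q)*κ2 := by
    have h1 := mul_le_mul_of_nonneg_left hgw hx0
    have h2 := mul_le_mul_of_nonneg_right hc.mul_driftCoeff_le hG
    have h3 := mul_le_mul_of_nonneg_right hc.driftCoeff_le hκ
    linarith
  have hγa : ∑ i, γ i * a i^2 ≤ amax * ∑ i, γ i := by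
    rw [mul_sum]; exact sum_le_sum fun i _ => by
      rw [mul_comm amax]; exact mul_le_mul_of_nonneg_left (hamax i) (hγ0 i)
  have hG2 : e*∑ i, γ i*(a i^2 * (4/3+4*driftCoeff Q) * g i^2) ≤
      2/3*Ω*(4/3+4*driftCoeff Q)*G + 12*κ₁*(e*amax*∑ i, γ i)*κ2 := by
    calc _ ≤ e*∑ i, γ i*(a i^2 * (4/3+4*driftCoeff Q) * (β2*G+κ2)) := by
          refine mul_le_mul_of_nonneg_left (sum_le_sum fun i _ => ?_) he
          exact mul_le_mul_of_nonneg_left (mul_le_mul_of_nonneg_left (hg i) (by positivity)) (hγ0 i)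
      _ = (e*∑ i, γ i*a i^2) * (4/3+4*driftCoeff Q) * (β2*G+κ2) := by
          rw [mul_sum, mul_sum, sum_mul, sum_mul]; exact sum_congr rfl fun i _ => by ring
      _ = 2/3*Ω*(4/3+4*driftCoeff Q)*G + (4/3+4*driftCoeff Q)*(e*∑ i, γ i*a i^2)*κ2 := by
          rw [hΩ]; ring
      _ ≤ _ := by
          have h1 : (4/3+4*driftCoeff Q)*(e*∑ i, γ i*a i^2) ≤ (12*κ₁)*(e*(amax*∑ i, γ i)) :=
            mul_le_mul hc.growth_coeff_le (mul_le_mul_of_nonneg_left hγa he)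
              (mul_nonneg he (sum_nonneg fun i _ => mul_nonneg (hγ0 i) (sq_nonneg _))) (by linarith)
          linarith [mul_le_mul_of_nonneg_right h1 hκ]
  have hκ1 : κ₁*G = rhoZero Q*G - Ω*(4/3+4*driftCoeff Q)/3*G := by rw [hc.κ_eq]; ring
  have hH' : e*∑ i, γ i*H i ≤ e*∑ i, γ i*(a i^2*(g i + d i)^2) :=
    mul_le_mul_of_nonneg_left (sum_le_sum fun i _ => mul_le_mul_of_nonneg_left (hH i) (hγ0 i)) he
  rcases le_total α 1 with hα1 | hα1
  · have h1α : 0 ≤ 1 - α := by linarith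
    -- the client drift, together with the part of the variance that does not carry `γ`
    have hΛ : ∀ i, w i*d i^2 + e*((1-α)*p i^2*V i) ≤ driftCoeff Q*(w i*g i^2) +
        (4*ρ*(e*((1-α)*p i^2*s2 i)) + 6*ρ*q^2*(w i*b i)
          + w i*(2*Ω*(4.4*ρ*(1+2*Q+4*Q^2)*Q^2)))*σ^2 := by
      intro i
      have hs0 : 0 ≤ e*(1-α)*Kf^2*w i := by have := hw0 i; positivity
      have hs1 : e*(1-α)*Kf^2*w i ≤ 1 := by
        have := mul_le_mul hα (hwle i) (hw0 i) zero_le_one; linarith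
      have hT : 0 ≤ 2*Ω*(4.4*ρ*(1+2*Q+4*Q^2)*Q^2) := by
        have := hc.Ω_nonneg; have := hc.Q_nonneg; positivity
      rcases (ha i).eq_or_lt with h0 | h0
      · have hwi : w i = 0 := by rw [hw, ← h0]; simp
        have h1 := hA i 1 zero_le_one le_rfl
        rw [← h0] at h1
        have h2 := mul_le_mul_of_nonneg_left h1 (show 0 ≤ e*((1-α)*p i^2) by positivity)
        rw [hwi]; linarith
      · have ha2 : 0 < a i^2 := by positivity
        have h1 := mul_le_mul_of_nonneg_left (hA i _ hs0 hs1) (hw0 i)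
        have hwK : w i * Kf = p i * a i := by rw [hw]; field_simp
        have h2 : e*(1-α)*Kf^2*w i*w i = e*(1-α)*(p i^2*a i^2) := by
          rw [← mul_pow, ← hwK]; ring
        refine le_of_mul_le_mul_left ?_ ha2
        have h3 : w i*(e*(1-α)*Kf^2*w i*(2*Ω*(4.4*ρ*(1+2*Q+4*Q^2)*Q^2*a i^2)))*σ^2 ≤
            w i*(1*(2*Ω*(4.4*ρ*(1+2*Q+4*Q^2)*Q^2*a i^2)))*σ^2 := by
          have := hw0 i
          have h4 : 0 ≤ 2*Ω*(4.4*ρ*(1+2*Q+4*Q^2)*Q^2*a i^2) := by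
            have := hc.Ω_nonneg; have := hc.Q_nonneg; positivity
          gcongr
        have h5 : w i * (e*(1-α)*Kf^2*w i * V i) = e*(1-α)*(p i^2*a i^2) * V i := by rw [← h2]; ring
        have h6 : w i * (e*(1-α)*Kf^2*w i*(4*ρ*s2 i)) = e*(1-α)*(p i^2*a i^2)*(4*ρ*s2 i) := by
          rw [← h2]; ring
        nlinarith
    have hΛs := sum_le_sum fun i (_ : i ∈ univ) => hΛ i
    have hBs := sum_le_sum fun i (_ : i ∈ univ) => mul_le_mul_of_nonneg_left (hB i) (hγ0 i)
    have hM : 4/3*Ω*Q ≤ β2*(e*C*∑ i, γ i) := by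
      have h1 := mul_le_mul_of_nonneg_left hγa (show 0 ≤ 2*e*β2*(q^2*C) by positivity)
      have h2 := mul_le_mul_of_nonneg_right hamax' (show 0 ≤ 2*e*β2*C*∑ i, γ i by positivity)
      rw [hΩ, hQ]; linarith
    have hex := mul_le_mul_of_nonneg_right (hc.excess_le hM) (sq_nonneg σ)
    have e1 : ∑ i, (w i*d i^2 + e*((1-α)*p i^2*V i)) + e*∑ i, γ i*(V i + a i^2*(g i + d i)^2) =
        ∑ i, w i * d i^2 + e*∑ i, (vr i + p i^2)*V i + e*∑ i, γ i*(a i^2*(g i + d i)^2) := by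
      simp only [mul_sum, ← sum_add_distrib]
      exact sum_congr rfl fun i _ => by rw [hγ]; ring
    have e2 : ∑ i, (driftCoeff Q*(w i*g i^2) + (4*ρ*(e*((1-α)*p i^2*s2 i)) + 6*ρ*q^2*(w i*b i)
          + w i*(2*Ω*(4.4*ρ*(1+2*Q+4*Q^2)*Q^2)))*σ^2) +
        e*∑ i, γ i*(a i^2 * (4/3+4*driftCoeff Q) * g i^2 + (4*ρ*s2 i + 1.35*ρ*C)*σ^2) =
        driftCoeff Q*∑ i, w i*g i^2 + e*∑ i, γ i*(a i^2 * (4/3+4*driftCoeff Q) * g i^2)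
        + 4*ρ*(e*∑ i, (vr i + p i^2)*s2 i)*σ^2 + 6*ρ*q^2*(∑ i, w i*b i)*σ^2
        + (∑ i, w i)*(2*Ω*(4.4*ρ*(1+2*Q+4*Q^2)*Q^2))*σ^2 + 1.35*ρ*(e*C*∑ i, γ i)*σ^2 := by
      simp only [mul_sum, sum_mul, ← sum_add_distrib]
      exact sum_congr rfl fun i _ => by rw [hγ]; ring
    have e3 := add_le_add hΛs (mul_le_mul_of_nonneg_left hBs he)
    rw [e1, e2, hw1, one_mul] at e3
    have e4 : ρ*(e*C*(∑ i, γ i)*σ^2) ≤ 2*κ₁*(e*C*(∑ i, γ i)*σ^2) :=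
      mul_le_mul_of_nonneg_right hκρ (by positivity)
    linarith
  · have hΛ : ∀ i, w i*d i^2 ≤ driftCoeff Q*(w i*g i^2) + 6*ρ*q^2*(w i*b i)*σ^2 := by
      intro i
      rcases (ha i).eq_or_lt with h0 | h0
      · have hwi : w i = 0 := by rw [hw, ← h0]; simp
        rw [hwi]; simp
      · have ha2 : 0 < a i^2 := by positivity
        refine le_of_mul_le_mul_left ?_ ha2
        have := mul_le_mul_of_nonneg_left (hA i 0 le_rfl zero_le_one) (hw0 i)
        linarith
    have hu : ∀ i, vr i + p i^2 ≤ γ i := fun i => by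
      rw [hγ]; nlinarith [sq_nonneg (p i)]
    have hΛs := sum_le_sum fun i (_ : i ∈ univ) => hΛ i
    have hBs := sum_le_sum fun i (_ : i ∈ univ) =>
      hB' i _ _ (add_nonneg (hvr i) (sq_nonneg (p i))) (hu i)
    have e1 : ∑ i, w i*d i^2 + e*∑ i, ((vr i + p i^2)*V i + γ i*(a i^2*(g i + d i)^2)) =
        ∑ i, w i * d i^2 + e*∑ i, (vr i + p i^2)*V i + e*∑ i, γ i*(a i^2*(g i + d i)^2) := by
      simp only [mul_sum, ← sum_add_distrib]
      exact sum_congr rfl fun i _ => by ring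
    have e2 : ∑ i, (driftCoeff Q*(w i*g i^2) + 6*ρ*q^2*(w i*b i)*σ^2) +
        e*∑ i, (γ i*(a i^2 * (4/3+4*driftCoeff Q) * g i^2) +
          ((vr i + p i^2)*(4*ρ*s2 i) + γ i*(3*ρ*C))*σ^2) =
        driftCoeff Q*∑ i, w i*g i^2 + e*∑ i, γ i*(a i^2 * (4/3+4*driftCoeff Q) * g i^2)
        + 4*ρ*(e*∑ i, (vr i + p i^2)*s2 i)*σ^2 + 6*ρ*q^2*(∑ i, w i*b i)*σ^2
        + 3*ρ*(e*C*∑ i, γ i)*σ^2 := by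
      simp only [mul_sum, sum_mul, ← sum_add_distrib]
      exact sum_congr rfl fun i _ => by ring
    have e3 := add_le_add hΛs (mul_le_mul_of_nonneg_left hBs he)
    rw [e1, e2] at e3
    have e4 : ρ*(e*C*(∑ i, γ i)*σ^2) ≤ 2*κ₁*(e*C*(∑ i, γ i)*σ^2) :=
      mul_le_mul_of_nonneg_right hκρ (by positivity)
    linarith
end round

/-! ### Independence of the iterates and the noise -/

section indep
variable {X : Type*} [mX : MeasurableSpace X] {P : Measure X}

theorem indepFun_of_measurable {A B : Type*} [MeasurableSpace A] [MeasurableSpace B]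
    {m₁ m₂ : MeasurableSpace X} {f : X → A} {g : X → B} (h : Indep m₁ m₂ P)
    (hf : Measurable[m₁] f) (hg : Measurable[m₂] g) : IndepFun f g P :=
  indep_of_indep_of_le_left (indep_of_indep_of_le_right h hg.comap_le) hf.comap_le

/-- Two independent families that are independent of each other form one independent family. -/
theorem iIndep_sumElim {ι κ A B : Type*} [MeasurableSpace A] [MeasurableSpace B] {f : ι → X → A}
    {g : κ → X → B}
    (hf : iIndepFun f P) (hg : iIndepFun g P)
    (hfg : IndepFun (fun x i => f i x) (fun x j => g j x) P) :
    iIndep (Sum.elim (fun i => MeasurableSpace.comap (f i) inferInstance)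
      (fun j => MeasurableSpace.comap (g j) inferInstance)) P := by
  classical
  rw [iIndep_iff]
  intro s E hE
  have hl : ∀ i ∈ s.toLeft, MeasurableSet[MeasurableSpace.comap (f i) inferInstance]
      (E (Sum.inl i)) :=
    fun i hi => hE _ (mem_toLeft.1 hi)
  have hr : ∀ j ∈ s.toRight, MeasurableSet[MeasurableSpace.comap (g j) inferInstance]
      (E (Sum.inr j)) :=
    fun j hj => hE _ (mem_toRight.1 hj)
  have e : ⋂ i ∈ s, E i = (⋂ i ∈ s.toLeft, E (Sum.inl i)) ∩ ⋂ j ∈ s.toRight, E (Sum.inr j) := by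
    ext x
    simp only [Set.mem_iInter, Set.mem_inter_iff, mem_toLeft, mem_toRight]
    exact ⟨fun h => ⟨fun i hi => h _ hi, fun j hj => h _ hj⟩, fun h i => by
      cases i with
      | inl i => exact h.1 i
      | inr j => exact h.2 j⟩
  have hle : ∀ i, MeasurableSpace.comap (f i) inferInstance ≤
      MeasurableSpace.comap (fun x i => f i x) inferInstance := fun i =>
    ((measurable_pi_apply i).comp (comap_measurable (fun x i => f i x))).comap_le
  have hle' : ∀ j, MeasurableSpace.comap (g j) inferInstance ≤
      MeasurableSpace.comap (fun x j => g j x) inferInstance := fun j =>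
    ((measurable_pi_apply j).comp (comap_measurable (fun x j => g j x))).comap_le
  rw [e, (Indep_iff _ _ P).1 hfg _ _
    (Finset.measurableSet_biInter _ fun i hi => hle i _ (hl i hi))
    (Finset.measurableSet_biInter _ fun j hj => hle' j _ (hr j hj)),
    hf.meas_biInter hl, hg.meas_biInter hr]
  have : s = s.toLeft.disjSum s.toRight := (toLeft_disjSum_toRight).symm
  conv_rhs => rw [this]
  rw [prod_disjSum]
end indep

namespace FedScheme
variable {n d : ℕ} {Ξ 𝒮 X : Type*} [MeasurableSpace Ξ] [MeasurableSpace 𝒮] [mX : MeasurableSpace X]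
  {P : Measure X} {F : FedScheme n d Ξ 𝒮} {S : ℕ → X → 𝒮} {ξ : ℕ → Fin n → ℕ → X → Ξ}

/-- The `σ`-algebra generated by the samplings `S t` with `Sum.inl t ∈ A` and the batches
`ξ t i k` with `Sum.inr (t, i, k) ∈ A`. -/
def noiseAlg (S : ℕ → X → 𝒮) (ξ : ℕ → Fin n → ℕ → X → Ξ) (A : Set (ℕ ⊕ ℕ × Fin n × ℕ)) :
    MeasurableSpace X :=
  ⨆ q ∈ A, Sum.elim (fun t => MeasurableSpace.comap (S t) inferInstance)
    (fun q : ℕ × Fin n × ℕ => MeasurableSpace.comap (ξ q.1 q.2.1 q.2.2) inferInstance) q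

theorem measurable_S_noiseAlg {A : Set (ℕ ⊕ ℕ × Fin n × ℕ)} {t : ℕ} (h : Sum.inl t ∈ A) :
    Measurable[noiseAlg S ξ A] (S t) :=
  measurable_iff_comap_le.2 (le_biSup (Sum.elim (fun t => MeasurableSpace.comap (S t) inferInstance)
    (fun q : ℕ × Fin n × ℕ => MeasurableSpace.comap (ξ q.1 q.2.1 q.2.2) inferInstance)) h)

theorem measurable_ξ_noiseAlg {A : Set (ℕ ⊕ ℕ × Fin n × ℕ)} {t : ℕ} {i : Fin n} {k : ℕ}
    (h : Sum.inr (t, i, k) ∈ A) : Measurable[noiseAlg S ξ A] (ξ t i k) :=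
  measurable_iff_comap_le.2 (le_biSup (Sum.elim (fun t => MeasurableSpace.comap (S t) inferInstance)
    (fun q : ℕ × Fin n × ℕ => MeasurableSpace.comap (ξ q.1 q.2.1 q.2.2) inferInstance)) h)

theorem IsRandomness.indep (h : F.IsRandomness P S ξ) {A B : Set (ℕ ⊕ ℕ × Fin n × ℕ)}
    (hAB : Disjoint A B) : Indep (noiseAlg S ξ A) (noiseAlg S ξ B) P :=
  indep_iSup_of_disjoint (fun q => by
      cases q with
      | inl t => exact (h.measurable_S t).comap_le
      | inr q => exact (h.measurable_ξ _ _ _).comap_le)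
    (iIndep_sumElim h.indep_S h.indep_ξ h.indep_S_ξ) hAB

theorem measurable_pi_pi {Y : Type*} {m : MeasurableSpace Y} {f : Fin n → ℕ → Y → Ξ}
    (h : ∀ i k, Measurable (f i k)) : Measurable (fun y i k => f i k y) :=
  measurable_pi_lambda _ fun i => measurable_pi_lambda _ fun k => h i k

theorem measurable_localModel {Y : Type*} {m : MeasurableSpace Y}
    (hg : ∀ i, Measurable (Function.uncurry (F.g i))) (i : Fin n)
    {x : Y → EuclideanSpace ℝ (Fin d)} {ζ : ℕ → Y → Ξ} (hx : Measurable x) {k : ℕ}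
    (hζ : ∀ j < k, Measurable (ζ j)) :
    Measurable (fun y => F.localModel i (x y) (fun j => ζ j y) k) := by
  induction k with
  | zero => exact hx
  | succ k ih =>
    have ih := ih fun j hj => hζ j (by omega)
    exact ih.sub (((hg i).comp (ih.prodMk (hζ k (by omega)))).fun_const_smul _)

/-- One round of the algorithm. -/
def roundMap (F : FedScheme n d Ξ 𝒮) (x : EuclideanSpace ℝ (Fin d)) (s : 𝒮)
    (ζ : Fin n → ℕ → Ξ) : EuclideanSpace ℝ (Fin d) :=
  x + F.ηg • ∑ i, F.ω i s • (F.localModel i x (ζ i) F.K - x)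

theorem measurable_roundMap {Y : Type*} {m : MeasurableSpace Y}
    (hg : ∀ i, Measurable (Function.uncurry (F.g i))) (hω : ∀ i, Measurable (F.ω i))
    {x : Y → EuclideanSpace ℝ (Fin d)} {s : Y → 𝒮} {ζ : Fin n → ℕ → Y → Ξ} (hx : Measurable x)
    (hs : Measurable s) (hζ : ∀ i k, Measurable (ζ i k)) :
    Measurable (fun y => F.roundMap (x y) (s y) (fun i k => ζ i k y)) := by
  unfold roundMap
  refine hx.add (Measurable.fun_const_smul (Finset.measurable_fun_sum _ fun i _ => ?_) _)
  exact ((hω i).comp hs).smul ((measurable_localModel hg i hx fun j _ => hζ i j).sub hx)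

theorem measurable_θ (hg : ∀ i, Measurable (Function.uncurry (F.g i)))
    (hω : ∀ i, Measurable (F.ω i))
    (θ₀ : EuclideanSpace ℝ (Fin d)) {A : Set (ℕ ⊕ ℕ × Fin n × ℕ)} (t : ℕ)
    (hA : ∀ s < t, Sum.inl s ∈ A ∧ ∀ i k, Sum.inr (s, i, k) ∈ A) :
    Measurable[noiseAlg S ξ A] (F.θ θ₀ S ξ t) := by
  induction t with
  | zero => exact measurable_const
  | succ t ih =>
    exact measurable_roundMap (m := noiseAlg S ξ A) hg hω (ih fun s hs => hA s (by omega))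
      (measurable_S_noiseAlg (hA t (by omega)).1)
      (fun i k => measurable_ξ_noiseAlg ((hA t (by omega)).2 i k))

theorem noiseAlg_le (h : F.IsRandomness P S ξ) (A : Set (ℕ ⊕ ℕ × Fin n × ℕ)) :
    noiseAlg S ξ A ≤ mX :=
  iSup₂_le fun q _ => by
    cases q with
    | inl t => exact (h.measurable_S t).comap_le
    | inr q => exact (h.measurable_ξ _ _ _).comap_le

/-- The model before round `t` is independent of the randomness of round `t`. -/
theorem IsRandomness.indepFun_θ (h : F.IsRandomness P S ξ)
    (hg : ∀ i, Measurable (Function.uncurry (F.g i))) (hω : ∀ i, Measurable (F.ω i))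
    (θ₀ : EuclideanSpace ℝ (Fin d)) (t : ℕ) :
    IndepFun (F.θ θ₀ S ξ t) (fun x => (S t x, fun i k => ξ t i k x)) P := by
  refine indepFun_of_measurable
      (h.indep (A := {q | Sum.elim (· < t) (fun q : ℕ × Fin n × ℕ => q.1 < t) q})
    (B := {q | Sum.elim (· = t) (fun q : ℕ × Fin n × ℕ => q.1 = t) q}) ?_)
    (measurable_θ hg hω θ₀ t fun s hs => ⟨hs, fun _ _ => hs⟩) ?_
  · rw [Set.disjoint_left]
    rintro (s | q) h1 h2
    · exact absurd (show s = t from h2) (Nat.ne_of_lt h1)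
    · exact absurd (show q.1 = t from h2) (Nat.ne_of_lt h1)
  · exact Measurable.prodMk (measurable_S_noiseAlg rfl)
      (measurable_pi_pi fun i k => measurable_ξ_noiseAlg rfl)

/-- The local model after `k` steps is independent of the next batch. -/
theorem IsRandomness.indepFun_localModel (h : F.IsRandomness P S ξ)
    (hg : ∀ i, Measurable (Function.uncurry (F.g i))) (t : ℕ) (i : Fin n)
    (θ : EuclideanSpace ℝ (Fin d)) (k : ℕ) :
    IndepFun (fun x => F.localModel i θ (fun j => ξ t i j x) k) (ξ t i k) P := by
  refine indepFun_of_measurable (h.indep (A := Sum.inr '' {q | q.2.2 < k})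
      (B := {Sum.inr (t, i, k)}) ?_)
    (measurable_localModel (m := noiseAlg S ξ _) hg i measurable_const fun j hj =>
      measurable_ξ_noiseAlg ⟨(t, i, j), hj, rfl⟩) (measurable_ξ_noiseAlg rfl)
  rw [Set.disjoint_singleton_right]
  rintro ⟨q, hq, e⟩
  obtain rfl := Sum.inr_injective e
  exact lt_irrefl k hq

/-- Local models of distinct clients are independent. -/
theorem IsRandomness.indepFun_localModel_localModel (h : F.IsRandomness P S ξ)
    (hg : ∀ i, Measurable (Function.uncurry (F.g i))) (t : ℕ) {i j : Fin n} (hij : i ≠ j)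
    (θ : EuclideanSpace ℝ (Fin d)) (k : ℕ) :
    IndepFun (fun x => F.localModel i θ (fun l => ξ t i l x) k)
      (fun x => F.localModel j θ (fun l => ξ t j l x) k) P := by
  refine indepFun_of_measurable (h.indep (A := Sum.inr '' {q | q.2.1 = i})
      (B := Sum.inr '' {q | q.2.1 = j}) ?_)
    (measurable_localModel (m := noiseAlg S ξ _) hg i measurable_const fun l _ =>
      measurable_ξ_noiseAlg ⟨(t, i, l), rfl, rfl⟩)
    (measurable_localModel (m := noiseAlg S ξ _) hg j measurable_const fun l _ =>
      measurable_ξ_noiseAlg ⟨(t, j, l), rfl, rfl⟩)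
  rw [Set.disjoint_left]
  rintro _ ⟨q, hq, rfl⟩ ⟨q', hq', e⟩
  obtain rfl := Sum.inr_injective e
  exact hij (hq.symm.trans hq')

/-- The sampling is independent of the batches. -/
theorem IsRandomness.indepFun_S (h : F.IsRandomness P S ξ) (t : ℕ) :
    IndepFun (S t) (fun x i k => ξ t i k x) P := by
  refine indepFun_of_measurable (h.indep (A := Set.range Sum.inl) (B := Set.range Sum.inr) ?_)
    (measurable_S_noiseAlg ⟨t, rfl⟩)
    (measurable_pi_pi fun i k => measurable_ξ_noiseAlg ⟨_, rfl⟩)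
  rw [Set.disjoint_left]
  rintro _ ⟨_, rfl⟩ ⟨_, e⟩
  cases e

end FedScheme

/-! ### The descent lemma and square-integrable random vectors -/

section smooth
variable {E : Type*} [NormedAddCommGroup E] [InnerProductSpace ℝ E] [CompleteSpace E]

/-- The descent lemma. -/
theorem le_add_inner_add_sq {f : E → ℝ} {L : ℝ} (hf : Differentiable ℝ f)
    (hL : ∀ x y, ‖gradient f x - gradient f y‖ ≤ L * ‖x - y‖) (x v : E) :
    f (x + v) ≤ f x + ⟪gradient f x, v⟫_ℝ + L/2*‖v‖^2 := by
  set φ : ℝ → ℝ := fun t => f (x + t • v) - t * ⟪gradient f x, v⟫_ℝ - L/2*t^2*‖v‖^2 with hφ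
  have hd : ∀ t, HasDerivAt φ (⟪gradient f (x + t • v), v⟫_ℝ - ⟪gradient f x, v⟫_ℝ -
      L*t*‖v‖^2) t := by
    intro t
    have h1 : HasDerivAt (fun t : ℝ => x + t • v) v t := by
      simpa using ((hasDerivAt_id t).smul_const v).const_add x
    have h2 : HasDerivAt (fun t : ℝ => f (x + t • v)) ⟪gradient f (x + t • v), v⟫_ℝ t := by
      have := (hf (x + t • v)).hasFDerivAt.comp_hasDerivAt t h1
      rwa [← inner_gradient_left] at this
    have h3 := (h2.sub ((hasDerivAt_id t).mul_const ⟪gradient f x, v⟫_ℝ)).sub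
      (((hasDerivAt_pow 2 t).const_mul (L/2)).mul_const (‖v‖^2))
    exact h3.congr_deriv (by simp only [one_mul, Nat.cast_ofNat]; ring)
  have hanti : AntitoneOn φ (Set.Icc 0 1) := by
    refine antitoneOn_of_deriv_nonpos (convex_Icc 0 1)
        (fun t _ => (hd t).continuousAt.continuousWithinAt)
      (fun t _ => (hd t).differentiableAt.differentiableWithinAt) fun t ht => ?_
    rw [interior_Icc] at ht
    rw [(hd t).deriv, ← inner_sub_left]
    have h1 := real_inner_le_norm (gradient f (x + t • v) - gradient f x) v
    have h2 := hL (x + t • v) x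
    rw [add_sub_cancel_left, norm_smul, Real.norm_of_nonneg ht.1.le] at h2
    nlinarith [mul_le_mul_of_nonneg_right h2 (norm_nonneg v)]
  have := hanti (Set.left_mem_Icc.2 zero_le_one) (Set.right_mem_Icc.2 zero_le_one) zero_le_one
  simp only [hφ, one_smul, zero_smul, add_zero] at this
  linarith

end smooth

section L2
variable {E : Type*} [NormedAddCommGroup E]
  {X : Type*} [MeasurableSpace X] {P : Measure X}

theorem integrable_sq_norm_of_memLp {Y : X → E} (hY : MemLp Y 2 P) :
    Integrable (fun x => ‖Y x‖^2) P :=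
  (memLp_two_iff_integrable_sq_norm hY.1).1 hY

variable [InnerProductSpace ℝ E]

theorem integrable_inner_of_memLp {Y Z : X → E} (hY : MemLp Y 2 P) (hZ : MemLp Z 2 P) :
    Integrable (fun x => ⟪Y x, Z x⟫_ℝ) P := by
  refine ((integrable_sq_norm_of_memLp hY).add (integrable_sq_norm_of_memLp hZ)).mono'
      (hY.1.inner hZ.1)
    (.of_forall fun x => ?_)
  have := abs_real_inner_le_norm (Y x) (Z x)
  rw [Real.norm_eq_abs, Pi.add_apply]
  nlinarith [sq_nonneg (‖Y x‖ - ‖Z x‖), sq_nonneg (‖Y x‖), sq_nonneg (‖Z x‖)]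

theorem integral_norm_add_sq {Y Z : X → E} (hY : MemLp Y 2 P) (hZ : MemLp Z 2 P) :
    ∫ x, ‖Y x + Z x‖^2 ∂P = ∫ x, ‖Y x‖^2 ∂P + 2 * ∫ x, ⟪Y x, Z x⟫_ℝ ∂P + ∫ x, ‖Z x‖^2 ∂P := by
  have e : ∀ x, ‖Y x + Z x‖^2 = ‖Y x‖^2 + 2 * ⟪Y x, Z x⟫_ℝ + ‖Z x‖^2 := fun x =>
      norm_add_sq_real _ _
  simp_rw [e]
  have h1 := integrable_sq_norm_of_memLp hY
  have h2 := (integrable_inner_of_memLp hY hZ).const_mul 2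
  rw [integral_add (by exact h1.add h2) (integrable_sq_norm_of_memLp hZ), integral_add h1 h2,
      integral_const_mul]

theorem integral_inner_le_sqrt {Y Z : X → E} (hY : MemLp Y 2 P) (hZ : MemLp Z 2 P) :
    ∫ x, ⟪Y x, Z x⟫_ℝ ∂P ≤ √(∫ x, ‖Y x‖^2 ∂P) * √(∫ x, ‖Z x‖^2 ∂P) := by
  have h := discrim_le_zero (a := ∫ x, ‖Y x‖^2 ∂P) (b := 2 * ∫ x, ⟪Y x, Z x⟫_ℝ ∂P)
      (c := ∫ x, ‖Z x‖^2 ∂P)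
    fun t => by
      have h1 := integral_norm_add_sq (hY.const_smul t) hZ
      have h2 : 0 ≤ ∫ x, ‖(t • Y) x + Z x‖^2 ∂P := integral_nonneg fun x => sq_nonneg _
      rw [h1] at h2
      simp only [Pi.smul_apply, norm_smul, mul_pow, real_inner_smul_left, integral_const_mul,
        Real.norm_eq_abs, sq_abs] at h2
      linarith
  rw [discrim] at h
  rw [← Real.sqrt_mul (integral_nonneg fun x => sq_nonneg _)]
  exact Real.le_sqrt_of_sq_le (by linarith)

/-- Minkowski's inequality in `L²`, in terms of integrals. -/
theorem integral_norm_add_sq_le {Y Z : X → E} (hY : MemLp Y 2 P) (hZ : MemLp Z 2 P) :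
    ∫ x, ‖Y x + Z x‖^2 ∂P ≤ (√(∫ x, ‖Y x‖^2 ∂P) + √(∫ x, ‖Z x‖^2 ∂P))^2 := by
  rw [integral_norm_add_sq hY hZ]
  have := integral_inner_le_sqrt hY hZ
  nlinarith [Real.sq_sqrt (show 0 ≤ ∫ x, ‖Y x‖^2 ∂P from integral_nonneg fun x => sq_nonneg _),
    Real.sq_sqrt (show 0 ≤ ∫ x, ‖Z x‖^2 ∂P from integral_nonneg fun x => sq_nonneg _)]

variable [CompleteSpace E] [IsProbabilityMeasure P]

/-- The second moment about `c` is the variance plus the squared bias. -/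
theorem integral_norm_sub_sq {Y : X → E} (hY : MemLp Y 2 P) (c : E) :
    ∫ x, ‖Y x - c‖^2 ∂P = ∫ x, ‖Y x - ∫ y, Y y ∂P‖^2 ∂P + ‖∫ x, Y x ∂P - c‖^2 := by
  set m := ∫ y, Y y ∂P with hm
  have hYi : Integrable Y P := hY.integrable (by norm_num)
  have h := integral_norm_add_sq (P := P) (Y := fun x => Y x - m) (hY.sub (memLp_const m))
    (memLp_const (m - c))
  simp only [sub_add_sub_cancel] at h
  have h2 : ∫ x, ⟪Y x - m, m - c⟫_ℝ ∂P = 0 := by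
    simp_rw [real_inner_comm (m - c)]
    rw [integral_inner (f := fun x => Y x - m) (hYi.sub (integrable_const m)), integral_sub hYi
        (integrable_const m)]
    simp [hm]
  rw [h, h2]
  simp

theorem integral_norm_sub_mean_le {Y : X → E} (hY : MemLp Y 2 P) (c : E) :
    ∫ x, ‖Y x - ∫ y, Y y ∂P‖^2 ∂P ≤ ∫ x, ‖Y x - c‖^2 ∂P := by
  rw [integral_norm_sub_sq hY c]; nlinarith [sq_nonneg ‖∫ x, Y x ∂P - c‖]

end L2

section indep
variable {E : Type*} [NormedAddCommGroup E] [InnerProductSpace ℝ E] [FiniteDimensional ℝ E]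
  [MeasurableSpace E] [BorelSpace E]
  {X Ξ A : Type*} [MeasurableSpace X] [MeasurableSpace Ξ] [MeasurableSpace A] {P : Measure X}
      [IsProbabilityMeasure P]

/-- Fubini's theorem for a function of two independent random variables. -/
theorem integral_comp_eq_of_indepFun {Y : X → A} {ζ : X → Ξ} {F : Type*} [NormedAddCommGroup F]
    [NormedSpace ℝ F] (h : IndepFun Y ζ P) (hY : Measurable Y)
    (hζ : Measurable ζ) {f : A × Ξ → F} (hf : StronglyMeasurable f)
        (hi : Integrable (fun x => f (Y x, ζ x)) P) :
    ∫ x, f (Y x, ζ x) ∂P = ∫ x, ∫ x', f (Y x, ζ x') ∂P ∂P := by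
  have hmap := (indepFun_iff_map_prod_eq_prod_map_map hY.aemeasurable hζ.aemeasurable).1 h
  have hPY : IsProbabilityMeasure (P.map Y) := Measure.isProbabilityMeasure_map hY.aemeasurable
  have hPζ : IsProbabilityMeasure (P.map ζ) := Measure.isProbabilityMeasure_map hζ.aemeasurable
  have hm := hY.prodMk hζ
  have hi' : Integrable f ((P.map Y).prod (P.map ζ)) := by
    rw [← hmap]; exact (integrable_map_measure hf.aestronglyMeasurable hm.aemeasurable).2 hi
  calc ∫ x, f (Y x, ζ x) ∂P = ∫ z, f z ∂(P.map fun x => (Y x, ζ x)) :=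
        (integral_map hm.aemeasurable hf.aestronglyMeasurable).symm
    _ = ∫ y, ∫ z, f (y, z) ∂(P.map ζ) ∂(P.map Y) := by rw [hmap, integral_prod _ hi']
    _ = ∫ x, ∫ z, f (Y x, z) ∂(P.map ζ) ∂P :=
        integral_map hY.aemeasurable (hf.integral_prod_right').aestronglyMeasurable
    _ = _ := by
        congr 1; ext x
        exact integral_map hζ.aemeasurable (hf.comp_measurable
            measurable_prodMk_left).aestronglyMeasurable

theorem integrable_integral_comp_of_indepFun {Y : X → A} {ζ : X → Ξ} {F : Type*}
    [NormedAddCommGroup F]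
    [NormedSpace ℝ F] (h : IndepFun Y ζ P) (hY : Measurable Y) (hζ : Measurable ζ) {f : A × Ξ → F}
    (hf : StronglyMeasurable f) (hi : Integrable (fun x => f (Y x, ζ x)) P) :
    Integrable (fun x => ∫ x', f (Y x, ζ x') ∂P) P := by
  have hmap := (indepFun_iff_map_prod_eq_prod_map_map hY.aemeasurable hζ.aemeasurable).1 h
  have hPζ : IsProbabilityMeasure (P.map ζ) := Measure.isProbabilityMeasure_map hζ.aemeasurable
  have hi' : Integrable f ((P.map Y).prod (P.map ζ)) := by
    rw [← hmap]
    exact (integrable_map_measure hf.aestronglyMeasurable (hY.prodMk hζ).aemeasurable).2 hi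
  refine (hi'.integral_prod_left.comp_measurable hY).congr (.of_forall fun x => ?_)
  exact integral_map hζ.aemeasurable (hf.comp_measurable
      measurable_prodMk_left).aestronglyMeasurable

theorem lintegral_comp_eq_of_indepFun {Y : X → A} {ζ : X → Ξ} (h : IndepFun Y ζ P)
    (hY : Measurable Y)
    (hζ : Measurable ζ) {f : A × Ξ → ENNReal} (hf : Measurable f) :
    ∫⁻ x, f (Y x, ζ x) ∂P = ∫⁻ x, ∫⁻ x', f (Y x, ζ x') ∂P ∂P := by
  have hmap := (indepFun_iff_map_prod_eq_prod_map_map hY.aemeasurable hζ.aemeasurable).1 h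
  have hPζ : IsProbabilityMeasure (P.map ζ) := Measure.isProbabilityMeasure_map hζ.aemeasurable
  have hPY : IsProbabilityMeasure (P.map Y) := Measure.isProbabilityMeasure_map hY.aemeasurable
  have hm := hY.prodMk hζ
  calc ∫⁻ x, f (Y x, ζ x) ∂P = ∫⁻ z, f z ∂(P.map fun x => (Y x, ζ x)) := (lintegral_map hf hm).symm
    _ = ∫⁻ y, ∫⁻ z, f (y, z) ∂(P.map ζ) ∂(P.map Y) := by rw [hmap, lintegral_prod _ hf.aemeasurable]
    _ = ∫⁻ x, ∫⁻ z, f (Y x, z) ∂(P.map ζ) ∂P := lintegral_map hf.lintegral_prod_right' hY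
    _ = _ := by
        congr 1; ext x
        exact lintegral_map (hf.comp measurable_prodMk_left) hζ

/-- Tonelli's theorem: a nonnegative function of two independent random variables is integrable if
its partial expectations are bounded by an integrable function. -/
theorem integrable_comp_of_indepFun_of_le {Y : X → A} {ζ : X → Ξ} (h : IndepFun Y ζ P)
    (hY : Measurable Y)
    (hζ : Measurable ζ) {f : A × Ξ → ℝ} (hf : Measurable f) (hf0 : ∀ z, 0 ≤ f z) {B : A → ℝ}
    (hfi : ∀ y, Integrable (fun x => f (y, ζ x)) P) (hle : ∀ y, ∫ x, f (y, ζ x) ∂P ≤ B y)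
    (hB : Integrable (fun x => B (Y x)) P) : Integrable (fun x => f (Y x, ζ x)) P := by
  refine ⟨(hf.comp (hY.prodMk hζ)).aestronglyMeasurable, ?_⟩
  rw [hasFiniteIntegral_iff_ofReal (.of_forall fun x => hf0 _),
    lintegral_comp_eq_of_indepFun h hY hζ (f := fun z => ENNReal.ofReal (f z)) hf.ennreal_ofReal]
  calc ∫⁻ x, ∫⁻ x', ENNReal.ofReal (f (Y x, ζ x')) ∂P ∂P ≤ ∫⁻ x, ENNReal.ofReal (B (Y x)) ∂P := by
        refine lintegral_mono fun x => ?_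
        rw [← ofReal_integral_eq_lintegral_ofReal (hfi _) (.of_forall fun x => hf0 _)]
        exact ENNReal.ofReal_le_ofReal (hle _)
    _ < _ := hB.lintegral_lt_top

end indep

/-! ### Moments of the local steps -/

/-- One step of the variance recursion: the increment is the sum of a part determined by the past
and of noise orthogonal to it. -/
theorem integral_norm_add_smul_sq_le {E X : Type*} [NormedAddCommGroup E] [InnerProductSpace ℝ E]
    [MeasurableSpace X] {P : Measure X} [IsProbabilityMeasure P] {N G ε : X → E} {a σ : ℝ}
    (hN : MemLp N 2 P) (hG : MemLp G 2 P) (hε : MemLp ε 2 P) (m μ : E) (ha : 0 ≤ a)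
    (h0 : ∫ x, ⟪(N x - m) + a • (G x - μ), ε x⟫_ℝ ∂P = 0) (hσ : ∫ x, ‖ε x‖^2 ∂P ≤ σ^2) :
    ∫ x, ‖((N x - m) + a • (G x - μ)) + a • ε x‖^2 ∂P ≤
      (√(∫ x, ‖N x - m‖^2 ∂P) + a * √(∫ x, ‖G x - μ‖^2 ∂P))^2 + a^2*σ^2 := by
  have hNm : MemLp (fun x => N x - m) 2 P := hN.sub (memLp_const m)
  have hGm : MemLp (fun x => a • (G x - μ)) 2 P := (hG.sub (memLp_const μ)).const_smul a
  have hU : MemLp (fun x => (N x - m) + a • (G x - μ)) 2 P := hNm.add hGm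
  have h1 := integral_norm_add_sq hU (Z := fun x => a • ε x) (hε.const_smul a)
  have h2 := integral_norm_add_sq_le hNm hGm
  simp only [real_inner_smul_right, integral_const_mul, h0, norm_smul, mul_pow, Real.norm_eq_abs,
      sq_abs] at h1 h2
  rw [Real.sqrt_mul (sq_nonneg _), Real.sqrt_sq ha] at h2
  nlinarith [mul_le_mul_of_nonneg_left hσ (sq_nonneg a)]

namespace FedScheme
variable {n d : ℕ} {Ξ 𝒮 X : Type*} [MeasurableSpace Ξ] [MeasurableSpace 𝒮] [MeasurableSpace X]
  {P : Measure X} [IsProbabilityMeasure P] {F : FedScheme n d Ξ 𝒮} {S : ℕ → X → 𝒮}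
  {ξ : ℕ → Fin n → ℕ → X → Ξ} {L σ : ℝ}

theorem Smooth.continuous_gradient (h : F.Smooth L) (i : Fin n) :
    Continuous (gradient (F.loss i)) :=
  LipschitzWith.continuous (K := L.toNNReal) (LipschitzWith.of_dist_le_mul fun x y => by
    rw [dist_eq_norm, dist_eq_norm]
    exact ((h i).2 x y).trans (mul_le_mul_of_nonneg_right (Real.le_coe_toNNReal L) (norm_nonneg _)))

theorem memLp_gradient (h : F.Smooth L) (i : Fin n) {Y : X → EuclideanSpace ℝ (Fin d)}
    (hY : MemLp Y 2 P) :
    MemLp (fun x => gradient (F.loss i) (Y x)) 2 P := by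
  have h0 : MemLp (fun _ : X => ‖gradient (F.loss i) 0‖) 2 P := memLp_const _
  have h1 : MemLp (fun x => ‖gradient (F.loss i) 0‖ + L * ‖Y x‖) 2 P := h0.add (hY.norm.const_mul L)
  have hm : AEStronglyMeasurable (fun x => gradient (F.loss i) (Y x)) P :=
    (h.continuous_gradient i).comp_aestronglyMeasurable hY.1
  refine h1.mono hm (.of_forall fun x => ?_)
  have h2 := (h i).2 (Y x) 0
  rw [sub_zero] at h2
  have h3 := norm_le_insert' (gradient (F.loss i) (Y x)) (gradient (F.loss i) 0)
  rw [Real.norm_eq_abs]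
  exact le_trans (by linarith) (le_abs_self _)

/-- The noise of the stochastic gradient. -/
noncomputable def gradNoise (F : FedScheme n d Ξ 𝒮) (i : Fin n) (y : EuclideanSpace ℝ (Fin d))
    (ζ : Ξ) :
    EuclideanSpace ℝ (Fin d) := F.g i y ζ - gradient (F.loss i) y

section noise
variable {i : Fin n} {Y : X → EuclideanSpace ℝ (Fin d)} {ζ : X → Ξ}

theorem measurable_gradNoise (h : F.Smooth L) (hg : F.UnbiasedBoundedVariance σ) :
    Measurable (Function.uncurry (F.gradNoise i)) :=
  (hg.measurable i).sub ((h.continuous_gradient i).measurable.comp measurable_fst)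

theorem integral_gradNoise (hg : F.UnbiasedBoundedVariance σ) (hζ : Measurable ζ)
    (hlaw : P.map ζ = F.batchLaw i) (y : EuclideanSpace ℝ (Fin d)) :
    Integrable (fun x => F.gradNoise i y (ζ x)) P ∧ ∫ x, F.gradNoise i y (ζ x) ∂P = 0 := by
  have hb : IsProbabilityMeasure (F.batchLaw i) := hlaw ▸ Measure.isProbabilityMeasure_map
      hζ.aemeasurable
  have h1 := hg.integrable i y
  have h2 := hg.unbiased i y
  have h3 : Integrable (F.gradNoise i y) (F.batchLaw i) := h1.sub (integrable_const _)
  refine ⟨?_, ?_⟩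
  · rw [← hlaw] at h3; exact h3.comp_measurable hζ
  · have h4 : ∫ z, F.gradNoise i y z ∂(F.batchLaw i) = 0 := by
      unfold gradNoise; rw [integral_sub h1 (integrable_const _), h2]; simp
    rw [← hlaw] at h4 h3
    rwa [integral_map hζ.aemeasurable h3.1] at h4

theorem integral_sq_gradNoise_le (hg : F.UnbiasedBoundedVariance σ) (hζ : Measurable ζ)
    (hlaw : P.map ζ = F.batchLaw i) (y : EuclideanSpace ℝ (Fin d)) :
    Integrable (fun x => ‖F.gradNoise i y (ζ x)‖^2) P ∧ ∫ x, ‖F.gradNoise i y (ζ x)‖^2 ∂P ≤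
        σ^2 := by
  have h1 := hg.integrable_sq i y
  have h2 := hg.variance_le i y
  rw [← hlaw] at h1 h2
  refine ⟨h1.comp_measurable hζ, ?_⟩
  rwa [integral_map hζ.aemeasurable h1.1] at h2

theorem memLp_gradNoise (h : F.Smooth L) (hg : F.UnbiasedBoundedVariance σ) (hY : Measurable Y)
    (hζ : Measurable ζ)
    (hind : IndepFun Y ζ P) (hlaw : P.map ζ = F.batchLaw i) :
    MemLp (fun x => F.gradNoise i (Y x) (ζ x)) 2 P := by
  have hm := measurable_gradNoise h hg (i := i)
  have hm' : Measurable fun x => F.gradNoise i (Y x) (ζ x) := hm.comp (hY.prodMk hζ)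
  refine (memLp_two_iff_integrable_sq_norm hm'.aestronglyMeasurable).2 ?_
  exact integrable_comp_of_indepFun_of_le hind hY hζ (f := fun z => ‖F.gradNoise i z.1 z.2‖^2)
      (B := fun _ => σ^2)
    (hm.norm.pow_const 2) (fun z => sq_nonneg _)
      (fun y => (integral_sq_gradNoise_le hg hζ hlaw y).1)
    (fun y => (integral_sq_gradNoise_le hg hζ hlaw y).2) (integrable_const _)

theorem integral_sq_gradNoise_comp_le (h : F.Smooth L) (hg : F.UnbiasedBoundedVariance σ)
    (hY : Measurable Y) (hζ : Measurable ζ)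
    (hind : IndepFun Y ζ P) (hlaw : P.map ζ = F.batchLaw i) :
    ∫ x, ‖F.gradNoise i (Y x) (ζ x)‖^2 ∂P ≤ σ^2 := by
  have hm := measurable_gradNoise h hg (i := i)
  have hint := integrable_sq_norm_of_memLp (memLp_gradNoise h hg hY hζ hind hlaw)
  rw [integral_comp_eq_of_indepFun hind hY hζ (f := fun z => ‖F.gradNoise i z.1 z.2‖^2)
    (hm.norm.pow_const 2).stronglyMeasurable hint]
  have := integral_mono_of_nonneg (μ := P) (f := fun x => ∫ x', ‖F.gradNoise i (Y x) (ζ x')‖^2 ∂P)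
    (.of_forall fun x => integral_nonneg fun _ => sq_nonneg _) (integrable_const (σ^2))
    (.of_forall fun x => (integral_sq_gradNoise_le hg hζ hlaw (Y x)).2)
  simpa using this

/-- The gradient noise is orthogonal to every function of the local model. -/
theorem integral_inner_gradNoise (h : F.Smooth L) (hg : F.UnbiasedBoundedVariance σ)
    (hY : Measurable Y) (hζ : Measurable ζ)
    (hind : IndepFun Y ζ P) (hlaw : P.map ζ = F.batchLaw i)
    {ψ : EuclideanSpace ℝ (Fin d) → EuclideanSpace ℝ (Fin d)} (hψ : Measurable ψ)
        (hψY : MemLp (fun x => ψ (Y x)) 2 P) :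
    ∫ x, ⟪ψ (Y x), F.gradNoise i (Y x) (ζ x)⟫_ℝ ∂P = 0 := by
  have hm := measurable_gradNoise h hg (i := i)
  rw [integral_comp_eq_of_indepFun hind hY hζ (f := fun z => ⟪ψ z.1, F.gradNoise i z.1 z.2⟫_ℝ)
    ((hψ.comp measurable_fst).inner hm).stronglyMeasurable
    (integrable_inner_of_memLp hψY (memLp_gradNoise h hg hY hζ hind hlaw))]
  have : ∀ x, ∫ x', ⟪ψ (Y x), F.gradNoise i (Y x) (ζ x')⟫_ℝ ∂P = 0 := fun x => by
    rw [integral_inner (integral_gradNoise hg hζ hlaw (Y x)).1,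
        (integral_gradNoise hg hζ hlaw (Y x)).2,
      inner_zero_right]
  simp [this]

theorem integral_gradNoise_comp (h : F.Smooth L) (hg : F.UnbiasedBoundedVariance σ)
    (hY : Measurable Y) (hζ : Measurable ζ)
    (hind : IndepFun Y ζ P) (hlaw : P.map ζ = F.batchLaw i) :
    ∫ x, F.gradNoise i (Y x) (ζ x) ∂P = 0 := by
  have h1 := integral_inner_gradNoise h hg hY hζ hind hlaw
    (ψ := fun _ => ∫ x, F.gradNoise i (Y x) (ζ x) ∂P) measurable_const (memLp_const _)
  rw [integral_inner ((memLp_gradNoise h hg hY hζ hind hlaw).integrable (by norm_num))] at h1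
  exact inner_self_eq_zero.1 h1

end noise

section localRun
variable (F) (ξ) (i : Fin n) (t : ℕ) (θ : EuclideanSpace ℝ (Fin d))

/-- The local model of client `i` in round `t` after `k` steps from `θ`. -/
def localIter (k : ℕ) (x : X) : EuclideanSpace ℝ (Fin d) := F.localModel i θ (fun j => ξ t i j x) k

/-- The accumulated stochastic gradient, which is `(θ - y_k) / η_l`. -/
def accGrad (k : ℕ) (x : X) : EuclideanSpace ℝ (Fin d) :=
  ∑ j ∈ range k, F.a i j • F.g i (F.localIter ξ i t θ j x) (ξ t i j x)

theorem localIter_eq (k : ℕ) (x : X) : F.localIter ξ i t θ k x =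
    θ - F.ηl • F.accGrad ξ i t θ k x := by
  induction k with
  | zero => simp [localIter, localModel, accGrad]
  | succ k ih =>
    have e : F.localIter ξ i t θ (k+1) x = F.localIter ξ i t θ k x -
      (F.ηl * F.a i k) • F.g i (F.localIter ξ i t θ k x) (ξ t i k x) := rfl
    rw [e, accGrad, sum_range_succ, ← accGrad]
    nth_rw 1 [ih]
    rw [smul_add, smul_smul, sub_sub]

variable {F ξ} in

/-- The accumulated gradient is a function of the local model. -/
theorem accGrad_eq (hηl : F.ηl ≠ 0) (k : ℕ) (x : X) :
    F.accGrad ξ i t θ k x = F.ηl⁻¹ • (θ - F.localIter ξ i t θ k x) := by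
  rw [localIter_eq, sub_sub_cancel, inv_smul_smul₀ hηl]

theorem accGrad_succ (k : ℕ) (x : X) : F.accGrad ξ i t θ (k+1) x = F.accGrad ξ i t θ k x +
    F.a i k • (gradient (F.loss i) (F.localIter ξ i t θ k x) + F.gradNoise i
        (F.localIter ξ i t θ k x) (ξ t i k x)) := by
  rw [accGrad, sum_range_succ, ← accGrad, gradNoise, add_sub_cancel]

/-- The mean of the accumulated stochastic gradient. -/
noncomputable def meanGrad (P : Measure X) (k : ℕ) : EuclideanSpace ℝ (Fin d) :=
    ∫ x, F.accGrad ξ i t θ k x ∂P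

/-- The variance of the accumulated stochastic gradient. -/
noncomputable def varGrad (P : Measure X) (k : ℕ) : ℝ :=
    ∫ x, ‖F.accGrad ξ i t θ k x - F.meanGrad ξ i t θ P k‖^2 ∂P

variable {F ξ}
variable (h : F.Smooth L) (hg : F.UnbiasedBoundedVariance σ) (hr : F.IsRandomness P S ξ)
include h hg hr

theorem measurable_localIter (k : ℕ) : Measurable (F.localIter ξ i t θ k) :=
  measurable_localModel hg.measurable i measurable_const fun j _ => hr.measurable_ξ t i j

theorem memLp_accGrad (k : ℕ) : MemLp (F.accGrad ξ i t θ k) 2 P := by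
  induction k with
  | zero =>
    have e : F.accGrad ξ i t θ 0 = fun _ => 0 := funext fun x => by simp [accGrad]
    rw [e]; exact memLp_const 0
  | succ k ih =>
    have hm := measurable_localIter i t θ h hg hr k
    have h1 : MemLp (F.localIter ξ i t θ k) 2 P := by
      have : F.localIter ξ i t θ k = fun x => θ - F.ηl • F.accGrad ξ i t θ k x := funext fun x =>
          localIter_eq ..
      rw [this]
      exact (memLp_const θ).sub (ih.const_smul F.ηl)
    have e : F.accGrad ξ i t θ (k+1) = fun x => F.accGrad ξ i t θ k x +
      F.a i k • (gradient (F.loss i) (F.localIter ξ i t θ k x) + F.gradNoise i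
          (F.localIter ξ i t θ k x) (ξ t i k x)) :=
      funext fun x => accGrad_succ ..
    rw [e]
    exact ih.add (((memLp_gradient h i h1).add (memLp_gradNoise h hg hm (hr.measurable_ξ t i k)
      (hr.indepFun_localModel hg.measurable t i θ k) (hr.law_ξ t i k))).const_smul (F.a i k))

theorem memLp_localIter (k : ℕ) : MemLp (F.localIter ξ i t θ k) 2 P := by
  have : F.localIter ξ i t θ k = fun x => θ - F.ηl • F.accGrad ξ i t θ k x := funext fun x =>
      localIter_eq ..
  rw [this]
  exact (memLp_const θ).sub ((memLp_accGrad i t θ h hg hr k).const_smul F.ηl)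

theorem meanGrad_succ (k : ℕ) : F.meanGrad ξ i t θ P (k+1) = F.meanGrad ξ i t θ P k +
    F.a i k • ∫ x, gradient (F.loss i) (F.localIter ξ i t θ k x) ∂P := by
  have hm := measurable_localIter i t θ h hg hr k
  have h1 := (memLp_accGrad i t θ h hg hr k).integrable (by norm_num)
  have h2 := (memLp_gradient h i (memLp_localIter i t θ h hg hr k)).integrable (by norm_num)
  have h3 := memLp_gradNoise h hg hm (hr.measurable_ξ t i k)
      (hr.indepFun_localModel hg.measurable t i θ k) (hr.law_ξ t i k)
  have h4 := integral_gradNoise_comp h hg hm (hr.measurable_ξ t i k)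
      (hr.indepFun_localModel hg.measurable t i θ k) (hr.law_ξ t i k)
  unfold meanGrad
  simp_rw [accGrad_succ]
  have h5 := h3.integrable (by norm_num)
  rw [integral_add h1 (by exact (h2.add h5).smul (F.a i k)), integral_smul, integral_add h2 h5, h4,
    add_zero]

theorem varGrad_succ_le (hηl : 0 < F.ηl) (k : ℕ) (ha : 0 ≤ F.a i k) : F.varGrad ξ i t θ P (k+1) ≤
    (√(F.varGrad ξ i t θ P k) + F.a i k * √(∫ x, ‖gradient (F.loss i) (F.localIter ξ i t θ k x) -
      ∫ x', gradient (F.loss i) (F.localIter ξ i t θ k x') ∂P‖^2 ∂P))^2 + F.a i k^2*σ^2 := by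
  have hm := measurable_localIter i t θ h hg hr k
  have hζ := hr.measurable_ξ t i k
  have hind := hr.indepFun_localModel hg.measurable t i θ k
  have hG := memLp_gradient h i (memLp_localIter i t θ h hg hr k)
  have hε := memLp_gradNoise h hg hm hζ hind (hr.law_ξ t i k)
  have hψ : Measurable fun y => ((F.ηl⁻¹ • (θ - y) - F.meanGrad ξ i t θ P k) + F.a i k •
      (gradient (F.loss i) y - ∫ x', gradient (F.loss i) (F.localIter ξ i t θ k x') ∂P)) := by
    have hc := (h.continuous_gradient i).measurable
    generalize F.meanGrad ξ i t θ P k = m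
    generalize ∫ x', gradient (F.loss i) (F.localIter ξ i t θ k x') ∂P = μ
    fun_prop
  have hN : MemLp (fun x => F.ηl⁻¹ • (θ - F.localIter ξ i t θ k x)) 2 P :=
    ((memLp_const θ).sub (memLp_localIter i t θ h hg hr k)).const_smul F.ηl⁻¹
  have h0 := integral_inner_gradNoise h hg hm hζ hind (hr.law_ξ t i k) hψ
    ((hN.sub (memLp_const (F.meanGrad ξ i t θ P k))).add ((hG.sub (memLp_const
      (∫ x', gradient (F.loss i) (F.localIter ξ i t θ k x') ∂P))).const_smul (F.a i k)))
  have key := integral_norm_add_smul_sq_le hN hG hε (F.meanGrad ξ i t θ P k) _ ha h0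
    (integral_sq_gradNoise_comp_le h hg hm hζ hind (hr.law_ξ t i k))
  unfold varGrad
  refine le_trans (le_of_eq (integral_congr_ae (.of_forall fun x => ?_))) (key.trans_eq ?_)
  · simp only
    rw [accGrad_succ, meanGrad_succ i t θ h hg hr, accGrad_eq i t θ hηl.ne']
    congr 2
    module
  · simp_rw [accGrad_eq i t θ hηl.ne']

/-- The distance of the mean local gradient at step `k` from the gradient at the start of the
round. -/
noncomputable def gradDrift (F : FedScheme n d Ξ 𝒮) (ξ : ℕ → Fin n → ℕ → X → Ξ) (i : Fin n) (t : ℕ)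
    (θ : EuclideanSpace ℝ (Fin d)) (P : Measure X) (k : ℕ) : ℝ :=
  ‖∫ x, gradient (F.loss i) (F.localIter ξ i t θ k x) ∂P - gradient (F.loss i) θ‖

omit h hg hr [IsProbabilityMeasure P] in
theorem meanGrad_zero : F.meanGrad ξ i t θ P 0 = 0 := by simp [meanGrad, accGrad]

theorem meanGrad_eq_sum (k : ℕ) : F.meanGrad ξ i t θ P k =
    ∑ j ∈ range k, F.a i j • ∫ x, gradient (F.loss i) (F.localIter ξ i t θ j x) ∂P := by
  induction k with
  | zero => simp [meanGrad_zero]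
  | succ k ih => rw [meanGrad_succ i t θ h hg hr, sum_range_succ, ih]

theorem norm_meanGrad_sub_le (k : ℕ) (ha : ∀ j < k, 0 ≤ F.a i j) :
    ‖F.meanGrad ξ i t θ P k - (∑ j ∈ range k, F.a i j) • gradient (F.loss i) θ‖ ≤
      ∑ j ∈ range k, F.a i j * F.gradDrift ξ i t θ P j := by
  rw [meanGrad_eq_sum i t θ h hg hr, sum_smul, ← sum_sub_distrib]
  refine (norm_sum_le _ _).trans (sum_le_sum fun j hj => ?_)
  rw [← smul_sub, norm_smul, Real.norm_of_nonneg (ha j (mem_range.1 hj)), gradDrift]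

theorem norm_meanGrad_le (k : ℕ) (ha : ∀ j < k, 0 ≤ F.a i j) :
    ‖F.meanGrad ξ i t θ P k‖ ≤ (∑ j ∈ range k, F.a i j) * ‖gradient (F.loss i) θ‖ +
      ∑ j ∈ range k, F.a i j * F.gradDrift ξ i t θ P j := by
  have h1 := norm_meanGrad_sub_le i t θ h hg hr k ha
  have h2 := norm_le_norm_add_norm_sub ((∑ j ∈ range k, F.a i j) • gradient (F.loss i) θ)
      (F.meanGrad ξ i t θ P k)
  rw [norm_sub_rev] at h1
  rw [norm_smul, Real.norm_of_nonneg (sum_nonneg fun j hj => ha j (mem_range.1 hj))] at h2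
  linarith

/-- The second moments of a local run satisfy the recursions of `IsLocalRun`. -/
theorem isLocalRun (hηl : 0 < F.ηl) (ha : ∀ k < F.K, 0 ≤ F.a i k) :
    IsLocalRun (F.a i) F.K (F.ηl*L) ‖gradient (F.loss i) θ‖ σ (F.varGrad ξ i t θ P)
      (fun k => ∫ x, ‖gradient (F.loss i) (F.localIter ξ i t θ k x) -
        ∫ x', gradient (F.loss i) (F.localIter ξ i t θ k x') ∂P‖^2 ∂P) (F.gradDrift ξ i t θ P) where
  a_nonneg := ha
  g_nonneg := norm_nonneg _
  V_zero := by simp [varGrad, accGrad, meanGrad_zero]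
  V_nonneg k := integral_nonneg fun _ => sq_nonneg _
  v_nonneg k := integral_nonneg fun _ => sq_nonneg _
  D_nonneg k := norm_nonneg _
  V_succ k hk := varGrad_succ_le i t θ h hg hr hηl k (ha k hk)
  v_le_mul k hk := by
    have hN := memLp_accGrad i t θ h hg hr k
    have hG := memLp_gradient h i (memLp_localIter i t θ h hg hr k)
    refine (integral_norm_sub_mean_le hG (gradient (F.loss i)
        (θ - F.ηl • F.meanGrad ξ i t θ P k))).trans ?_
    rw [varGrad, ← integral_const_mul]
    refine integral_mono (integrable_sq_norm_of_memLp (hG.sub (memLp_const _)))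
      ((integrable_sq_norm_of_memLp (hN.sub (memLp_const _))).const_mul _) fun x => ?_
    have h1 := (h i).2 (F.localIter ξ i t θ k x) (θ - F.ηl • F.meanGrad ξ i t θ P k)
    rw [localIter_eq, sub_sub_sub_cancel_left, ← smul_sub, norm_smul, norm_sub_rev
        (F.meanGrad ξ i t θ P k),
      Real.norm_of_nonneg hηl.le] at h1
    simp only
    rw [← mul_pow, localIter_eq]
    gcongr
    linarith
  add_le_mul k hk := by
    have hN := memLp_accGrad i t θ h hg hr k
    have hG := memLp_gradient h i (memLp_localIter i t θ h hg hr k)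
    rw [gradDrift, ← integral_norm_sub_sq hG (gradient (F.loss i) θ)]
    have h2 : ∫ x, ‖gradient (F.loss i) (F.localIter ξ i t θ k x) - gradient (F.loss i) θ‖^2 ∂P ≤
        (F.ηl*L)^2 * ∫ x, ‖F.accGrad ξ i t θ k x - 0‖^2 ∂P := by
      rw [← integral_const_mul]
      refine integral_mono (integrable_sq_norm_of_memLp (hG.sub (memLp_const _)))
        ((integrable_sq_norm_of_memLp (hN.sub (memLp_const _))).const_mul _) fun x => ?_
      have h1 := (h i).2 (F.localIter ξ i t θ k x) θ
      rw [localIter_eq, sub_sub_cancel_left, norm_neg, norm_smul, Real.norm_of_nonneg hηl.le] at h1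
      simp only [sub_zero]
      rw [← mul_pow, localIter_eq]
      gcongr
      linarith
    refine h2.trans (mul_le_mul_of_nonneg_left ?_ (sq_nonneg _))
    rw [integral_norm_sub_sq hN, sub_zero]
    refine add_le_add le_rfl ?_
    have h3 := norm_meanGrad_le i t θ h hg hr k fun j hj => ha j (by omega)
    gcongr
    exact h3

end localRun

end FedScheme

/-! ### Second moment of the aggregated update -/

section randomSum
variable {ι E X : Type*} [Fintype ι] [NormedAddCommGroup E] [InnerProductSpace ℝ E]
  [FiniteDimensional ℝ E] [MeasurableSpace E] [BorelSpace E] [MeasurableSpace X]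
  {P : Measure X} [IsProbabilityMeasure P] {W : ι → X → ℝ} {h : ι → X → E}

theorem norm_sum_smul_sq (c : ι → ℝ) (v : ι → E) :
    ‖∑ i, c i • v i‖^2 = ∑ i, ∑ j, c i * c j * ⟪v i, v j⟫_ℝ := by
  rw [← real_inner_self_eq_norm_sq, sum_inner]
  simp only [inner_sum, real_inner_smul_left, real_inner_smul_right]
  exact sum_congr rfl fun i _ => sum_congr rfl fun j _ => by ring

theorem integrable_mul_inner (hW : ∀ i, MemLp (W i) 2 P) (hh : ∀ i, MemLp (h i) 2 P)
    (hWh : IndepFun (fun x i => W i x) (fun x i => h i x) P) (i j : ι) :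
    Integrable (fun x => W i x * W j x * ⟪h i x, h j x⟫_ℝ) P ∧
    ∫ x, W i x * W j x * ⟪h i x, h j x⟫_ℝ ∂P = (∫ x, W i x * W j x ∂P) * ∫ x,
        ⟪h i x, h j x⟫_ℝ ∂P := by
  have h1 : Integrable (fun x => W i x * W j x) P := (hW i).integrable_mul (hW j)
  have h2 := integrable_inner_of_memLp (hh i) (hh j)
  have h3 : IndepFun (fun x => W i x * W j x) (fun x => ⟪h i x, h j x⟫_ℝ) P :=
    hWh.comp (φ := fun w : ι → ℝ => w i * w j) (ψ := fun v : ι → E => ⟪v i, v j⟫_ℝ)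
      ((measurable_pi_apply i).mul (measurable_pi_apply j))
      ((measurable_pi_apply i).inner (measurable_pi_apply j))
  exact ⟨h3.integrable_mul h1 h2, h3.integral_fun_mul_eq_mul_integral h1.1 h2.1⟩

theorem memLp_sum_smul (hW : ∀ i, MemLp (W i) 2 P) (hh : ∀ i, MemLp (h i) 2 P)
    (hWh : IndepFun (fun x i => W i x) (fun x i => h i x) P) :
    MemLp (fun x => ∑ i, W i x • h i x) 2 P := by
  refine (memLp_two_iff_integrable_sq_norm (f := fun x => ∑ i, W i x • h i x)
    (aestronglyMeasurable_fun_sum _ fun i _ => (hW i).1.smul (hh i).1)).2 ?_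
  simp_rw [norm_sum_smul_sq]
  exact integrable_finsetSum _ fun i _ => integrable_finsetSum _ fun j _ =>
    (integrable_mul_inner hW hh hWh i j).1

omit [FiniteDimensional ℝ E] in
theorem integral_sum_smul (hW : ∀ i, MemLp (W i) 2 P) (hh : ∀ i, MemLp (h i) 2 P)
    (hWh : IndepFun (fun x i => W i x) (fun x i => h i x) P) :
    ∫ x, ∑ i, W i x • h i x ∂P = ∑ i, (∫ x, W i x ∂P) • ∫ x, h i x ∂P := by
  have h1 : ∀ i, IndepFun (W i) (h i) P := fun i =>
    hWh.comp (φ := fun w : ι → ℝ => w i) (ψ := fun v : ι → E => v i)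
      (measurable_pi_apply i) (measurable_pi_apply i)
  rw [integral_finsetSum _ fun i _ => (h1 i).integrable_smul ((hW i).integrable (by norm_num))
    ((hh i).integrable (by norm_num))]
  exact sum_congr rfl fun i _ => (h1 i).integral_fun_smul_eq_smul_integral (hW i).1 (hh i).1

/-- The second moment of a combination of independent vectors, with random weights independent of
the vectors. -/
theorem integral_norm_sum_smul_sq {p vr γ : ι → ℝ} {α : ℝ} (hW : ∀ i, MemLp (W i) 2 P)
    (hh : ∀ i, MemLp (h i) 2 P)
    (hWh : IndepFun (fun x i => W i x) (fun x i => h i x) P)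
    (hind : ∀ i j, i ≠ j → IndepFun (h i) (h j) P)
    (hvr : ∀ i, ∫ x, W i x * W i x ∂P = vr i + p i^2)
    (hcov : ∀ i j, i ≠ j → ∫ x, W i x * W j x ∂P = (1-α)*(p i * p j))
    (hγ : ∀ i, γ i = vr i + α * p i^2) :
    ∫ x, ‖∑ i, W i x • h i x‖^2 ∂P =
      ∑ i, (vr i + p i^2) * ∫ x, ‖h i x - ∫ y, h i y ∂P‖^2 ∂P + ∑ i, γ i * ‖∫ x, h i x ∂P‖^2 +
      (1-α) * ‖∑ i, p i • ∫ x, h i x ∂P‖^2 := by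
  classical
  have e1 : ∀ i j, (∫ x, W i x * W j x ∂P) = (1-α)*(p i * p j) + if i = j then γ i else 0 := by
    intro i j
    split_ifs with hij
    · subst hij; rw [hvr, hγ]; ring
    · rw [hcov i j hij, add_zero]
  have e2 : ∀ i j, ∫ x, ⟪h i x, h j x⟫_ℝ ∂P = ⟪∫ x, h i x ∂P, ∫ x, h j x ∂P⟫_ℝ +
      if i = j then ∫ x, ‖h i x - ∫ y, h i y ∂P‖^2 ∂P else 0 := by
    intro i j
    split_ifs with hij
    · subst hij
      have h1 := integral_norm_sub_sq (hh i) 0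
      simp only [sub_zero] at h1
      simp only [real_inner_self_eq_norm_sq]
      linarith
    · rw [add_zero]
      exact (hind i j hij).integral_bilin ((hh i).integrable (by norm_num))
        ((hh j).integrable (by norm_num)) (innerSL ℝ)
  simp_rw [norm_sum_smul_sq]
  rw [integral_finsetSum _ fun i _ => integrable_finsetSum _ fun j _ =>
      (integrable_mul_inner hW hh hWh i j).1]
  simp_rw [integral_finsetSum _ fun j _ => (integrable_mul_inner hW hh hWh _ j).1,
    (integrable_mul_inner hW hh hWh _ _).2, e1, e2, mul_sum, ← sum_add_distrib]
  refine sum_congr rfl fun i _ => ?_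
  have e3 : ∀ j, ((1-α)*(p i * p j) + if i = j then γ i else 0) *
      (⟪∫ x, h i x ∂P, ∫ x, h j x ∂P⟫_ℝ +
      if i = j then ∫ x, ‖h i x - ∫ y, h i y ∂P‖^2 ∂P else 0) =
      (1-α) * (p i * p j * ⟪∫ x, h i x ∂P, ∫ x, h j x ∂P⟫_ℝ) + if i = j then
        γ i * ‖∫ x, h i x ∂P‖^2 + (vr i + p i^2) * ∫ x, ‖h i x - ∫ y, h i y ∂P‖^2 ∂P else 0 := by
    intro j
    split_ifs with hij
    · subst hij; rw [real_inner_self_eq_norm_sq, hγ]; ring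
    · ring
  simp_rw [e3, sum_add_distrib, sum_ite_eq, mem_univ, if_true]
  ring

end randomSum

namespace FedScheme
variable {n d : ℕ} {Ξ 𝒮 X : Type*} [MeasurableSpace Ξ] [MeasurableSpace 𝒮] [MeasurableSpace X]
  {P : Measure X} [IsProbabilityMeasure P] {F : FedScheme n d Ξ 𝒮} {S : ℕ → X → 𝒮}
  {ξ : ℕ → Fin n → ℕ → X → Ξ} {L σ : ℝ}

section weights
variable (hs : F.SamplingAssumption) (hr : F.IsRandomness P S ξ) (t : ℕ)
include hs hr

omit [IsProbabilityMeasure P] in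
theorem memLp_ω (i : Fin n) : MemLp (fun x => F.ω i (S t x)) 2 P :=
  (show MemLp (F.ω i) 2 (P.map (S t)) from hr.law_S t ▸ hs.memLp i).comp_of_map
      (hr.measurable_S t).aemeasurable

omit [IsProbabilityMeasure P] in
theorem integral_ω (i : Fin n) : ∫ x, F.ω i (S t x) ∂P = F.p i := by
  rw [← hs.mean i, ← hr.law_S t, integral_map (hr.measurable_S t).aemeasurable
      (hs.measurable i).aestronglyMeasurable]

theorem integral_ω_mul_ω (i j : Fin n) : ∫ x, F.ω i (S t x) * F.ω j (S t x) ∂P =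
    cov[F.ω i, F.ω j; F.samplingLaw] + F.p i * F.p j := by
  have : IsProbabilityMeasure F.samplingLaw :=
    hr.law_S t ▸ Measure.isProbabilityMeasure_map (hr.measurable_S t).aemeasurable
  rw [covariance_eq_sub (hs.memLp i) (hs.memLp j), hs.mean, hs.mean, sub_add_cancel, ← hr.law_S t,
    integral_map (hr.measurable_S t).aemeasurable ((hs.measurable i).mul
        (hs.measurable j)).aestronglyMeasurable]
  rfl

end weights

theorem roundMap_eq (t : ℕ) (θ : EuclideanSpace ℝ (Fin d)) (x : X) :
    F.roundMap θ (S t x) (fun i k => ξ t i k x) =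
      θ + -F.ηeff • ∑ i, F.ω i (S t x) • F.accGrad ξ i t θ F.K x := by
  have : ∀ i, F.localModel i θ (fun k => ξ t i k x) F.K - θ = -F.ηl •
      F.accGrad ξ i t θ F.K x := fun i => by
    have := localIter_eq F ξ i t θ F.K x
    unfold localIter at this
    rw [this, sub_sub_cancel_left, neg_smul]
  unfold roundMap
  simp_rw [this, smul_comm (F.ω _ _) (-F.ηl), ← smul_sum, smul_smul, ηeff]
  congr 2; ring

section round
variable (h : F.Smooth L) (hg : F.UnbiasedBoundedVariance σ) (hs : F.SamplingAssumption)
  (hr : F.IsRandomness P S ξ) (hηl : 0 < F.ηl) (t : ℕ) (θ : EuclideanSpace ℝ (Fin d))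
include h hg hs hr hηl

theorem indepFun_ω_accGrad : IndepFun (fun x i => F.ω i (S t x))
    (fun x i => F.accGrad ξ i t θ F.K x) P := by
  have hω : Measurable fun (s : 𝒮) i => F.ω i s := measurable_pi_lambda _ hs.measurable
  have hm : Measurable fun (z : Fin n → ℕ → Ξ) i => F.ηl⁻¹ • (θ - F.localModel i θ (z i) F.K) := by
    refine measurable_pi_lambda _ fun i => ?_
    have hm := measurable_localModel hg.measurable i (Y := Fin n → ℕ → Ξ) (x := fun _ => θ)
        (ζ := fun j z => z i j)
      measurable_const (k := F.K) fun j _ => (measurable_pi_apply j).comp (measurable_pi_apply i)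
    fun_prop
  have key := (hr.indepFun_S t).comp hω hm
  have e : (fun x i => F.accGrad ξ i t θ F.K x) = (fun z i =>
      F.ηl⁻¹ • (θ - F.localModel i θ (z i) F.K)) ∘
      fun x i k => ξ t i k x := funext fun x => funext fun i => accGrad_eq i t θ hηl.ne' _ x
  rw [e]
  exact key

omit h hs [IsProbabilityMeasure P] in
theorem indepFun_accGrad_accGrad (i j : Fin n) (hij : i ≠ j) :
    IndepFun (F.accGrad ξ i t θ F.K) (F.accGrad ξ j t θ F.K) P := by
  have e : ∀ i, F.accGrad ξ i t θ F.K = (fun y => F.ηl⁻¹ • (θ - y)) ∘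
      F.localIter ξ i t θ F.K := fun i =>
    funext fun x => accGrad_eq i t θ hηl.ne' _ x
  have hm : Measurable fun y : EuclideanSpace ℝ (Fin d) => F.ηl⁻¹ • (θ - y) :=
    (measurable_const.sub measurable_id).fun_const_smul _
  rw [e i, e j]
  exact (hr.indepFun_localModel_localModel hg.measurable t hij θ F.K).comp hm hm

theorem memLp_sum_ω_accGrad :
    MemLp (fun x => ∑ i, F.ω i (S t x) • F.accGrad ξ i t θ F.K x) 2 P :=
  memLp_sum_smul (fun i => memLp_ω hs hr t i) (fun i => memLp_accGrad i t θ h hg hr F.K)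
    (indepFun_ω_accGrad h hg hs hr hηl t θ)

theorem integral_sum_ω_accGrad : ∫ x, ∑ i, F.ω i (S t x) • F.accGrad ξ i t θ F.K x ∂P =
    ∑ i, F.p i • F.meanGrad ξ i t θ P F.K := by
  rw [integral_sum_smul (fun i => memLp_ω hs hr t i) (fun i => memLp_accGrad i t θ h hg hr F.K)
    (indepFun_ω_accGrad h hg hs hr hηl t θ)]
  simp_rw [integral_ω hs hr t]
  rfl

theorem integral_norm_sum_ω_accGrad_sq : ∫ x, ‖∑ i, F.ω i (S t x) • F.accGrad ξ i t θ F.K x‖^2 ∂P =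
    ∑ i, (F.varω i + F.p i^2) * F.varGrad ξ i t θ P F.K +
        ∑ i, F.γ i * ‖F.meanGrad ξ i t θ P F.K‖^2 +
      (1-F.α) * ‖∑ i, F.p i • F.meanGrad ξ i t θ P F.K‖^2 := by
  refine integral_norm_sum_smul_sq (W := fun i x => F.ω i (S t x)) (fun i => memLp_ω hs hr t i)
      (fun i => memLp_accGrad i t θ h hg hr F.K)
    (indepFun_ω_accGrad h hg hs hr hηl t θ) (indepFun_accGrad_accGrad hg hr hηl t θ) (fun i => ?_)
    (fun i j hij => ?_) fun i => rfl
  · rw [integral_ω_mul_ω hs hr, covariance_self (hs.measurable i).aemeasurable, varω]; ring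
  · rw [integral_ω_mul_ω hs hr, hs.cov i j hij]; ring

end round
end FedScheme

/-! ### The surrogate objective and the derived constants -/

namespace FedScheme
variable {n d : ℕ} {Ξ 𝒮 : Type*} [MeasurableSpace Ξ] [MeasurableSpace 𝒮] {F : FedScheme n d Ξ 𝒮}
    {L β κ : ℝ}

theorem a1_eq (ha : ∀ i, ∀ k < F.K, 0 ≤ F.a i k) (i : Fin n) : F.a1 i = ∑ k ∈ range F.K, F.a i k :=
  sum_congr rfl fun k hk => abs_of_nonneg (ha i k (mem_range.1 hk))

theorem a1_nonneg (F : FedScheme n d Ξ 𝒮) (i : Fin n) : 0 ≤ F.a1 i :=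
    sum_nonneg fun _ _ => abs_nonneg _

theorem w_nonneg (hp : ∀ i, 0 ≤ F.p i) (hK : 0 < F.Keff) (i : Fin n) : 0 ≤ F.w i :=
  div_nonneg (mul_nonneg (hp i) (F.a1_nonneg i)) hK.le

theorem sum_w (hK : 0 < F.Keff) : ∑ i, F.w i = 1 := by
  unfold w; rw [← sum_div]; exact div_self hK.ne'

theorem K_ne_zero (hK : 0 < F.Keff) : F.K ≠ 0 := fun h => by
  refine hK.ne' (sum_eq_zero fun i _ => ?_)
  simp [a1, h]

theorem nonempty_of_Keff_pos (hK : 0 < F.Keff) : Nonempty (Fin n) := by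
  by_contra h
  rw [not_nonempty_iff] at h
  simp [Keff] at hK

theorem a1_sub_aLast (ha : ∀ i, ∀ k < F.K, 0 ≤ F.a i k) {m : ℕ} (hm : F.K = m + 1) (i : Fin n) :
    F.a1 i - F.aLast i = ∑ k ∈ range m, F.a i k := by
  rw [a1_eq ha, aLast, hm, sum_range_succ, Nat.add_sub_cancel]; ring

theorem a2sq_sub_aLast_sq {m : ℕ} (hm : F.K = m + 1) (i : Fin n) :
    F.a2sq i - F.aLast i^2 = ∑ k ∈ range m, F.a i k^2 := by
  rw [a2sq, aLast, hm, sum_range_succ, Nat.add_sub_cancel]; ring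

theorem mul_sub_le_cC (F : FedScheme n d Ξ 𝒮) (i : Fin n) : F.a1 i * (F.a1 i - F.aLast i) ≤ F.cC :=
  le_ciSup (Finite.bddAbove_range fun i => F.a1 i * (F.a1 i - F.aLast i)) i

theorem sq_le_iSup (F : FedScheme n d Ξ 𝒮) (i : Fin n) : F.a1 i^2 ≤ ⨆ i, F.a1 i^2 :=
  le_ciSup (Finite.bddAbove_range fun i => F.a1 i^2) i

theorem cC_nonneg (ha : ∀ i, ∀ k < F.K, 0 ≤ F.a i k) (hK : 0 < F.Keff) : 0 ≤ F.cC := by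
  obtain ⟨i⟩ := nonempty_of_Keff_pos hK
  obtain ⟨m, hm⟩ := Nat.exists_eq_add_one_of_ne_zero (K_ne_zero hK)
  refine le_trans (mul_nonneg (F.a1_nonneg i) ?_) (F.mul_sub_le_cC i)
  rw [a1_sub_aLast ha hm]
  exact sum_nonneg fun k hk => ha i k (by have := mem_range.1 hk; omega)

theorem hasGradientAt_surrogate (h : F.Smooth L) (x : EuclideanSpace ℝ (Fin d)) :
    HasGradientAt F.surrogate (∑ i, F.w i • gradient (F.loss i) x) x := by
  rw [hasGradientAt_iff_hasFDerivAt, map_sum]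
  refine HasFDerivAt.fun_sum fun i _ => ?_
  have h1 := ((h i).1 x).hasGradientAt.hasFDerivAt.const_mul (F.w i)
  rwa [← map_smul] at h1

theorem gradient_surrogate (h : F.Smooth L) (x : EuclideanSpace ℝ (Fin d)) :
    gradient F.surrogate x = ∑ i, F.w i • gradient (F.loss i) x :=
        (hasGradientAt_surrogate h x).gradient

theorem norm_sum_smul_le {ι E : Type*} [Fintype ι] [NormedAddCommGroup E]
    [NormedSpace ℝ E] {w : ι → ℝ}
    (hw : ∀ i, 0 ≤ w i) (v : ι → E) : ‖∑ i, w i • v i‖ ≤ ∑ i, w i * ‖v i‖ :=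
  (norm_sum_le _ _).trans_eq
      (sum_congr rfl fun i _ => by rw [norm_smul, Real.norm_of_nonneg (hw i)])

theorem norm_gradient_surrogate_sub_le (hp : ∀ i, 0 ≤ F.p i) (hK : 0 < F.Keff) (h : F.Smooth L)
    (x y : EuclideanSpace ℝ (Fin d)) : ‖gradient F.surrogate x - gradient F.surrogate y‖ ≤
        L * ‖x - y‖ := by
  rw [gradient_surrogate h, gradient_surrogate h, ← sum_sub_distrib]
  simp_rw [← smul_sub]
  calc _ ≤ ∑ i, F.w i * ‖gradient (F.loss i) x - gradient (F.loss i) y‖ :=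
      norm_sum_smul_le (w_nonneg hp hK) _
    _ ≤ ∑ i, F.w i * (L * ‖x - y‖) :=
      sum_le_sum fun i _ => mul_le_mul_of_nonneg_left ((h i).2 x y) (w_nonneg hp hK i)
    _ = L * ‖x - y‖ := by rw [← sum_mul, sum_w hK, one_mul]

theorem differentiable_surrogate (h : F.Smooth L) : Differentiable ℝ F.surrogate :=
  fun x => (hasGradientAt_surrogate h x).differentiableAt

theorem BoundedDissimilarity.sq_norm_le (h : F.BoundedDissimilarity β κ) (i : Fin n)
    (x : EuclideanSpace ℝ (Fin d)) :
    ‖gradient (F.loss i) x‖^2 ≤ β^2*‖gradient F.surrogate x‖^2 + κ^2 := by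
  have := h (Pi.single i 1) (fun j => by
    by_cases hj : j = i
    · subst hj; simp
    · simp [Pi.single_eq_of_ne hj]) (by simp) x
  simpa [Pi.single_apply] using this

/-- Jensen's inequality, as the surrogate gradient is the `w`-average of the local ones. -/
theorem norm_sum_sub_gradient_sq_le (hp : ∀ i, 0 ≤ F.p i) (hK : 0 < F.Keff) (h : F.Smooth L)
    (x : EuclideanSpace ℝ (Fin d)) (v : Fin n → EuclideanSpace ℝ (Fin d)) :
    ‖∑ i, F.w i • v i - gradient F.surrogate x‖^2 ≤ ∑ i, F.w i * ‖v i - gradient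
        (F.loss i) x‖^2 := by
  rw [gradient_surrogate h, ← sum_sub_distrib]
  simp_rw [← smul_sub]
  have h1 := norm_sum_smul_le (w_nonneg hp hK) fun i => v i - gradient (F.loss i) x
  calc _ ≤ (∑ i, F.w i * ‖v i - gradient (F.loss i) x‖)^2 := by gcongr
    _ ≤ _ := Real.pow_arith_mean_le_arith_mean_pow _ _ _ (fun i _ => w_nonneg hp hK i) (sum_w hK)
      (fun i _ => norm_nonneg _) 2

/-- The smallness parameter `(η_l L)² C`, which is `R / 2`. -/
noncomputable def cQ (F : FedScheme n d Ξ 𝒮) (L : ℝ) : ℝ := (F.ηl*L)^2 * F.cC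

/-- The coefficient `κ₁` of `‖∇‖²` in the descent inequality of one round. -/
noncomputable def descentRate (F : FedScheme n d Ξ 𝒮) (L β : ℝ) : ℝ :=
  rhoZero (F.cQ L) - F.Ω L β*(4/3+4*driftCoeff (F.cQ L))/3

theorem roundConstants (ha : ∀ i, ∀ k < F.K, 0 ≤ F.a i k) (hK : 0 < F.Keff) (hηl : 0 < F.ηl)
    (hηg : 0 < F.ηg)
    (hL : 0 ≤ L) (hβ : 1 ≤ β^2) (hγ : ∀ i, 0 ≤ F.γ i) (hR : F.R L ≤ 1/(2*β^2+1))
        (hΩ : F.Ω L β ≤ 1/2) :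
    RoundConstants (β^2) (F.cQ L) (F.Ω L β) (F.descentRate L β)
        (F.descentRate L β / (1 - F.Ω L β)) where
  Q_nonneg := mul_nonneg (sq_nonneg _) (cC_nonneg ha hK)
  Ω_nonneg := by
    have : 0 ≤ ∑ i, F.γ i * F.a1 i^2 := sum_nonneg fun i _ => mul_nonneg (hγ i) (sq_nonneg _)
    unfold Ω ηeff; positivity
  Ω_le := hΩ
  one_le_β := hβ
  four_mul_le := by
    have e : F.R L = 2 * F.cQ L := by unfold R cQ; ring
    rw [e, le_div_iff₀ (by positivity)] at hR
    linarith
  κ_eq := rfl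
  κ_eq' := by rw [mul_div_cancel₀]; linarith

end FedScheme

/-! ### Descent in one round -/

namespace FedScheme
variable {n d : ℕ} {Ξ 𝒮 X : Type*} [MeasurableSpace Ξ] [MeasurableSpace 𝒮] [MeasurableSpace X]
  {P : Measure X} [IsProbabilityMeasure P] {F : FedScheme n d Ξ 𝒮} {S : ℕ → X → 𝒮}
  {ξ : ℕ → Fin n → ℕ → X → Ξ} {L β κ σ : ℝ}

/-- The distance of the mean normalized update of client `i` from its gradient. For `a_i = 0` the
update vanishes and the inverse is `0`. -/
noncomputable def updateDrift (F : FedScheme n d Ξ 𝒮) (ξ : ℕ → Fin n → ℕ → X → Ξ)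
    (i : Fin n) (t : ℕ)
    (θ : EuclideanSpace ℝ (Fin d)) (P : Measure X) : ℝ :=
  ‖(F.a1 i)⁻¹ • F.meanGrad ξ i t θ P F.K - gradient (F.loss i) θ‖

section client
variable (ha : ∀ i, ∀ k < F.K, 0 ≤ F.a i k) (h : F.Smooth L) (hg : F.UnbiasedBoundedVariance σ)
  (hr : F.IsRandomness P S ξ) (i : Fin n) (t : ℕ) (θ : EuclideanSpace ℝ (Fin d))
include ha h hg hr

theorem smul_inv_meanGrad : F.a1 i • (F.a1 i)⁻¹ • F.meanGrad ξ i t θ P F.K =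
    F.meanGrad ξ i t θ P F.K := by
  rcases eq_or_ne (F.a1 i) 0 with h0 | h0
  · have h1 : ∀ k ∈ range F.K, F.a i k = 0 :=
      (sum_eq_zero_iff_of_nonneg fun k hk => ha i k (mem_range.1 hk)).1 (by rw [← a1_eq ha, h0])
    have h2 : F.meanGrad ξ i t θ P F.K = 0 := by
      rw [meanGrad_eq_sum i t θ h hg hr]
      exact sum_eq_zero fun k hk => by rw [h1 k hk, zero_smul]
    rw [h2, smul_zero, smul_zero]
  · exact smul_inv_smul₀ h0 _

theorem mul_updateDrift_le : F.a1 i * F.updateDrift ξ i t θ P ≤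
    ∑ k ∈ range F.K, F.a i k * F.gradDrift ξ i t θ P k := by
  have h1 := norm_meanGrad_sub_le i t θ h hg hr F.K (ha i)
  rw [← a1_eq ha, ← smul_inv_meanGrad ha h hg hr, ← smul_sub, norm_smul,
    Real.norm_of_nonneg (F.a1_nonneg i)] at h1
  exact h1

theorem norm_meanGrad_sq_le : ‖F.meanGrad ξ i t θ P F.K‖^2 ≤
    F.a1 i^2 * (‖gradient (F.loss i) θ‖ + F.updateDrift ξ i t θ P)^2 := by
  rw [← smul_inv_meanGrad ha h hg hr, norm_smul, Real.norm_of_nonneg (F.a1_nonneg i), ← mul_pow]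
  have h1 := norm_le_norm_add_norm_sub (gradient (F.loss i) θ)
      ((F.a1 i)⁻¹ • F.meanGrad ξ i t θ P F.K)
  rw [norm_sub_rev] at h1
  have := F.a1_nonneg i
  gcongr
  exact h1

end client

/-- The part of the bound for one round that does not depend on the iterate. -/
noncomputable def roundNoise (F : FedScheme n d Ξ 𝒮) (L β κ σ : ℝ) : ℝ :=
  2*(F.descentRate L β/(1-F.Ω L β))*(L*F.ηeff/F.Keff*∑ i, (F.varω i + F.p i^2)*F.a2sq i)*σ^2 +
  3*(F.descentRate L β/(1-F.Ω L β))*(F.ηl*L)^2*(∑ i, F.w i*(F.a2sq i - F.aLast i^2))*σ^2 +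
  6*(F.descentRate L β/(1-F.Ω L β))*F.cQ L*κ^2 +
  3*F.descentRate L β*(L*F.ηeff/F.Keff*F.cC*∑ i, F.γ i)*σ^2 +
  6*F.descentRate L β*(L*F.ηeff/F.Keff*(⨆ i, F.a1 i^2)*∑ i, F.γ i)*κ^2

/-- The standing assumptions of the convergence theorem. -/
structure Assumptions (F : FedScheme n d Ξ 𝒮) (P : Measure X) (S : ℕ → X → 𝒮)
    (ξ : ℕ → Fin n → ℕ → X → Ξ) (L β κ σ : ℝ) : Prop where
  p_nonneg : ∀ i, 0 ≤ F.p i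
  a_nonneg : ∀ i, ∀ k < F.K, 0 ≤ F.a i k
  Keff_pos : 0 < F.Keff
  ηl_pos : 0 < F.ηl
  ηg_pos : 0 < F.ηg
  L_nonneg : 0 ≤ L
  one_le_β : 1 ≤ β^2
  smooth : F.Smooth L
  bddBelow : BddBelow (Set.range F.surrogate)
  dissimilarity : F.BoundedDissimilarity β κ
  grad : F.UnbiasedBoundedVariance σ
  sampling : F.SamplingAssumption
  γ_nonneg : ∀ i, 0 ≤ F.γ i
  randomness : F.IsRandomness P S ξ
  R_le : F.R L ≤ 1/(2*β^2+1)
  R'_lt : F.R' L < 1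
  step_pos : 0 < 1 - L*F.ηeff*(1-F.α)*F.Keff
  Ω_le : F.Ω L β ≤ 1/2

namespace Assumptions
variable (hF : F.Assumptions P S ξ L β κ σ)
include hF

omit [IsProbabilityMeasure P] in
theorem roundConstants : RoundConstants (β^2) (F.cQ L) (F.Ω L β) (F.descentRate L β)
    (F.descentRate L β/(1-F.Ω L β)) :=
  FedScheme.roundConstants hF.a_nonneg hF.Keff_pos hF.ηl_pos hF.ηg_pos hF.L_nonneg hF.one_le_β
    hF.γ_nonneg hF.R_le hF.Ω_le

omit [IsProbabilityMeasure P] in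
theorem ηeff_pos : 0 < F.ηeff := mul_pos hF.ηl_pos hF.ηg_pos

omit [IsProbabilityMeasure P] in
theorem descentRate_pos : 0 < F.descentRate L β := by
  linarith [hF.roundConstants.κ_ge, hF.roundConstants.ρ_ge']

omit [IsProbabilityMeasure P] in
theorem small_localRun (i : Fin n) {m : ℕ} (hm : F.K = m+1) :
    IsLocalRun.Small (F.a i) m (F.ηl*L) F.cC
    (F.descentRate L β/(1-F.Ω L β)) (2*F.Ω L β) where
  C_nonneg := cC_nonneg hF.a_nonneg hF.Keff_pos
  le_C := by
    rw [← a1_sub_aLast hF.a_nonneg hm, ← hm, ← a1_eq hF.a_nonneg]; exact F.mul_sub_le_cC i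
  Q_le := hF.roundConstants.Q_le
  sq_le := by
    rw [← hm, ← a1_eq hF.a_nonneg, mul_pow]
    have h1 := mul_le_mul_of_nonneg_left (F.sq_le_iSup i) (sq_nonneg (F.ηl*L))
    have h2 := hF.R'_lt
    unfold R' at h2
    linarith
  w_nonneg := by linarith [hF.roundConstants.Ω_nonneg]
  w_le := by linarith [hF.Ω_le]
  ρ_ge := hF.roundConstants.ρ_ge

/-- `round_step_le` for the moments of the local runs of one round. -/
theorem round_step (t : ℕ) (θ : EuclideanSpace ℝ (Fin d)) :
    -‖gradient F.surrogate θ‖^2/2 + 1/2*∑ i, F.w i * F.updateDrift ξ i t θ P^2 +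
      L*F.ηeff/F.Keff/2*∑ i, (F.varω i + F.p i^2)*F.varGrad ξ i t θ P F.K +
      L*F.ηeff/F.Keff/2*∑ i, F.γ i*‖F.meanGrad ξ i t θ P F.K‖^2 ≤
      -(F.descentRate L β*‖gradient F.surrogate θ‖^2) + F.roundNoise L β κ σ := by
  obtain ⟨m, hm⟩ := Nat.exists_eq_add_one_of_ne_zero (K_ne_zero hF.Keff_pos)
  have hK := hF.Keff_pos
  have hL := hF.L_nonneg
  have hηe := hF.ηeff_pos
  have hq : 0 ≤ F.ηl*L := mul_nonneg hF.ηl_pos.le hF.L_nonneg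
  have hrun : ∀ i, IsLocalRun (F.a i) (m+1) (F.ηl*L) ‖gradient (F.loss i) θ‖ σ (F.varGrad ξ i t θ P)
      (fun k => ∫ x, ‖gradient (F.loss i) (F.localIter ξ i t θ k x) -
        ∫ x', gradient (F.loss i) (F.localIter ξ i t θ k x') ∂P‖^2 ∂P) (F.gradDrift ξ i t θ P) :=
    fun i => by
      have := isLocalRun i t θ hF.smooth hF.grad hF.randomness hF.ηl_pos (hF.a_nonneg i)
      rwa [hm] at this
  have hsm := fun i => hF.small_localRun i hm
  have hA1 : ∀ i, ∑ k ∈ range (m+1), F.a i k = F.a1 i := fun i => by rw [a1_eq hF.a_nonneg, hm]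
  have hA2 : ∀ i, ∑ k ∈ range (m+1), F.a i k^2 = F.a2sq i := fun i => by rw [a2sq, hm]
  have hd : ∀ i, 0 ≤ (∑ k ∈ range (m+1), F.a i k) * F.updateDrift ξ i t θ P := fun i => by
    rw [hA1]; exact mul_nonneg (F.a1_nonneg i) (norm_nonneg _)
  have hdT : ∀ i, (∑ k ∈ range (m+1), F.a i k) * F.updateDrift ξ i t θ P ≤
      ∑ k ∈ range (m+1), F.a i k * F.gradDrift ξ i t θ P k := fun i => by
    rw [hA1]
    simpa only [hm] using mul_updateDrift_le hF.a_nonneg hF.smooth hF.grad hF.randomness i t θ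
  refine round_step_le (ι := Fin n) (w := F.w) (p := F.p) (a := F.a1) (s2 := F.a2sq)
      (b := fun i => F.a2sq i - F.aLast i^2)
    (vr := F.varω) (γ := F.γ) (g := fun i => ‖gradient (F.loss i) θ‖)
        (H := fun i => ‖F.meanGrad ξ i t θ P F.K‖^2)
    (d := fun i => F.updateDrift ξ i t θ P) (V := fun i => F.varGrad ξ i t θ P F.K)
    (α := F.α) (e := L*F.ηeff/F.Keff) (Kf := F.Keff) (σ := σ) (q := F.ηl*L) (C := F.cC)
    (amax := ⨆ i, F.a1 i^2) (Q := F.cQ L)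
    hF.roundConstants rfl (by positivity) hF.Keff_pos ?_ F.a1_nonneg hF.p_nonneg (fun _ => rfl)
    (sum_w hF.Keff_pos) (fun _ => rfl) hF.γ_nonneg (fun i => variance_nonneg _ _) ?_ F.sq_le_iSup ?_
        (cC_nonneg hF.a_nonneg hF.Keff_pos)
    (fun i => norm_meanGrad_sq_le hF.a_nonneg hF.smooth hF.grad hF.randomness i t θ) (sq_nonneg κ)
        (sq_nonneg _)
    (fun i => hF.dissimilarity.sq_norm_le i θ) ?_ ?_ ?_
  · have e : L*F.ηeff/F.Keff*(1-F.α)*F.Keff^2 = L*F.ηeff*(1-F.α)*F.Keff := by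
      field_simp
    rw [e]; linarith [hF.step_pos]
  · unfold Ω; ring
  · have h2 := hF.R'_lt
    unfold R' at h2
    linarith
  · intro i s h0 h1
    have := (hrun i).drift_add_variance_le (hsm i) hq (hd i) (hdT i) h0 h1
    rw [hA1, hA2, ← a2sq_sub_aLast_sq hm, ← hm] at this
    exact this
  · intro i
    have := (hrun i).variance_add_mean_le (hsm i) hq (hd i) (hdT i)
    rw [hA1, hA2, ← hm] at this
    exact this
  · intro i u ν h0 h1
    have := (hrun i).variance_add_mean_weighted_le (hsm i) hq (hd i) (hdT i) h0 h1
    rw [hA1, hA2, ← hm] at this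
    exact this

theorem integrable_surrogate_roundMap (t : ℕ)
    (θ : EuclideanSpace ℝ (Fin d)) :
    Integrable (fun x => F.surrogate (F.roundMap θ (S t x) (fun i k => ξ t i k x))) P := by
  have hU := memLp_sum_ω_accGrad hF.smooth hF.grad hF.sampling hF.randomness hF.ηl_pos t θ
  set U := fun x => ∑ i, F.ω i (S t x) • F.accGrad ξ i t θ F.K x with hUdef
  have hV : MemLp (fun x => -F.ηeff • U x) 2 P := hU.const_smul (-F.ηeff)
  have e : ∀ x, F.roundMap θ (S t x) (fun i k => ξ t i k x) = θ + -F.ηeff • U x := fun x =>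
      roundMap_eq t θ x
  simp_rw [e]
  have hub : Integrable (fun x => F.surrogate θ + ⟪gradient F.surrogate θ, -F.ηeff • U x⟫_ℝ +
      L/2*‖-F.ηeff • U x‖^2) P :=
    ((integrable_const _).add (integrable_inner_of_memLp (memLp_const _) hV)).add
      ((integrable_sq_norm_of_memLp hV).const_mul _)
  have hm : AEStronglyMeasurable (fun x => F.surrogate (θ + -F.ηeff • U x)) P :=
    (differentiable_surrogate hF.smooth).continuous.comp_aestronglyMeasurable
        (aestronglyMeasurable_const.add hV.1)
  exact integrable_of_le_of_le hm (.of_forall fun x => ciInf_le hF.bddBelow (θ + -F.ηeff • U x))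
    (.of_forall fun x => le_add_inner_add_sq (differentiable_surrogate hF.smooth)
      (norm_gradient_surrogate_sub_le hF.p_nonneg hF.Keff_pos hF.smooth) θ (-F.ηeff • U x))
          (integrable_const _) hub

/-- The expected descent of the surrogate in one round started at `θ`. -/
theorem integral_surrogate_roundMap_le (t : ℕ)
    (θ : EuclideanSpace ℝ (Fin d)) :
    ∫ x, F.surrogate (F.roundMap θ (S t x) (fun i k => ξ t i k x)) ∂P ≤ F.surrogate θ +
      F.ηeff*F.Keff*(-(F.descentRate L β*‖gradient F.surrogate θ‖^2) + F.roundNoise L β κ σ) := by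
  have hint := hF.integrable_surrogate_roundMap t θ
  have hηe := hF.ηeff_pos
  have hU := memLp_sum_ω_accGrad hF.smooth hF.grad hF.sampling hF.randomness hF.ηl_pos t θ
  have hU1 := integral_sum_ω_accGrad hF.smooth hF.grad hF.sampling hF.randomness hF.ηl_pos t θ
  have hU2 := integral_norm_sum_ω_accGrad_sq hF.smooth hF.grad hF.sampling hF.randomness
      hF.ηl_pos t θ
  have hstep := hF.round_step t θ
  have e : ∀ x, F.roundMap θ (S t x) (fun i k => ξ t i k x) =
    θ + -F.ηeff • ∑ i, F.ω i (S t x) • F.accGrad ξ i t θ F.K x := fun x => roundMap_eq t θ x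
  simp_rw [e] at hint ⊢
  have hK := hF.Keff_pos
  have hη := hF.step_pos
  -- the mean update
  set u := ∑ i, F.w i • (F.a1 i)⁻¹ • F.meanGrad ξ i t θ P F.K with hu
  have hpu : ∑ i, F.p i • F.meanGrad ξ i t θ P F.K = F.Keff • u := by
    rw [hu, smul_sum]
    refine sum_congr rfl fun i _ => ?_
    have hw : F.Keff * F.w i = F.p i * F.a1 i := by unfold w; field_simp
    rw [smul_smul, hw, mul_smul, smul_inv_meanGrad hF.a_nonneg hF.smooth hF.grad hF.randomness]
  rw [hpu] at hU1 hU2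
  have hdrift : ‖u - gradient F.surrogate θ‖^2 ≤ ∑ i, F.w i * F.updateDrift ξ i t θ P^2 :=
    norm_sum_sub_gradient_sq_le hF.p_nonneg hF.Keff_pos hF.smooth θ _
  set G := gradient F.surrogate θ with hG
  set Uf := fun x => ∑ i, F.ω i (S t x) • F.accGrad ξ i t θ F.K x with hUdef
  have hub : ∫ x, F.surrogate (θ + -F.ηeff • Uf x) ∂P ≤
      F.surrogate θ - F.ηeff * ⟪G, F.Keff • u⟫_ℝ + L/2*F.ηeff^2*∫ x, ‖Uf x‖^2 ∂P := by
    have hi1 : Integrable (fun x => F.surrogate θ + -F.ηeff * ⟪G, Uf x⟫_ℝ) P :=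
      (integrable_const _).add ((integrable_inner_of_memLp (memLp_const G) hU).const_mul _)
    have hi2 : Integrable (fun x => L/2*F.ηeff^2*‖Uf x‖^2) P :=
        (integrable_sq_norm_of_memLp hU).const_mul _
    calc _ ≤ ∫ x, ((F.surrogate θ + -F.ηeff * ⟪G, Uf x⟫_ℝ) + L/2*F.ηeff^2*‖Uf x‖^2) ∂P := by
          refine integral_mono hint (hi1.add hi2) fun x => ?_
          have := le_add_inner_add_sq (differentiable_surrogate hF.smooth)
            (norm_gradient_surrogate_sub_le hF.p_nonneg hF.Keff_pos hF.smooth) θ (-F.ηeff • Uf x)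
          rw [real_inner_smul_right, norm_smul, mul_pow, Real.norm_eq_abs, sq_abs] at this
          simp only
          linarith
      _ = _ := by
          rw [integral_add hi1 hi2, integral_add (integrable_const _)
            ((integrable_inner_of_memLp (memLp_const G) hU).const_mul _), integral_const_mul,
            integral_const_mul, integral_inner (hU.integrable (by norm_num)), hU1]
          simp
          ring
  refine hub.trans ?_
  rw [hU2, real_inner_smul_right, norm_smul, mul_pow, Real.norm_of_nonneg hF.Keff_pos.le]
  have hpol : -⟪G, u⟫_ℝ = ‖u - G‖^2/2 - ‖G‖^2/2 - ‖u‖^2/2 := by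
    rw [norm_sub_sq_real, real_inner_comm]; ring
  have h1 : L*F.ηeff*(1-F.α)*F.Keff*‖u‖^2 ≤ ‖u‖^2 := by nlinarith [sq_nonneg ‖u‖]
  have h2 : -⟪G, u⟫_ℝ + L*F.ηeff/F.Keff/2*(∑ i, (F.varω i + F.p i^2)*F.varGrad ξ i t θ P F.K +
      ∑ i, F.γ i*‖F.meanGrad ξ i t θ P F.K‖^2) + L*F.ηeff*(1-F.α)*F.Keff/2*‖u‖^2 ≤
      -(F.descentRate L β*‖G‖^2) + F.roundNoise L β κ σ := by linarith
  have h3 := mul_le_mul_of_nonneg_left h2 (mul_pos hηe hF.Keff_pos).le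
  refine le_trans (le_of_eq ?_) (add_le_add_right h3 (F.surrogate θ))
  field_simp
  ring

end Assumptions
end FedScheme

/-! ### Summation over the rounds -/

namespace FedScheme
variable {n d : ℕ} {Ξ 𝒮 X : Type*} [MeasurableSpace Ξ] [MeasurableSpace 𝒮] [MeasurableSpace X]
  {P : Measure X} [IsProbabilityMeasure P] {F : FedScheme n d Ξ 𝒮} {S : ℕ → X → 𝒮}
  {ξ : ℕ → Fin n → ℕ → X → Ξ} {L β κ σ : ℝ}

theorem measurable_globalModel (hg : F.UnbiasedBoundedVariance σ) (hs : F.SamplingAssumption)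
    (hr : F.IsRandomness P S ξ) (θ₀ : EuclideanSpace ℝ (Fin d)) (t : ℕ) :
    Measurable (F.θ θ₀ S ξ t) :=
  (measurable_θ hg.measurable hs.measurable θ₀ (A := Set.univ) t fun _ _ =>
      ⟨trivial, fun _ _ => trivial⟩).mono
    (noiseAlg_le hr _) le_rfl

namespace Assumptions
variable (hF : F.Assumptions P S ξ L β κ σ)
include hF

/-- By induction: the surrogate is bounded below, and its expected value after a round is bounded
by an integrable function of the iterate. -/
theorem integrable_surrogate_θ (θ₀ : EuclideanSpace ℝ (Fin d)) (t : ℕ) :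
    Integrable (fun x => F.surrogate (F.θ θ₀ S ξ t x)) P := by
  induction t with
  | zero => exact integrable_const (F.surrogate θ₀)
  | succ t ih =>
    have hm := measurable_roundMap (Y := EuclideanSpace ℝ (Fin d) × 𝒮 × (Fin n → ℕ → Ξ))
        (x := fun z => z.1)
      (s := fun z => z.2.1) (ζ := fun i k z => z.2.2 i k) hF.grad.measurable hF.sampling.measurable
          measurable_fst
      (measurable_fst.comp measurable_snd) fun i k => (measurable_pi_apply k).comp
        ((measurable_pi_apply i).comp (measurable_snd.comp measurable_snd))
    have hf : Measurable fun z : EuclideanSpace ℝ (Fin d) × 𝒮 × (Fin n → ℕ → Ξ) =>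
        F.surrogate (F.roundMap z.1 z.2.1 z.2.2) - ⨅ y, F.surrogate y :=
      ((differentiable_surrogate hF.smooth).continuous.measurable.comp hm).sub_const _
    have hζ : Measurable fun x => (S t x, fun i k => ξ t i k x) :=
      (hF.randomness.measurable_S t).prodMk (measurable_pi_pi fun i k => hF.randomness.measurable_ξ
          t i k)
    have hint := fun θ => hF.integrable_surrogate_roundMap t θ
    have hle := fun θ => hF.integral_surrogate_roundMap_le t θ
    have hd0 := hF.descentRate_pos.le
    have key := integrable_comp_of_indepFun_of_le (hF.randomness.indepFun_θ hF.grad.measurable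
        hF.sampling.measurable θ₀ t)
      (measurable_globalModel hF.grad hF.sampling hF.randomness θ₀ t) hζ hf
          (fun z => sub_nonneg.2 (ciInf_le hF.bddBelow _))
      (B := fun θ => F.surrogate θ + F.ηeff*F.Keff*F.roundNoise L β κ σ - ⨅ y, F.surrogate y)
      (fun θ => (hint θ).sub (integrable_const _)) (fun θ => by
        rw [integral_sub (hint θ) (integrable_const _)]
        have h1 := mul_nonneg (mul_pos (mul_pos hF.ηl_pos hF.ηg_pos) hF.Keff_pos).le
            (mul_nonneg hd0 (sq_nonneg ‖gradient F.surrogate θ‖))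
        have h2 := hle θ
        simp only [integral_const, probReal_univ, one_smul]
        unfold ηeff at h2 ⊢
        linarith) ((ih.add (integrable_const _)).sub (integrable_const _))
    refine (key.add (integrable_const (⨅ y, F.surrogate y))).congr (.of_forall fun x => ?_)
    exact sub_add_cancel (F.surrogate (F.θ θ₀ S ξ (t+1) x)) _

/-- The descent of the surrogate, which is bounded below, controls the squared gradient. -/
theorem integrable_gradient_θ (θ₀ : EuclideanSpace ℝ (Fin d)) (t : ℕ) :
    Integrable (fun x => ‖gradient F.surrogate (F.θ θ₀ S ξ t x)‖^2) P := by
  have hint := fun θ => hF.integrable_surrogate_roundMap t θ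
  have hle := fun θ => hF.integral_surrogate_roundMap_le t θ
  have hd0 := hF.descentRate_pos
  have hmul : 0 < F.ηeff*F.Keff*F.descentRate L β :=
      mul_pos (mul_pos (mul_pos hF.ηl_pos hF.ηg_pos) hF.Keff_pos) hd0
  have hcont : Continuous (gradient F.surrogate) :=
    LipschitzWith.continuous (K := L.toNNReal) (LipschitzWith.of_dist_le_mul fun x y => by
      rw [dist_eq_norm, dist_eq_norm]
      exact (norm_gradient_surrogate_sub_le hF.p_nonneg hF.Keff_pos hF.smooth x y).trans
        (mul_le_mul_of_nonneg_right (Real.le_coe_toNNReal L) (norm_nonneg _)))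
  refine Integrable.mono' (((hF.integrable_surrogate_θ θ₀ t).add
    (integrable_const (F.ηeff*F.Keff*F.roundNoise L β κ σ - ⨅ y, F.surrogate y))).div_const
      (F.ηeff*F.Keff*F.descentRate L β))
    ((hcont.norm.pow 2).measurable.comp (measurable_globalModel hF.grad hF.sampling hF.randomness θ₀
        t)).aestronglyMeasurable (.of_forall fun x => ?_)
  rw [Real.norm_of_nonneg (sq_nonneg _), le_div_iff₀ hmul, Pi.add_apply]
  have h1 := hle (F.θ θ₀ S ξ t x)
  have h2 := integral_mono (integrable_const _) (hint (F.θ θ₀ S ξ t x)) fun y =>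
      ciInf_le hF.bddBelow _
  simp only [integral_const, probReal_univ, one_smul] at h2
  linarith

theorem integral_surrogate_θ_succ_le (θ₀ : EuclideanSpace ℝ (Fin d)) (t : ℕ) :
    ∫ x, F.surrogate (F.θ θ₀ S ξ (t+1) x) ∂P ≤ ∫ x, F.surrogate (F.θ θ₀ S ξ t x) ∂P +
      F.ηeff*F.Keff*(-(F.descentRate L β*∫ x, ‖gradient F.surrogate (F.θ θ₀ S ξ t x)‖^2 ∂P) +
        F.roundNoise L β κ σ) := by
  have hle := fun θ => hF.integral_surrogate_roundMap_le t θ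
  have hi := hF.integrable_surrogate_θ θ₀
  have hG := hF.integrable_gradient_θ θ₀ t
  have hm := measurable_roundMap (Y := EuclideanSpace ℝ (Fin d) × 𝒮 × (Fin n → ℕ → Ξ))
      (x := fun z => z.1)
    (s := fun z => z.2.1) (ζ := fun i k z => z.2.2 i k) hF.grad.measurable hF.sampling.measurable
        measurable_fst
    (measurable_fst.comp measurable_snd) fun i k => (measurable_pi_apply k).comp
      ((measurable_pi_apply i).comp (measurable_snd.comp measurable_snd))
  have hf : Measurable fun z : EuclideanSpace ℝ (Fin d) × 𝒮 × (Fin n → ℕ → Ξ) =>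
      F.surrogate (F.roundMap z.1 z.2.1 z.2.2) := (differentiable_surrogate
          hF.smooth).continuous.measurable.comp hm
  have hζ : Measurable fun x => (S t x, fun i k => ξ t i k x) :=
    (hF.randomness.measurable_S t).prodMk (measurable_pi_pi fun i k => hF.randomness.measurable_ξ t
        i k)
  have e := integral_comp_eq_of_indepFun (hF.randomness.indepFun_θ hF.grad.measurable
      hF.sampling.measurable θ₀ t)
    (measurable_globalModel hF.grad hF.sampling hF.randomness θ₀ t) hζ hf.stronglyMeasurable
        (hi (t+1))
  have hG' : Integrable (fun x => -(F.descentRate L β*‖gradient F.surrogate (F.θ θ₀ S ξ t x)‖^2))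
      P :=
    (hG.const_mul _).neg
  have hB : Integrable (fun x => F.ηeff*F.Keff*(-(F.descentRate L β*
      ‖gradient F.surrogate (F.θ θ₀ S ξ t x)‖^2) + F.roundNoise L β κ σ)) P :=
    (hG'.add (integrable_const _)).const_mul _
  have h1 : ∫ x, F.surrogate (F.θ θ₀ S ξ (t+1) x) ∂P ≤ _ := e.trans_le
    (integral_mono (integrable_integral_comp_of_indepFun
        (hF.randomness.indepFun_θ hF.grad.measurable
      hF.sampling.measurable θ₀ t) (measurable_globalModel hF.grad hF.sampling hF.randomness θ₀ t)
          hζ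
      hf.stronglyMeasurable (hi (t+1))) ((hi t).add hB) fun x => hle (F.θ θ₀ S ξ t x))
  refine h1.trans_eq ?_
  simp only [Pi.add_apply]
  rw [integral_add (hi t) hB, integral_const_mul, integral_add hG' (integrable_const _),
    integral_neg, integral_const_mul]
  simp

theorem sum_integral_gradient_le (θ₀ : EuclideanSpace ℝ (Fin d)) (T : ℕ) :
    F.ηeff*F.Keff*F.descentRate L β * ∑ t ∈ range T,
        ∫ x, ‖gradient F.surrogate (F.θ θ₀ S ξ t x)‖^2 ∂P ≤
      (F.surrogate θ₀ - ⨅ y, F.surrogate y) + T*(F.ηeff*F.Keff*F.roundNoise L β κ σ) := by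
  have hi := hF.integrable_surrogate_θ θ₀
  have hstep := hF.integral_surrogate_θ_succ_le θ₀
  have h1 : ∀ T : ℕ, F.ηeff*F.Keff*F.descentRate L β * ∑ t ∈ range T,
      ∫ x, ‖gradient F.surrogate (F.θ θ₀ S ξ t x)‖^2 ∂P ≤ F.surrogate θ₀ -
      ∫ x, F.surrogate (F.θ θ₀ S ξ T x) ∂P + T*(F.ηeff*F.Keff*F.roundNoise L β κ σ) := by
    intro T
    induction T with
    | zero => simp [θ, globalModel]
    | succ T ih =>
      rw [sum_range_succ]
      have := hstep T
      push_cast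
      linarith
  have h2 := integral_mono (integrable_const _) (hi T) fun y => ciInf_le hF.bddBelow _
  simp only [integral_const, probReal_univ, one_smul] at h2
  linarith [h1 T]

end Assumptions

theorem roundNoise_div_descentRate {m : ℕ} (hm : 0 < m) (hΩ : F.Ω L β ≤ 1/2)
    (hd : 0 < F.descentRate L β) :
    F.roundNoise L β κ σ / F.descentRate L β =
      2 * L * F.ηeff * (1 / (m : ℝ)) * (F.cA m / (1 - F.Ω L β)) * σ ^ 2
        + 3 * F.ηl ^ 2 * L ^ 2 * (F.cB / (1 - F.Ω L β)) * σ ^ 2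
        + 6 * F.ηl ^ 2 * L ^ 2 * (F.cC / (1 - F.Ω L β)) * κ ^ 2
        + 3 * L * F.ηeff * F.cD * σ ^ 2
        + 6 * L * F.ηeff * F.cE * κ ^ 2 := by
  have h1 : 0 < 1 - F.Ω L β := by linarith
  have hm' : (m:ℝ) ≠ 0 := by positivity
  have hγ : ∑ i, F.varω i + F.α * ∑ i, F.p i^2 = ∑ i, F.γ i := by
    rw [mul_sum, ← sum_add_distrib]; rfl
  unfold roundNoise cA cD cE cQ
  rw [hγ, ← cB]
  generalize F.Ω L β = Ω at *
  generalize F.descentRate L β = κ₁ at *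
  have h1' := h1.ne'
  have hd' := hd.ne'
  generalize ∑ i, (F.varω i + F.p i^2)*F.a2sq i = s
  generalize ∑ i, F.γ i = s'
  generalize (⨆ i, F.a1 i ^ 2) = s''
  generalize F.Keff = Kf
  field_simp

end FedScheme

end

theorem mainTheorem2 {n d : ℕ} {Ξ 𝒮 X : Type*} [MeasurableSpace Ξ] [MeasurableSpace 𝒮]
    [MeasurableSpace X] (P : Measure X) [IsProbabilityMeasure P]
    (F : FedScheme n d Ξ 𝒮) (L β κ σ : ℝ) (m T : ℕ)
    (θ₀ : EuclideanSpace ℝ (Fin d)) (S : ℕ → X → 𝒮) (ξ : ℕ → Fin n → ℕ → X → Ξ)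
    (hp : ∀ i, 0 ≤ F.p i)
    (ha : ∀ i, ∀ k < F.K, 0 ≤ F.a i k)
    (hK : 0 < F.Keff)
    (hηl : 0 < F.ηl) (hηg : 0 < F.ηg) (hm : 0 < m) (hT : 0 < T)
    (hL : 0 ≤ L) (hβ : 1 ≤ β ^ 2)
    (hsmooth : F.Smooth L)
    (hbdd : BddBelow (Set.range F.surrogate))
    (hdiss : F.BoundedDissimilarity β κ)
    (hgrad : F.UnbiasedBoundedVariance σ)
    (hsamp : F.SamplingAssumption)
    (hγ : ∀ i, 0 ≤ F.γ i)
    (hrand : F.IsRandomness P S ξ)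
    (hR : F.R L ≤ 1 / (2 * β ^ 2 + 1))
    (hR' : F.R' L < 1)
    (hη : 0 < 1 - L * F.ηeff * (1 - F.α) * F.Keff)
    (hΩ : F.Ω L β ≤ 1 / 2) :
    (∀ t < T, Integrable (fun x => ‖gradient F.surrogate (F.θ θ₀ S ξ t x)‖ ^ 2) P) ∧
    1 / (T : ℝ) * ∑ t ∈ Finset.range T,
        ∫ x, ‖gradient F.surrogate (F.θ θ₀ S ξ t x)‖ ^ 2 ∂P
      ≤ 4 * ((F.surrogate θ₀ - ⨅ y, F.surrogate y) / ((1 - F.Ω L β) * F.ηeff * F.Keff * T))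
        + 2 * L * F.ηeff * (1 / (m : ℝ)) * (F.cA m / (1 - F.Ω L β)) * σ ^ 2
        + 3 * F.ηl ^ 2 * L ^ 2 * (F.cB / (1 - F.Ω L β)) * σ ^ 2
        + 6 * F.ηl ^ 2 * L ^ 2 * (F.cC / (1 - F.Ω L β)) * κ ^ 2
        + 3 * L * F.ηeff * F.cD * σ ^ 2
        + 6 * L * F.ηeff * F.cE * κ ^ 2 := by
  have hF : F.Assumptions P S ξ L β κ σ := ⟨hp, ha, hK, hηl, hηg, hL, hβ, hsmooth, hbdd, hdiss, hgrad,
    hsamp, hγ, hrand, hR, hR', hη, hΩ⟩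
  have hρ := hF.roundConstants.ρ_ge'
  have hd := hF.descentRate_pos
  have hηe := hF.ηeff_pos
  have hT' : (0:ℝ) < T := by exact_mod_cast hT
  have h1Ω : 0 < 1 - F.Ω L β := by linarith
  have hsum := hF.sum_integral_gradient_le θ₀ T
  refine ⟨fun t _ => hF.integrable_gradient_θ θ₀ t, ?_⟩
  have hnoise := FedScheme.roundNoise_div_descentRate (F := F) (L := L) (β := β) (κ := κ) (σ := σ)
    hm hΩ hd
  have hf : 0 ≤ F.surrogate θ₀ - ⨅ y, F.surrogate y := sub_nonneg.2 (ciInf_le hbdd θ₀)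
  have hinit : (F.surrogate θ₀ - ⨅ y, F.surrogate y) / (F.descentRate L β * F.ηeff * F.Keff * T) ≤
      4 * ((F.surrogate θ₀ - ⨅ y, F.surrogate y) / ((1 - F.Ω L β) * F.ηeff * F.Keff * T)) := by
    -- the descent rate is at least `(1 - Ω) / 4`
    have h4 : (1 - F.Ω L β) / 4 ≤ F.descentRate L β := by
      rw [hF.roundConstants.κ_eq']; nlinarith
    calc _ ≤ (F.surrogate θ₀ - ⨅ y, F.surrogate y) / ((1 - F.Ω L β) / 4 * F.ηeff * F.Keff * T) := by
          gcongr
      _ = _ := by field_simp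
  refine le_trans ?_ (add_le_add_left (add_le_add_left (add_le_add_left (add_le_add_left
    (add_le_add_left hinit _) _) _) _) _)
  have e : 1 / (T : ℝ) * ∑ t ∈ Finset.range T, ∫ x, ‖gradient F.surrogate (F.θ θ₀ S ξ t x)‖ ^ 2 ∂P ≤
      (F.surrogate θ₀ - ⨅ y, F.surrogate y) / (F.descentRate L β * F.ηeff * F.Keff * T) +
        F.roundNoise L β κ σ / F.descentRate L β := by
    have hpos : 0 < F.descentRate L β * F.ηeff * F.Keff * T := by positivity
    rw [one_div_mul_eq_div, div_le_iff₀ hT']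
    refine le_of_mul_le_mul_left (hsum.trans_eq ?_) (mul_pos (mul_pos hηe hK) hd)
    field_simp
  linarith
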